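/- Let $d\ge 2$ and $0\le k\le d$ be integers. Write $D_j=(2\pi i)^{-1}\partial_{x_j}$, $\Delta=\sum_{j=1}^d\partial_{x_j}^2$, $\tilde x=(x_1,\dots,x_k,-x_{k+1},\dots,-x_d)$ for $x\in\mathbb R^d$, and $\langle t\rangle=(1+|t|^2)^{1/2}$. On $C_c^\infty(\mathbb R^d)\subset L^2(\mathbb R^d)$ consider the ultrahyperbolic operator of index $k$ and a conjugate operator, $$P=\sum_{j=1}^k D_j^2-\sum_{j=k+1}^d D_j^2,\qquad A=\tilde x\cdot D\,(I-(2\pi)^{-2}\Delta)^{-1}+(I-(2\pi)^{-2}\Delta)^{-1}D\cdot\tilde x .$$ Then $P$ and $A$ are essentially self-adjoint on $C_c^\infty(\mathbb R^d)$; denote their self-adjoint closures by $P$ and $A$ again. Let $I$ be a bounded interval whose closure is contained in $\mathbb R\setminus\{0\}$, let $s>1/2$, and let $W$ be either $\langle A\rangle^{-s}$ (defined by functional calculus) or the operator of multiplication by $\langle x\rangle^{-s}$. Then, for each choice of the sign $\pm$, $$\sup\{\|W(P-z)^{-1}W\|_{B(L^2(\mathbb R^d))} : z\in\mathbb C,\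 \operatorname{Re}z\in I,\ \pm\operatorname{Im}z>0\}<\infty,$$ and the limits $$W(P-\lambda\pm i0)^{-1}W=\lim_{\varepsilon\to+0}W(P-\lambda\pm i\varepsilon)^{-1}W$$ exist in the operator norm of $B(L^2(\mathbb R^d))$, uniformly in $\lambda\in I$. -/

import Mathlib

open MeasureTheory Filter Topology
open scoped SchwartzMap LineDeriv Laplacian ENNReal

namespace UltraHyp

noncomputable section

/-- Euclidean space `ℝ^d`. -/
abbrev E (d : ℕ) : Type := EuclideanSpace ℝ (Fin d)

/-- The Hilbert space `L²(ℝ^d)` of complex valued functions (Lebesgue measure). -/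
abbrev L2 (d : ℕ) : Type := Lp (α := E d) ℂ 2 volume

/-! ### Differential operators on Schwartz functions -/

/-- The sign of the `j`-th variable (counted from `0`): `+1` for the first `k` variables,
`-1` for the others. -/
def sgn (k : ℕ) {d : ℕ} (j : Fin d) : ℝ := if (j : ℕ) < k then 1 else -1

/-- `D_j = (2πi)⁻¹ ∂_j` on Schwartz functions. -/
def D {d : ℕ} (j : Fin d) : 𝓢(E d, ℂ) →L[ℂ] 𝓢(E d, ℂ) :=
  (2 * Real.pi * Complex.I : ℂ)⁻¹ •
    LineDeriv.lineDerivOpCLM ℂ 𝓢(E d, ℂ) (EuclideanSpace.single j (1 : ℝ))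

/-- Multiplication by the `j`-th component of `x̃ = (x_1, …, x_k, -x_{k+1}, …, -x_d)`. -/
def mulTilde (k : ℕ) {d : ℕ} (j : Fin d) : 𝓢(E d, ℂ) →L[ℂ] 𝓢(E d, ℂ) :=
  SchwartzMap.smulLeftCLM ℂ (fun x : E d => ((sgn k j * x j : ℝ) : ℂ))

/-- `(I - (2π)⁻² Δ)⁻¹` on Schwartz functions, the Fourier multiplier with symbol
`(1 + |ξ|²)⁻¹`; see `invHelmholtz_left_inv` and `invHelmholtz_right_inv`. -/
def invHelmholtz (d : ℕ) : 𝓢(E d, ℂ) →L[ℂ] 𝓢(E d, ℂ) :=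
  SchwartzMap.fourierMultiplierCLM ℂ (fun ξ : E d => (((1 + ‖ξ‖ ^ 2)⁻¹ : ℝ) : ℂ))

/-- `P = ∑_{j ≤ k} D_j² - ∑_{j > k} D_j²` on Schwartz functions. -/
def schwartzP (k d : ℕ) : 𝓢(E d, ℂ) →L[ℂ] 𝓢(E d, ℂ) :=
  ∑ j : Fin d, ((sgn k j : ℝ) : ℂ) • (D j ∘L D j)

/-- `A = x̃·D (I - (2π)⁻²Δ)⁻¹ + (I - (2π)⁻²Δ)⁻¹ D·x̃` on Schwartz functions. -/
def schwartzA (k d : ℕ) : 𝓢(E d, ℂ) →L[ℂ] 𝓢(E d, ℂ) :=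
  (∑ j : Fin d, mulTilde k j ∘L D j) ∘L invHelmholtz d
    + invHelmholtz d ∘L (∑ j : Fin d, D j ∘L mulTilde k j)

theorem mulTilde_apply (k : ℕ) {d : ℕ} (j : Fin d) (u : 𝓢(E d, ℂ)) (x : E d) :
    mulTilde k j u x = ((sgn k j * x j : ℝ) : ℂ) * u x := by
  have h : (fun x : E d => ((sgn k j * x j : ℝ) : ℂ)).HasTemperateGrowth := by
    have h1 : (fun x : E d => x j).HasTemperateGrowth :=
      (EuclideanSpace.proj (𝕜 := ℝ) j : E d →L[ℝ] ℝ).hasTemperateGrowth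
    exact Function.HasTemperateGrowth.comp Function.Complex.hasTemperateGrowth_ofReal
      ((Function.HasTemperateGrowth.const (sgn k j)).mul h1)
  rw [mulTilde, SchwartzMap.smulLeftCLM_apply_apply h, smul_eq_mul]

theorem symbol_hasTemperateGrowth (d : ℕ) :
    (fun ξ : E d => (((1 + ‖ξ‖ ^ 2)⁻¹ : ℝ) : ℂ)).HasTemperateGrowth := by
  have h : (fun ξ : E d => (1 + ‖ξ‖ ^ 2)⁻¹).HasTemperateGrowth := by
    simpa only [Real.rpow_neg_one] using
      Function.hasTemperateGrowth_one_add_norm_sq_rpow (E d) (-1)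
  exact Function.HasTemperateGrowth.comp Function.Complex.hasTemperateGrowth_ofReal h

theorem helmholtz_eq (d : ℕ) (u : 𝓢(E d, ℂ)) :
    u - ((2 * Real.pi) ^ 2 : ℝ)⁻¹ • Δ u
      = SchwartzMap.fourierMultiplierCLM ℂ (fun ξ : E d => ((1 + ‖ξ‖ ^ 2 : ℝ) : ℂ)) u := by
  have h1 : SchwartzMap.fourierMultiplierCLM ℂ (fun ξ : E d => ((1 + ‖ξ‖ ^ 2 : ℝ) : ℂ)) u
      = SchwartzMap.fourierMultiplierCLM ℂ (fun ξ : E d => 1 + ‖ξ‖ ^ 2) u := by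
    have hg : (fun ξ : E d => 1 + ‖ξ‖ ^ 2).HasTemperateGrowth := by fun_prop
    rw [← SchwartzMap.fourierMultiplierCLM_ofReal ℂ hg u]
    simp
  have h2 : SchwartzMap.fourierMultiplierCLM ℂ (fun ξ : E d => 1 + ‖ξ‖ ^ 2) u
      = u + SchwartzMap.fourierMultiplierCLM ℂ (fun ξ : E d => ‖ξ‖ ^ 2) u := by
    have h3 : (fun _ : E d => (1 : ℝ)).HasTemperateGrowth := by fun_prop
    have h4 : (fun ξ : E d => ‖ξ‖ ^ 2).HasTemperateGrowth := by fun_prop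
    have h5 := SchwartzMap.smulLeftCLM_add (F := ℂ) h3 h4
    have h6 := SchwartzMap.fourierMultiplierCLM_const (E := E d) (F := ℂ) (1 : ℝ)
    have h7 : SchwartzMap.fourierMultiplierCLM ℂ (fun ξ : E d => 1 + ‖ξ‖ ^ 2)
        = SchwartzMap.fourierMultiplierCLM ℂ (fun _ : E d => (1 : ℝ))
          + SchwartzMap.fourierMultiplierCLM ℂ (fun ξ : E d => ‖ξ‖ ^ 2) := by
      simp only [SchwartzMap.fourierMultiplierCLM]
      rw [← ContinuousLinearMap.comp_add, ← ContinuousLinearMap.add_comp, ← h5]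
      rfl
    rw [h7, h6]
    simp
  rw [h1, h2, SchwartzMap.laplacian_eq_fourierMultiplierCLM, smul_smul]
  have h8 : ((2 * Real.pi) ^ 2 : ℝ)⁻¹ * -(2 * Real.pi) ^ 2 = -1 := by
    have := Real.pi_pos
    field_simp
  rw [h8, neg_one_smul, sub_neg_eq_add]

theorem invHelmholtz_left_inv (d : ℕ) (u : 𝓢(E d, ℂ)) :
    invHelmholtz d (u - ((2 * Real.pi) ^ 2 : ℝ)⁻¹ • Δ u) = u := by
  have h : (fun ξ : E d => ((1 + ‖ξ‖ ^ 2 : ℝ) : ℂ)).HasTemperateGrowth :=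
    Function.HasTemperateGrowth.comp Function.Complex.hasTemperateGrowth_ofReal
      (f := fun ξ : E d => 1 + ‖ξ‖ ^ 2) (by fun_prop)
  rw [helmholtz_eq, invHelmholtz, SchwartzMap.fourierMultiplierCLM_fourierMultiplierCLM_apply
    (symbol_hasTemperateGrowth d) h]
  have h1 : ((fun ξ : E d => (((1 + ‖ξ‖ ^ 2)⁻¹ : ℝ) : ℂ)) * fun ξ : E d =>
      ((1 + ‖ξ‖ ^ 2 : ℝ) : ℂ)) = fun _ => 1 := by
    funext ξ
    have h2 : (1 + ‖ξ‖ ^ 2 : ℝ) ≠ 0 := by positivity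
    rw [Pi.mul_apply, ← Complex.ofReal_mul, inv_mul_cancel₀ h2, Complex.ofReal_one]
  rw [h1]
  simp

theorem invHelmholtz_right_inv (d : ℕ) (u : 𝓢(E d, ℂ)) :
    invHelmholtz d u - ((2 * Real.pi) ^ 2 : ℝ)⁻¹ • Δ (invHelmholtz d u) = u := by
  have h : (fun ξ : E d => ((1 + ‖ξ‖ ^ 2 : ℝ) : ℂ)).HasTemperateGrowth :=
    Function.HasTemperateGrowth.comp Function.Complex.hasTemperateGrowth_ofReal
      (f := fun ξ : E d => 1 + ‖ξ‖ ^ 2) (by fun_prop)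
  rw [helmholtz_eq, invHelmholtz, SchwartzMap.fourierMultiplierCLM_fourierMultiplierCLM_apply
    h (symbol_hasTemperateGrowth d)]
  have h1 : ((fun ξ : E d => ((1 + ‖ξ‖ ^ 2 : ℝ) : ℂ)) * fun ξ : E d =>
      (((1 + ‖ξ‖ ^ 2)⁻¹ : ℝ) : ℂ)) = fun _ => 1 := by
    funext ξ
    have h2 : (1 + ‖ξ‖ ^ 2 : ℝ) ≠ 0 := by positivity
    rw [Pi.mul_apply, ← Complex.ofReal_mul, mul_inv_cancel₀ h2, Complex.ofReal_one]
  rw [h1]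
  simp

/-! ### Unbounded operators on `L²` -/

/-- The space `C_c^∞(ℝ^d)`, as a subspace of the Schwartz space. -/
def testFunctions (d : ℕ) : Submodule ℂ 𝓢(E d, ℂ) where
  carrier := {u | HasCompactSupport u}
  add_mem' hu hv := HasCompactSupport.add hu hv
  zero_mem' := HasCompactSupport.zero
  smul_mem' _ _ hu := hu.smul_left

/-- The inclusion `C_c^∞(ℝ^d) → L²(ℝ^d)`. -/
def testToL2 (d : ℕ) : testFunctions d →ₗ[ℂ] L2 d :=
  (SchwartzMap.toLpCLM ℂ ℂ 2 (volume : Measure (E d))).toLinearMap ∘ₗ (testFunctions d).subtype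

theorem testToL2_injective (d : ℕ) : Function.Injective (testToL2 d) := fun _ _ h =>
  Subtype.ext (SchwartzMap.injective_toLp 2 (volume : Measure (E d)) h)

/-- The operator on `L²(ℝ^d)` with domain `C_c^∞(ℝ^d)` that acts there as `T`. -/
def onTest {d : ℕ} (T : 𝓢(E d, ℂ) →L[ℂ] 𝓢(E d, ℂ)) : L2 d →ₗ.[ℂ] L2 d where
  domain := LinearMap.range (testToL2 d)
  toFun := ((SchwartzMap.toLpCLM ℂ ℂ 2 (volume : Measure (E d))).toLinearMap ∘ₗ T.toLinearMap ∘ₗ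
    (testFunctions d).subtype) ∘ₗ
      (LinearEquiv.ofInjective (testToL2 d) (testToL2_injective d)).symm.toLinearMap

theorem onTest_apply {d : ℕ} (T : 𝓢(E d, ℂ) →L[ℂ] 𝓢(E d, ℂ)) (u : testFunctions d) :
    onTest T ⟨testToL2 d u, LinearMap.mem_range_self _ u⟩
      = (T (u : 𝓢(E d, ℂ))).toLp 2 (volume : Measure (E d)) := by
  have h : (LinearEquiv.ofInjective (testToL2 d) (testToL2_injective d)).symm
      ⟨testToL2 d u, LinearMap.mem_range_self _ u⟩ = u := by
    rw [LinearEquiv.symm_apply_eq]; rfl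
  change ((T ((LinearEquiv.ofInjective (testToL2 d) (testToL2_injective d)).symm
      ⟨testToL2 d u, LinearMap.mem_range_self _ u⟩ : testFunctions d)).toLp 2
        (volume : Measure (E d))) = _
  rw [h]

/-- A densely defined operator is essentially self-adjoint if its closure is self-adjoint (the
closure is then its unique self-adjoint extension). -/
def IsEssentiallySelfAdjoint {H : Type*} [NormedAddCommGroup H] [InnerProductSpace ℂ H]
    [CompleteSpace H] (T : H →ₗ.[ℂ] H) : Prop :=
  Dense (T.domain : Set H) ∧ T.IsClosable ∧ IsSelfAdjoint T.closure

/-- `R = (T - z)⁻¹`: the bounded operator `R` is a two-sided inverse of `T - z`. -/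
def IsResolventAt {H : Type*} [NormedAddCommGroup H] [NormedSpace ℂ H]
    (T : H →ₗ.[ℂ] H) (z : ℂ) (R : H →L[ℂ] H) : Prop :=
  (∀ f : H, ∃ h : R f ∈ T.domain, T ⟨R f, h⟩ - z • R f = f) ∧
    ∀ u : T.domain, R (T u - z • (u : H)) = u

theorem IsResolventAt.unique {H : Type*} [NormedAddCommGroup H] [NormedSpace ℂ H]
    {T : H →ₗ.[ℂ] H} {z : ℂ} {R S : H →L[ℂ] H} (hR : IsResolventAt T z R)
    (hS : IsResolventAt T z S) : R = S := by
  ext f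
  obtain ⟨h, hf⟩ := hS.1 f
  have h2 := hR.2 ⟨S f, h⟩
  exact (congrArg R hf.symm).trans h2

open Classical in
/-- The resolvent `(T - z)⁻¹`; it is `0` if `z` is not in the resolvent set of `T`. -/
def resolventOp {H : Type*} [NormedAddCommGroup H] [NormedSpace ℂ H]
    (T : H →ₗ.[ℂ] H) (z : ℂ) : H →L[ℂ] H :=
  if h : ∃ R : H →L[ℂ] H, IsResolventAt T z R then h.choose else 0

theorem IsResolventAt.eq_resolventOp {H : Type*} [NormedAddCommGroup H] [NormedSpace ℂ H]
    {T : H →ₗ.[ℂ] H} {z : ℂ} {R : H →L[ℂ] H} (hR : IsResolventAt T z R) :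
    resolventOp T z = R := by
  have h : ∃ R : H →L[ℂ] H, IsResolventAt T z R := ⟨R, hR⟩
  rw [resolventOp, dif_pos h]
  exact h.choose_spec.unique hR

/-- For a self-adjoint operator the resolvent exists off the real axis, so that `resolventOp` has
its intended value there. -/
theorem isResolventAt_of_isSelfAdjoint {H : Type*} [NormedAddCommGroup H] [InnerProductSpace ℂ H]
    [CompleteSpace H] {T : H →ₗ.[ℂ] H} (hT : IsSelfAdjoint T) {z : ℂ} (hz : z.im ≠ 0) :
    IsResolventAt T z (resolventOp T z) := by
  have hd : Dense (T.domain : Set H) := hT.dense_domain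
  have hadj : T.adjoint = T := LinearPMap.isSelfAdjoint_def.1 hT
  have hsym : ∀ u v : T.domain, inner ℂ (T u) (v : H) = inner ℂ (u : H) (T v) := by
    have h := LinearPMap.adjoint_isFormalAdjoint hd
    rw [hadj] at h
    exact fun u v => h u v
  have key : ∀ (w : ℂ) (u : T.domain), |w.im| * ‖(u : H)‖ ≤ ‖T u - w • (u : H)‖ := by
    intro w u
    have h1 : (inner ℂ (u : H) (T u)).im = 0 := by
      have h := hsym u u
      rw [← inner_conj_symm] at h
      exact Complex.conj_eq_iff_im.1 h
    have h2 : (inner ℂ (u : H) (T u - w • (u : H))).im = -(w.im * ‖(u : H)‖ ^ 2) := by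
      rw [inner_sub_right, inner_smul_right, inner_self_eq_norm_sq_to_K, Complex.sub_im, h1]
      simp [← Complex.ofReal_pow]
    have h3 : |w.im| * ‖(u : H)‖ ^ 2 ≤ ‖(u : H)‖ * ‖T u - w • (u : H)‖ := by
      calc |w.im| * ‖(u : H)‖ ^ 2 = |(inner ℂ (u : H) (T u - w • (u : H))).im| := by
            rw [h2, abs_neg, abs_mul, abs_of_nonneg (sq_nonneg ‖(u : H)‖)]
        _ ≤ ‖inner ℂ (u : H) (T u - w • (u : H))‖ := Complex.abs_im_le_norm _
        _ ≤ _ := norm_inner_le_norm _ _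
    rcases (norm_nonneg (u : H)).eq_or_lt with h0 | h0
    · rw [← h0, mul_zero]; exact norm_nonneg _
    · nlinarith
  let L : T.domain →ₗ[ℂ] H := T.toFun - z • T.domain.subtype
  have hL : ∀ u : T.domain, L u = T u - z • (u : H) := fun u => rfl
  have hz' : 0 < |z.im| := abs_pos.2 hz
  have hinj : Function.Injective L := by
    rw [← LinearMap.ker_eq_bot, LinearMap.ker_eq_bot']
    intro u hu
    have h := key z u
    rw [← hL, hu, norm_zero] at h
    have h2 : ‖(u : H)‖ = 0 := by
      have := norm_nonneg (u : H)
      nlinarith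
    exact Subtype.ext (norm_eq_zero.1 h2)
  have hclosed : IsClosed (LinearMap.range L : Set H) := by
    refine isClosed_of_closure_subset fun y hy => ?_
    obtain ⟨f, hf, hlim⟩ := mem_closure_iff_seq_limit.1 hy
    choose u hu using hf
    have hc : CauchySeq fun n => (u n : H) := by
      rw [Metric.cauchySeq_iff']
      intro ε hε
      obtain ⟨N, hN⟩ := Metric.cauchySeq_iff'.1 hlim.cauchySeq (|z.im| * ε) (by positivity)
      refine ⟨N, fun n hn => ?_⟩
      have h := key z (u n - u N)
      rw [← hL, map_sub, hu, hu] at h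
      have h2 := hN n hn
      rw [dist_eq_norm] at h2 ⊢
      exact lt_of_mul_lt_mul_left (h.trans_lt h2) hz'.le
    obtain ⟨x, hx⟩ := cauchySeq_tendsto_of_complete hc
    have hTx : Tendsto (fun n => T (u n)) atTop (𝓝 (y + z • x)) := by
      have h : Tendsto (fun n => L (u n) + z • (u n : H)) atTop (𝓝 (y + z • x)) := by
        refine Tendsto.add ?_ (hx.const_smul z)
        simpa only [hu] using hlim
      refine h.congr fun n => ?_
      rw [hL, sub_add_cancel]
    have hg : (x, y + z • x) ∈ T.graph := by
      have hcl : IsClosed (T.graph : Set (H × H)) := hT.isClosed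
      exact hcl.mem_of_tendsto (hx.prodMk_nhds hTx) (.of_forall fun n => T.mem_graph (u n))
    obtain ⟨v, hv1, hv2⟩ := (LinearPMap.mem_graph_iff T).1 hg
    exact ⟨v, by rw [hL, hv1, hv2]; simp⟩
  have horth : (LinearMap.range L)ᗮ = ⊥ := by
    rw [Submodule.eq_bot_iff]
    intro v hv
    have h1 : ∀ u : T.domain,
        inner ℂ ((starRingEnd ℂ) z • v) (u : H) = inner ℂ v (T u) := by
      intro u
      have h := (Submodule.mem_orthogonal' _ _).1 hv (L u) ⟨u, rfl⟩
      rw [hL, inner_sub_right, inner_smul_right, sub_eq_zero] at h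
      rw [inner_smul_left, Complex.conj_conj, h]
    have h2 : v ∈ T.adjoint.domain := LinearPMap.mem_adjoint_domain_of_exists v ⟨_, h1⟩
    have h3 : T.adjoint ⟨v, h2⟩ = (starRingEnd ℂ) z • v :=
      LinearPMap.adjoint_apply_eq hd ⟨v, h2⟩ h1
    have h4 : ∃ h : v ∈ T.domain, T ⟨v, h⟩ = (starRingEnd ℂ) z • v := by
      have h5 : ∃ h : v ∈ T.adjoint.domain, T.adjoint ⟨v, h⟩ = (starRingEnd ℂ) z • v := ⟨h2, h3⟩
      rwa [hadj] at h5
    obtain ⟨h5, h6⟩ := h4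
    have h7 := key ((starRingEnd ℂ) z) ⟨v, h5⟩
    rw [h6, sub_self, norm_zero, Complex.conj_im, abs_neg] at h7
    have h8 : ‖v‖ = 0 := by
      have := norm_nonneg v
      have h9 : |z.im| * ‖v‖ ≤ 0 := h7
      nlinarith
    exact norm_eq_zero.1 h8
  have hsurj : Function.Surjective L := by
    rw [← LinearMap.range_eq_top]
    have h := Submodule.topologicalClosure_eq_top_iff.2 horth
    rwa [hclosed.submodule_topologicalClosure_eq] at h
  let e := LinearEquiv.ofBijective L ⟨hinj, hsurj⟩
  have he : ∀ u, e u = T u - z • (u : H) := fun u => rfl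
  let R : H →L[ℂ] H := (T.domain.subtype ∘ₗ e.symm.toLinearMap).mkContinuous |z.im|⁻¹ (by
    intro f
    have h := key z (e.symm f)
    rw [← he, e.apply_symm_apply] at h
    rw [inv_mul_eq_div, le_div_iff₀ hz', mul_comm]
    exact h)
  have hR : IsResolventAt T z R := by
    refine ⟨fun f => ⟨(e.symm f).2, ?_⟩, fun u => ?_⟩
    · exact (he (e.symm f)).symm.trans (e.apply_symm_apply f)
    · exact congrArg Subtype.val (e.symm_apply_apply u)
  rwa [hR.eq_resolventOp]

/-- The operator `P` with domain `C_c^∞(ℝ^d)`. -/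
def opP₀ (k d : ℕ) : L2 d →ₗ.[ℂ] L2 d := onTest (schwartzP k d)

/-- The operator `A` with domain `C_c^∞(ℝ^d)`. -/
def opA₀ (k d : ℕ) : L2 d →ₗ.[ℂ] L2 d := onTest (schwartzA k d)

/-- The ultrahyperbolic operator `P` of index `k` on `L²(ℝ^d)`. -/
def opP (k d : ℕ) : L2 d →ₗ.[ℂ] L2 d := (opP₀ k d).closure

/-- The conjugate operator `A` on `L²(ℝ^d)`. -/
def opA (k d : ℕ) : L2 d →ₗ.[ℂ] L2 d := (opA₀ k d).closure

/-! ### Weights -/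

/-- `⟨T⟩^{-s} = (1 + T²)^{-s/2}` for a self-adjoint operator `T` and `s ≥ 0`: the power `s/2`, in the
continuous functional calculus of bounded operators, of the bounded nonnegative operator
`(1 + T²)⁻¹ = (T + i)⁻¹ (T - i)⁻¹`. -/
def japaneseOp {H : Type*} [NormedAddCommGroup H] [InnerProductSpace ℂ H] [CompleteSpace H]
    (T : H →ₗ.[ℂ] H) (s : ℝ) : H →L[ℂ] H :=
  cfc (fun t : ℝ => t ^ (s / 2)) (resolventOp T (-Complex.I) ∘L resolventOp T Complex.I)

open Classical in
/-- The operator of multiplication by an essentially bounded function on `L²(ℝ^d)`. -/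
def mulOp {d : ℕ} (g : E d → ℂ) : L2 d →L[ℂ] L2 d :=
  if hg : MemLp g ∞ (volume : Measure (E d)) then
    (ContinuousLinearMap.mul ℂ ℂ).holderL volume ∞ 2 2 (hg.toLp g)
  else 0

theorem mulOp_apply {d : ℕ} {g : E d → ℂ} (hg : MemLp g ∞ (volume : Measure (E d)))
    (f : L2 d) : mulOp g f =ᵐ[volume] fun x => g x * f x := by
  rw [mulOp, dif_pos hg]
  filter_upwards [(ContinuousLinearMap.mul ℂ ℂ).coeFn_holder (r := 2) (hg.toLp g) f,
    hg.coeFn_toLp] with x h1 h2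
  simpa [h2] using h1

/-- `⟨x⟩^{-s} = (1 + |x|²)^{-s/2}`, `s ≥ 0`, as a multiplication operator on `L²(ℝ^d)`. -/
def japaneseX (d : ℕ) (s : ℝ) : L2 d →L[ℂ] L2 d :=
  mulOp fun x : E d => (((1 + ‖x‖ ^ 2) ^ (-s / 2) : ℝ) : ℂ)

theorem japaneseX_apply (d : ℕ) {s : ℝ} (hs : 0 ≤ s) (f : L2 d) :
    japaneseX d s f =ᵐ[volume] fun x => (((1 + ‖x‖ ^ 2) ^ (-s / 2) : ℝ) : ℂ) * f x := by
  refine mulOp_apply (memLp_top_of_bound ?_ 1 (.of_forall fun x => ?_)) f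
  · refine (Complex.continuous_ofReal.comp (Continuous.rpow_const (by fun_prop)
      fun x => Or.inl (by positivity))).aestronglyMeasurable
  · rw [Complex.norm_real, Real.norm_of_nonneg (by positivity)]
    exact Real.rpow_le_one_of_one_le_of_nonpos (by nlinarith [sq_nonneg ‖x‖]) (by linarith)

end

end UltraHyp

open MeasureTheory Filter Topology
open scoped SchwartzMap LineDeriv Laplacian ENNReal

namespace UltraHyp

noncomputable section

open scoped FourierTransform ComplexConjugate ContDiff

/-! The proof is Mourre's method, carried out with explicit symbols. On the Fourier side `P` is
multiplication by a quadratic form p(ξ), and the commutator of `A` with a multiplier g is again a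
multiplier, (i/π)(1+|ξ|²)⁻¹ ∇g·ξ̃ (`schwartzA_fmul`). The reflection in ξ̃ turns the indefinite form
into a definite one, ∇p·ξ̃ = 2|ξ|². Since |p(ξ)| ≤ |ξ|², the surface p = λ with λ ≠ 0 keeps away
from ξ = 0, so the commutator is bounded below there.

With R = (P - z)⁻¹ this yields R² = iπ h [A, R] + E, where the multipliers h and E are bounded
uniformly as z approaches the real axis (`fmul_symR_sq`, `norm_symE_le`). No energy cutoff is
needed. Moving `A` onto the vectors, ⟨f, R²g⟩ is controlled by first powers of the resolvent for f,
g in the domain of `A` (`exists_sqBound_opP`).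

Put F(ε) = ⟨f, R(λ+iε)f⟩. Then F' = i⟨f, R²f⟩, while ε‖Rf‖² ≤ |F|. Hence |F'| is at most a constant
times a√(|F|/ε) + N², where N bounds ‖f‖ and a bounds ‖f‖ + ‖Af‖. The singularity ε^(-1/2) is
integrable, and starting the integration at ε = N/a gives a bound by Na instead of a²
(`norm_le_of_quadratic_deriv_bound`). For two vectors the bound is √(Na)√(N'a')
(`norm_inner_resolventOp_le_of_sqBound`), and F is Hölder continuous of order 1/2 in ε.

The geometric mean √(Na) is what allows every s > 1/2. Either weight splits into dyadic pieces w_n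
with ‖w_n‖ of order 2^(-ns) and ‖A w_n‖ of order 2^(-n(s-1)), so the geometric means decay like
2^(-n(s-1/2)) and the double series of the pieces w_n R w_m converges uniformly
(`hasDyadicDecomposition_of_calculus`, `limiting_absorption_upper`). The lower half-plane follows by
taking adjoints.

Essential self-adjointness of `P` holds because P - w maps the Schwartz space onto itself for
nonreal w. For `A`, the commutators with the cutoffs (1+r²|x|²)⁻¹ are bounded uniformly in r
(`norm_schwartzA_cutS_le`), which excludes deficiency vectors at ±iκ for κ above that bound. -/

/-! ### Functions of temperate growth -/

/-- The inverse of a real function of temperate growth that is bounded below by a positive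
constant has temperate growth. -/
theorem hasTemperateGrowth_inv {V : Type*} [NormedAddCommGroup V] [NormedSpace ℝ V] {g : V → ℝ}
    (hg : g.HasTemperateGrowth) {c : ℝ} (hc : 0 < c) (h : ∀ x, c ≤ g x) :
    (fun x => (g x)⁻¹).HasTemperateGrowth := by
  -- Halving c gives an open set containing the range of `g`, on which the derivatives ±n! x^(-n-1)
  -- of the inverse are still bounded.
  set t : Set ℝ := Set.Ioi (c / 2)
  have ht : Set.range g ⊆ t := by
    rintro - ⟨y, rfl⟩
    exact (half_lt_self hc).trans_le (h y)
  have hpos : ∀ x ∈ t, (0 : ℝ) < x := fun x hx => (half_pos hc).trans hx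
  have hdiff : ContDiffOn ℝ ∞ (fun x : ℝ => x⁻¹) t :=
    contDiffOn_fun_id.inv fun x hx => (hpos x hx).ne'
  have hunique : UniqueDiffOn ℝ t := isOpen_Ioi.uniqueDiffOn
  refine Function.HasTemperateGrowth.comp' (g := fun x : ℝ => x⁻¹) ht hunique hdiff ?_ hg
  intro N
  refine ⟨0, ∑ n ∈ Finset.range (N + 1), (n.factorial : ℝ) * (c / 2)⁻¹ ^ (n + 1), by positivity,
    fun n hn x hx => ?_⟩
  have hx0 := hpos x hx
  have hcd : ContDiffAt ℝ n (fun x : ℝ => x⁻¹) x := contDiffAt_inv ℝ hx0.ne'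
  rw [norm_iteratedFDerivWithin_eq_norm_iteratedDerivWithin,
    iteratedDerivWithin_eq_iteratedDeriv hunique hcd hx, iteratedDeriv_eq_iterate,
    iter_deriv_inv, pow_zero, mul_one]
  have h1 : ‖(-1 : ℝ) ^ n * (n.factorial : ℝ) * x ^ (-1 - (n : ℤ))‖
      = (n.factorial : ℝ) * x⁻¹ ^ (n + 1) := by
    rw [norm_mul, norm_mul, norm_pow, norm_neg, norm_one, one_pow, one_mul, Real.norm_natCast,
      norm_zpow, Real.norm_of_nonneg hx0.le]
    congr 1
    rw [inv_pow, ← zpow_natCast, ← zpow_neg]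
    congr 1
    push_cast
    ring
  rw [h1]
  refine le_trans ?_ (Finset.single_le_sum
    (f := fun n : ℕ => (n.factorial : ℝ) * (c / 2)⁻¹ ^ (n + 1))
    (fun _ _ => by positivity) (Finset.mem_range.2 (Nat.lt_succ_of_le hn)))
  have h2 : x⁻¹ ≤ (c / 2)⁻¹ := inv_anti₀ (half_pos hc) (le_of_lt hx)
  gcongr

theorem hasTemperateGrowth_ofReal {V : Type*} [NormedAddCommGroup V] [NormedSpace ℝ V] {g : V → ℝ}
    (hg : g.HasTemperateGrowth) : (fun x => ((g x : ℝ) : ℂ)).HasTemperateGrowth :=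
  Function.HasTemperateGrowth.comp Function.Complex.hasTemperateGrowth_ofReal hg

theorem hasTemperateGrowth_conj {V : Type*} [NormedAddCommGroup V] [NormedSpace ℝ V] {g : V → ℂ}
    (hg : g.HasTemperateGrowth) : (fun x => conj (g x)).HasTemperateGrowth :=
  Function.HasTemperateGrowth.comp
    (Complex.conjCLE.toContinuousLinearMap : ℂ →L[ℝ] ℂ).hasTemperateGrowth hg

/-- Write (g - z)⁻¹ as the conjugate of g - z over |g - z|², whose denominator is at least (Im z)².
This is why the resolvent of `P` preserves the Schwartz space off the real axis. -/
theorem hasTemperateGrowth_inv_ofReal_sub {V : Type*} [NormedAddCommGroup V] [NormedSpace ℝ V]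
    {g : V → ℝ} (hg : g.HasTemperateGrowth) {z : ℂ} (hz : z.im ≠ 0) :
    (fun x => ((g x : ℂ) - z)⁻¹).HasTemperateGrowth := by
  have h1 : (fun x => ((g x - z.re) ^ 2 + z.im ^ 2)⁻¹).HasTemperateGrowth := by
    refine hasTemperateGrowth_inv (c := z.im ^ 2) ?_ (by positivity) fun x => ?_
    · exact ((hg.sub (.const _)).pow 2).add (.const _)
    · nlinarith [sq_nonneg (g x - z.re)]
  have h2 : (fun x => conj ((g x : ℂ) - z)).HasTemperateGrowth :=
    hasTemperateGrowth_conj ((hasTemperateGrowth_ofReal hg).sub (.const _))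
  have h3 : (fun x => ((g x : ℂ) - z)⁻¹)
      = fun x => (((((g x - z.re) ^ 2 + z.im ^ 2)⁻¹ : ℝ)) : ℂ) * conj ((g x : ℂ) - z) := by
    funext x
    rw [Complex.inv_def, mul_comm, Complex.normSq_apply]
    congr 3
    simp
    ring
  rw [h3]
  exact (hasTemperateGrowth_ofReal h1).mul h2

/-! ### Multiplication operators and Fourier multipliers on Schwartz functions -/

/-- The inclusion of the Schwartz space into `L²`. -/
abbrev toL2 (d : ℕ) : 𝓢(E d, ℂ) →L[ℂ] L2 d :=
  SchwartzMap.toLpCLM ℂ ℂ 2 (volume : Measure (E d))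

/-- Multiplication by a function of temperate growth. -/
abbrev mulS {d : ℕ} (g : E d → ℂ) : 𝓢(E d, ℂ) →L[ℂ] 𝓢(E d, ℂ) := SchwartzMap.smulLeftCLM ℂ g

/-- The Fourier multiplier with a symbol of temperate growth. -/
abbrev fmul {d : ℕ} (g : E d → ℂ) : 𝓢(E d, ℂ) →L[ℂ] 𝓢(E d, ℂ) :=
  SchwartzMap.fourierMultiplierCLM ℂ g

theorem denseRange_toL2 (d : ℕ) : DenseRange (toL2 d) :=
  SchwartzMap.denseRange_toLpCLM (F := ℂ) (p := 2) (μ := (volume : Measure (E d)))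
    ENNReal.ofNat_ne_top

theorem norm_toL2_mulS_le {d : ℕ} {g : E d → ℂ} (hg : g.HasTemperateGrowth) {C : ℝ}
    (hC : ∀ x, ‖g x‖ ≤ C) (u : 𝓢(E d, ℂ)) : ‖toL2 d (mulS g u)‖ ≤ C * ‖toL2 d u‖ := by
  refine Lp.norm_le_mul_norm_of_ae_le_mul ?_
  filter_upwards [(mulS g u).coeFn_toLp 2 (volume : Measure (E d)),
    u.coeFn_toLp 2 (volume : Measure (E d))] with x h1 h2
  rw [SchwartzMap.toLpCLM_apply, SchwartzMap.toLpCLM_apply, h1, h2,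
    SchwartzMap.smulLeftCLM_apply_apply hg, norm_smul]
  exact mul_le_mul_of_nonneg_right (hC x) (norm_nonneg _)

theorem inner_toL2_mulS {d : ℕ} {g : E d → ℂ} (hg : g.HasTemperateGrowth) (u v : 𝓢(E d, ℂ)) :
    inner ℂ (toL2 d (mulS g u)) (toL2 d v)
      = inner ℂ (toL2 d u) (toL2 d (mulS (fun x => conj (g x)) v)) := by
  rw [SchwartzMap.toLpCLM_apply, SchwartzMap.toLpCLM_apply, SchwartzMap.toLpCLM_apply,
    SchwartzMap.toLpCLM_apply, SchwartzMap.inner_toL2_toL2_eq _ _ (volume : Measure (E d)),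
    SchwartzMap.inner_toL2_toL2_eq _ _ (volume : Measure (E d))]
  refine integral_congr_ae (.of_forall fun x => ?_)
  simp only [SchwartzMap.smulLeftCLM_apply_apply hg,
    SchwartzMap.smulLeftCLM_apply_apply (hasTemperateGrowth_conj hg), smul_eq_mul]
  simp [mul_left_comm, mul_comm]

theorem norm_toL2_fourier {d : ℕ} (u : 𝓢(E d, ℂ)) : ‖toL2 d (𝓕 u)‖ = ‖toL2 d u‖ :=
  SchwartzMap.norm_fourier_toL2_eq u

theorem inner_toL2_fourier {d : ℕ} (u v : 𝓢(E d, ℂ)) :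
    inner ℂ (toL2 d (𝓕 u)) (toL2 d (𝓕 v)) = inner ℂ (toL2 d u) (toL2 d v) :=
  SchwartzMap.inner_fourier_toL2_eq u v

theorem fourier_fmul {d : ℕ} (g : E d → ℂ) (u : 𝓢(E d, ℂ)) : 𝓕 (fmul g u) = mulS g (𝓕 u) := by
  rw [SchwartzMap.fourierMultiplierCLM_apply, FourierTransform.fourier_fourierInv_eq]

theorem fourier_injective {d : ℕ} {u v : 𝓢(E d, ℂ)} (h : 𝓕 u = 𝓕 v) : u = v := by
  rw [← FourierTransform.fourierInv_fourier_eq (F := 𝓢(E d, ℂ)) u, h,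
    FourierTransform.fourierInv_fourier_eq (F := 𝓢(E d, ℂ))]

theorem norm_toL2_fmul_le {d : ℕ} {g : E d → ℂ} (hg : g.HasTemperateGrowth) {C : ℝ}
    (hC : ∀ x, ‖g x‖ ≤ C) (u : 𝓢(E d, ℂ)) : ‖toL2 d (fmul g u)‖ ≤ C * ‖toL2 d u‖ := by
  rw [← norm_toL2_fourier, fourier_fmul, ← norm_toL2_fourier u]
  exact norm_toL2_mulS_le hg hC _

theorem inner_toL2_fmul {d : ℕ} {g : E d → ℂ} (hg : g.HasTemperateGrowth) (u v : 𝓢(E d, ℂ)) :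
    inner ℂ (toL2 d (fmul g u)) (toL2 d v)
      = inner ℂ (toL2 d u) (toL2 d (fmul (fun x => conj (g x)) v)) := by
  rw [← inner_toL2_fourier, fourier_fmul, inner_toL2_mulS hg, ← fourier_fmul, inner_toL2_fourier]

theorem fmul_fmul {d : ℕ} {g h : E d → ℂ} (hg : g.HasTemperateGrowth) (hh : h.HasTemperateGrowth)
    (u : 𝓢(E d, ℂ)) : fmul g (fmul h u) = fmul (fun x => g x * h x) u :=
  SchwartzMap.fourierMultiplierCLM_fourierMultiplierCLM_apply hg hh u

theorem mulS_mulS {d : ℕ} {g h : E d → ℂ} (hg : g.HasTemperateGrowth) (hh : h.HasTemperateGrowth)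
    (u : 𝓢(E d, ℂ)) : mulS g (mulS h u) = mulS (fun x => g x * h x) u :=
  SchwartzMap.smulLeftCLM_smulLeftCLM_apply hg hh u

theorem fmul_comm {d : ℕ} {g h : E d → ℂ} (hg : g.HasTemperateGrowth) (hh : h.HasTemperateGrowth)
    (u : 𝓢(E d, ℂ)) : fmul g (fmul h u) = fmul h (fmul g u) := by
  rw [fmul_fmul hg hh, fmul_fmul hh hg]
  simp only [mul_comm]

theorem fmul_add {d : ℕ} {g h : E d → ℂ} (hg : g.HasTemperateGrowth) (hh : h.HasTemperateGrowth)
    (u : 𝓢(E d, ℂ)) : fmul (fun x => g x + h x) u = fmul g u + fmul h u := by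
  apply fourier_injective
  rw [FourierTransform.fourier_add, fourier_fmul, fourier_fmul, fourier_fmul]
  ext x
  simp only [add_apply, SchwartzMap.smulLeftCLM_apply_apply hg,
    SchwartzMap.smulLeftCLM_apply_apply hh,
    SchwartzMap.smulLeftCLM_apply_apply (hg.fun_add hh), smul_eq_mul, add_mul]

theorem fmul_const_mul {d : ℕ} {g : E d → ℂ} (hg : g.HasTemperateGrowth) (c : ℂ)
    (u : 𝓢(E d, ℂ)) : fmul (fun x => c * g x) u = c • fmul g u := by
  have h := SchwartzMap.fourierMultiplierCLM_smul (F := ℂ) hg c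
  exact congrArg (fun T : 𝓢(E d, ℂ) →L[ℂ] 𝓢(E d, ℂ) => T u) h

theorem fmul_sum {d : ℕ} {ι : Type*} {s : Finset ι} {g : ι → E d → ℂ}
    (hg : ∀ i ∈ s, (g i).HasTemperateGrowth) (u : 𝓢(E d, ℂ)) :
    fmul (fun x => ∑ i ∈ s, g i x) u = ∑ i ∈ s, fmul (g i) u := by
  have h := SchwartzMap.fourierMultiplierCLM_sum ℂ hg
  have h2 := congrArg (fun T : 𝓢(E d, ℂ) →L[ℂ] 𝓢(E d, ℂ) => T u) h
  simpa using h2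

theorem fmul_one {d : ℕ} (u : 𝓢(E d, ℂ)) : fmul (fun _ => 1) u = u := by
  simp

/-! ### Coordinates and their commutators with Fourier multipliers -/

/-- The coordinate functions. -/
def coord {d : ℕ} (j : Fin d) (x : E d) : ℂ := ((x j : ℝ) : ℂ)

theorem hasTemperateGrowth_coord_real {d : ℕ} (j : Fin d) :
    (fun x : E d => x j).HasTemperateGrowth :=
  (EuclideanSpace.proj (𝕜 := ℝ) j : E d →L[ℝ] ℝ).hasTemperateGrowth

theorem hasTemperateGrowth_coord {d : ℕ} (j : Fin d) : (coord (d := d) j).HasTemperateGrowth :=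
  hasTemperateGrowth_ofReal (hasTemperateGrowth_coord_real j)

theorem inner_single {d : ℕ} (j : Fin d) (x : E d) :
    inner ℝ x (EuclideanSpace.single j (1 : ℝ)) = x j := by
  rw [EuclideanSpace.inner_single_right]
  simp

/-- The partial derivative in the direction of the `j`-th basis vector. -/
def pderiv {d : ℕ} (j : Fin d) (g : E d → ℂ) (x : E d) : ℂ :=
  fderiv ℝ g x (EuclideanSpace.single j 1)

theorem hasTemperateGrowth_fderiv {V W : Type*} [NormedAddCommGroup V] [NormedSpace ℝ V]
    [NormedAddCommGroup W] [NormedSpace ℝ W] {g : V → W} (hg : g.HasTemperateGrowth) :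
    (fderiv ℝ g).HasTemperateGrowth := by
  refine ⟨hg.1.fderiv_right (by simp), fun n => ?_⟩
  obtain ⟨k, C, h⟩ := hg.2 (n + 1)
  refine ⟨k, C, fun x => ?_⟩
  rw [norm_iteratedFDeriv_fderiv]
  exact h x

theorem hasTemperateGrowth_pderiv {d : ℕ} (j : Fin d) {g : E d → ℂ} (hg : g.HasTemperateGrowth) :
    (pderiv j g).HasTemperateGrowth :=
  Function.HasTemperateGrowth.comp
    (ContinuousLinearMap.apply ℝ ℂ (EuclideanSpace.single j (1 : ℝ))).hasTemperateGrowth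
    (hasTemperateGrowth_fderiv hg)

theorem fourier_mulS_coord {d : ℕ} (j : Fin d) (u : 𝓢(E d, ℂ)) :
    𝓕 (mulS (coord j) u)
      = (Complex.I / (2 * Real.pi)) • ∂_{EuclideanSpace.single j (1 : ℝ)} (𝓕 u) := by
  have h := SchwartzMap.lineDerivOp_fourier_eq u (EuclideanSpace.single j (1 : ℝ))
  have h1 : SchwartzMap.smulLeftCLM ℂ (inner ℝ · (EuclideanSpace.single j (1 : ℝ)) : E d → ℝ) u
      = mulS (coord j) u := by
    rw [← SchwartzMap.smulLeftCLM_ofReal ℂ (by fun_prop)]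
    congr 2
    funext x
    simp only [inner_single, coord]
    rfl
  rw [h, h1, FourierTransform.fourier_smul, smul_smul]
  have h2 : Complex.I / (2 * Real.pi) * -(2 * Real.pi * Complex.I) = 1 := by
    have : (Real.pi : ℂ) ≠ 0 := by exact_mod_cast Real.pi_ne_zero
    field_simp
    simp
  rw [h2, one_smul]

/-- The commutator of a coordinate with a Fourier multiplier. -/
theorem mulS_coord_fmul {d : ℕ} (j : Fin d) {g : E d → ℂ} (hg : g.HasTemperateGrowth)
    (u : 𝓢(E d, ℂ)) :
    mulS (coord j) (fmul g u) = fmul g (mulS (coord j) u)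
      + fmul (fun ξ => Complex.I / (2 * Real.pi) * pderiv j g ξ) u := by
  have hc : (fun ξ => Complex.I / (2 * Real.pi) * pderiv j g ξ).HasTemperateGrowth :=
    (Function.HasTemperateGrowth.const _).mul (hasTemperateGrowth_pderiv j hg)
  apply fourier_injective
  rw [FourierTransform.fourier_add, fourier_mulS_coord, fourier_fmul, fourier_fmul, fourier_fmul,
    fourier_mulS_coord, ContinuousLinearMap.map_smul]
  ext ξ
  simp only [add_apply, smul_apply, SchwartzMap.smulLeftCLM_apply_apply hg,
    SchwartzMap.smulLeftCLM_apply_apply hc, SchwartzMap.lineDerivOp_apply_eq_fderiv]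
  have h1 : (fun ξ => g ξ • (𝓕 u) ξ) = mulS g (𝓕 u) := (SchwartzMap.smulLeftCLM_apply hg _).symm
  rw [← h1, fderiv_fun_smul (hg.1.differentiable (by simp) ξ) ((𝓕 u).differentiableAt)]
  simp [pderiv]
  ring

/-! ### The symbols of `P` and `A` -/

/-- The symbol of `P`. -/
def symP (k : ℕ) {d : ℕ} (ξ : E d) : ℝ := ∑ j, sgn k j * ξ j ^ 2

/-- The symbol `(1 + |ξ|²)⁻¹`. -/
def symH {d : ℕ} (ξ : E d) : ℝ := (1 + ‖ξ‖ ^ 2)⁻¹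

/-- The symbol of `D_j (I - (2π)⁻²Δ)⁻¹`. -/
def symT {d : ℕ} (j : Fin d) (ξ : E d) : ℂ := coord j ξ * (symH ξ : ℂ)

/-- The reflected vector `(ξ_1, …, ξ_k, -ξ_{k+1}, …, -ξ_d)`. -/
def tilde (k : ℕ) {d : ℕ} (ξ : E d) : E d := WithLp.toLp 2 fun j => sgn k j * ξ j

theorem sgn_sq (k : ℕ) {d : ℕ} (j : Fin d) : sgn k j * sgn k j = 1 := by
  unfold sgn; split_ifs <;> norm_num

theorem abs_sgn (k : ℕ) {d : ℕ} (j : Fin d) : |sgn k j| = 1 := by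
  unfold sgn; split_ifs <;> norm_num

theorem hasTemperateGrowth_symP (k d : ℕ) : (symP k (d := d)).HasTemperateGrowth :=
  Function.HasTemperateGrowth.sum (s := Finset.univ) fun j _ =>
    (Function.HasTemperateGrowth.const (sgn k j)).mul ((hasTemperateGrowth_coord_real j).pow 2)

theorem hasTemperateGrowth_norm_sq (d : ℕ) : (fun ξ : E d => ‖ξ‖ ^ 2).HasTemperateGrowth := by
  fun_prop

theorem hasTemperateGrowth_symH (d : ℕ) : (symH (d := d)).HasTemperateGrowth :=
  hasTemperateGrowth_inv ((Function.HasTemperateGrowth.const 1).add (hasTemperateGrowth_norm_sq d))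
    one_pos fun x => by simp

theorem hasTemperateGrowth_symT {d : ℕ} (j : Fin d) : (symT (d := d) j).HasTemperateGrowth :=
  (hasTemperateGrowth_coord j).mul (hasTemperateGrowth_ofReal (hasTemperateGrowth_symH d))

theorem symH_pos {d : ℕ} (ξ : E d) : 0 < symH ξ := by unfold symH; positivity

theorem symH_le_one {d : ℕ} (ξ : E d) : symH ξ ≤ 1 :=
  inv_le_one_of_one_le₀ (by nlinarith [sq_nonneg ‖ξ‖])

theorem symH_mul {d : ℕ} (ξ : E d) : symH ξ * (1 + ‖ξ‖ ^ 2) = 1 :=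
  inv_mul_cancel₀ (by positivity)

theorem norm_sq_mul_symH_le {d : ℕ} (ξ : E d) : ‖ξ‖ ^ 2 * symH ξ ≤ 1 := by
  nlinarith [symH_mul ξ, symH_pos ξ]

theorem abs_coord_le {d : ℕ} (j : Fin d) (x : E d) : |x j| ≤ ‖x‖ := by
  simpa using PiLp.norm_apply_le x j

theorem norm_coord_le {d : ℕ} (j : Fin d) (x : E d) : ‖coord j x‖ ≤ ‖x‖ := by
  rw [coord, Complex.norm_real]; exact abs_coord_le j x

/-- This is the purpose of the Helmholtz inverse in `A`: the derivatives are tamed to bounded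
operators, so `A` grows only like |x|. -/
theorem norm_symT_le {d : ℕ} (j : Fin d) (ξ : E d) : ‖symT j ξ‖ ≤ 1 := by
  rw [symT, norm_mul, Complex.norm_real, Real.norm_of_nonneg (symH_pos ξ).le]
  have h := norm_coord_le j ξ
  have h1 := symH_mul ξ
  have h2 := symH_pos ξ
  have h3 : ‖ξ‖ ≤ 1 + ‖ξ‖ ^ 2 := by nlinarith [sq_nonneg (‖ξ‖ - 1)]
  nlinarith [norm_nonneg (coord j ξ)]

theorem inner_tilde_self (k : ℕ) {d : ℕ} (ξ : E d) : inner ℝ ξ (tilde k ξ) = symP k ξ := by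
  rw [PiLp.inner_apply, symP]
  refine Finset.sum_congr rfl fun j _ => ?_
  simp [tilde]
  ring

theorem norm_sq_eq_sum {d : ℕ} (ξ : E d) : ‖ξ‖ ^ 2 = ∑ j, ξ j ^ 2 := by
  rw [EuclideanSpace.norm_sq_eq]
  simp

/-- Keeps the energy surface p = λ at |ξ|² ≥ |λ|, away from the critical point ξ = 0; energy zero is
excluded for this reason. -/
theorem abs_symP_le (k : ℕ) {d : ℕ} (ξ : E d) : |symP k ξ| ≤ ‖ξ‖ ^ 2 := by
  rw [norm_sq_eq_sum, symP]
  refine (Finset.abs_sum_le_sum_abs _ _).trans (Finset.sum_le_sum fun j _ => ?_)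
  rw [abs_mul, abs_sgn, one_mul, abs_of_nonneg (sq_nonneg _)]

theorem hasFDerivAt_norm_sq {d : ℕ} (ξ : E d) :
    HasFDerivAt (fun ξ : E d => ‖ξ‖ ^ 2) (2 • innerSL ℝ ξ) ξ :=
  (hasStrictFDerivAt_norm_sq ξ).hasFDerivAt

theorem hasFDerivAt_coord {d : ℕ} (j : Fin d) (ξ : E d) :
    HasFDerivAt (fun ξ : E d => ξ j) (EuclideanSpace.proj (𝕜 := ℝ) j : E d →L[ℝ] ℝ) ξ :=
  (EuclideanSpace.proj (𝕜 := ℝ) j : E d →L[ℝ] ℝ).hasFDerivAt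

/-- Each sign occurs once in p and once in ξ̃, so it is squared away. This is the positivity on
which the commutator method rests. -/
theorem fderiv_symP_tilde (k : ℕ) {d : ℕ} (ξ : E d) :
    fderiv ℝ (symP k (d := d)) ξ (tilde k ξ) = 2 * ‖ξ‖ ^ 2 := by
  have h : HasFDerivAt (symP k (d := d)) (∑ j, sgn k j • ((2 : ℕ) • ξ j ^ (2 - 1)) •
      (EuclideanSpace.proj (𝕜 := ℝ) j : E d →L[ℝ] ℝ)) ξ :=
    HasFDerivAt.fun_sum fun j _ => ((hasFDerivAt_coord j ξ).pow 2).const_mul (sgn k j)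
  rw [h.fderiv, norm_sq_eq_sum, Finset.mul_sum, sum_apply]
  refine Finset.sum_congr rfl fun j _ => ?_
  simp [tilde]
  linear_combination (2 * ξ j ^ 2) * sgn_sq k j

/-! ### `P` and `A` in terms of multipliers -/

theorem D_eq_fmul {d : ℕ} (j : Fin d) (u : 𝓢(E d, ℂ)) : D j u = fmul (coord j) u := by
  have h := SchwartzMap.lineDeriv_eq_fourierMultiplierCLM (EuclideanSpace.single j (1 : ℝ)) u
  rw [← SchwartzMap.fourierMultiplierCLM_ofReal ℂ (by fun_prop)] at h
  have h1 : (fun x : E d => ((inner ℝ x (EuclideanSpace.single j (1 : ℝ)) : ℝ) : ℂ)) = coord j := by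
    funext x
    rw [inner_single, coord]
  have h3 : ∂_{EuclideanSpace.single j (1 : ℝ)} u
      = (2 * Real.pi * Complex.I : ℂ) • fmul (coord j) u := by
    rw [h, ← h1]; rfl
  have h2 : (2 * Real.pi * Complex.I : ℂ) ≠ 0 := by
    simp [Real.pi_ne_zero]
  change (2 * Real.pi * Complex.I : ℂ)⁻¹ • ∂_{EuclideanSpace.single j (1 : ℝ)} u = _
  rw [h3, smul_smul, inv_mul_cancel₀ h2, one_smul]

theorem invHelmholtz_eq_fmul {d : ℕ} (u : 𝓢(E d, ℂ)) :
    invHelmholtz d u = fmul (fun ξ => (symH ξ : ℂ)) u := rfl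

theorem mulTilde_eq (k : ℕ) {d : ℕ} (j : Fin d) (u : 𝓢(E d, ℂ)) :
    mulTilde k j u = ((sgn k j : ℝ) : ℂ) • mulS (coord j) u := by
  ext x
  rw [mulTilde_apply, smul_apply, SchwartzMap.smulLeftCLM_apply_apply (hasTemperateGrowth_coord j)]
  simp [coord, mul_assoc]

theorem schwartzP_eq_fmul (k d : ℕ) (u : 𝓢(E d, ℂ)) :
    schwartzP k d u = fmul (fun ξ => ((symP k ξ : ℝ) : ℂ)) u := by
  have h : (fun ξ : E d => ((symP k ξ : ℝ) : ℂ))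
      = fun ξ => ∑ j, ((sgn k j : ℝ) : ℂ) * (coord j ξ * coord j ξ) := by
    funext ξ
    simp [symP, coord, sq]
  have hc : ∀ j : Fin d, (fun ξ : E d => coord j ξ * coord j ξ).HasTemperateGrowth := fun j =>
    (hasTemperateGrowth_coord j).mul (hasTemperateGrowth_coord j)
  rw [h, fmul_sum fun j _ => (Function.HasTemperateGrowth.const _).fun_mul (hc j), schwartzP,
    sum_apply]
  refine Finset.sum_congr rfl fun j _ => ?_
  rw [fmul_const_mul (hc j), ← fmul_fmul (hasTemperateGrowth_coord j) (hasTemperateGrowth_coord j),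
    ← D_eq_fmul, ← D_eq_fmul]
  rfl

/-- Form in which the symmetry of `A` is visible: coordinates and the multipliers `symT j` are
symmetric and occur in both orders. -/
theorem schwartzA_eq (k d : ℕ) (u : 𝓢(E d, ℂ)) :
    schwartzA k d u = ∑ j, ((sgn k j : ℝ) : ℂ) •
      (mulS (coord j) (fmul (symT j) u) + fmul (symT j) (mulS (coord j) u)) := by
  have hH := hasTemperateGrowth_ofReal (hasTemperateGrowth_symH d)
  have h : schwartzA k d u = (∑ j, mulTilde k j (D j (invHelmholtz d u)))
      + invHelmholtz d (∑ j, D j (mulTilde k j u)) := by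
    simp [schwartzA]
  rw [h, map_sum, ← Finset.sum_add_distrib]
  refine Finset.sum_congr rfl fun j _ => ?_
  rw [mulTilde_eq, mulTilde_eq, map_smul, map_smul, D_eq_fmul, D_eq_fmul, invHelmholtz_eq_fmul,
    invHelmholtz_eq_fmul, fmul_fmul (hasTemperateGrowth_coord j) hH,
    fmul_comm hH (hasTemperateGrowth_coord j), fmul_fmul (hasTemperateGrowth_coord j) hH, smul_add]
  rfl

theorem inner_schwartzP (k d : ℕ) (u v : 𝓢(E d, ℂ)) :
    inner ℂ (toL2 d (schwartzP k d u)) (toL2 d v)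
      = inner ℂ (toL2 d u) (toL2 d (schwartzP k d v)) := by
  rw [schwartzP_eq_fmul, schwartzP_eq_fmul,
    inner_toL2_fmul (hasTemperateGrowth_ofReal (hasTemperateGrowth_symP k d))]
  simp only [Complex.conj_ofReal]

theorem inner_mulS_coord {d : ℕ} (j : Fin d) (u v : 𝓢(E d, ℂ)) :
    inner ℂ (toL2 d (mulS (coord j) u)) (toL2 d v)
      = inner ℂ (toL2 d u) (toL2 d (mulS (coord j) v)) := by
  rw [inner_toL2_mulS (hasTemperateGrowth_coord j)]
  have h : (fun x : E d => conj (coord j x)) = coord j := by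
    funext x; simp [coord]
  rw [h]

theorem inner_fmul_symT {d : ℕ} (j : Fin d) (u v : 𝓢(E d, ℂ)) :
    inner ℂ (toL2 d (fmul (symT j) u)) (toL2 d v)
      = inner ℂ (toL2 d u) (toL2 d (fmul (symT j) v)) := by
  rw [inner_toL2_fmul (hasTemperateGrowth_symT j)]
  have h : (fun x : E d => conj (symT j x)) = symT j := by
    funext x; simp [symT, coord]
  rw [h]

theorem inner_schwartzA (k d : ℕ) (u v : 𝓢(E d, ℂ)) :
    inner ℂ (toL2 d (schwartzA k d u)) (toL2 d v)
      = inner ℂ (toL2 d u) (toL2 d (schwartzA k d v)) := by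
  rw [schwartzA_eq, schwartzA_eq, map_sum, map_sum, sum_inner, inner_sum]
  refine Finset.sum_congr rfl fun j _ => ?_
  rw [map_smul, map_smul, map_add, map_add, inner_smul_left, inner_smul_right, inner_add_left,
    inner_add_right, inner_mulS_coord, inner_fmul_symT, inner_fmul_symT, inner_mulS_coord,
    Complex.conj_ofReal, add_comm]

/-- The commutator of `A` with a Fourier multiplier. -/
theorem schwartzA_fmul (k d : ℕ) {g : E d → ℂ} (hg : g.HasTemperateGrowth) (u : 𝓢(E d, ℂ)) :
    schwartzA k d (fmul g u) = fmul g (schwartzA k d u)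
      + fmul (fun ξ => Complex.I / Real.pi * ((symH ξ : ℂ) * fderiv ℝ g ξ (tilde k ξ))) u := by
  have hp : ∀ j : Fin d, (fun ξ => Complex.I / (2 * Real.pi) * pderiv j g ξ).HasTemperateGrowth :=
    fun j => (Function.HasTemperateGrowth.const _).mul (hasTemperateGrowth_pderiv j hg)
  have h : (fun ξ => Complex.I / Real.pi * ((symH ξ : ℂ) * fderiv ℝ g ξ (tilde k ξ)))
      = fun ξ => ∑ j, (2 * ((sgn k j : ℝ) : ℂ)) *
        (symT j ξ * (Complex.I / (2 * Real.pi) * pderiv j g ξ)) := by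
    funext ξ
    have h1 : tilde k ξ = ∑ j, (sgn k j * ξ j) • EuclideanSpace.single j (1 : ℝ) := by
      ext i
      simp [tilde, Pi.single_apply, WithLp.ofLp_sum, Finset.sum_apply]
    rw [h1, map_sum, Finset.mul_sum, Finset.mul_sum]
    refine Finset.sum_congr rfl fun j _ => ?_
    rw [map_smul, symT, coord, pderiv]
    have : (Real.pi : ℂ) ≠ 0 := by exact_mod_cast Real.pi_ne_zero
    rw [Complex.real_smul]
    push_cast
    field_simp
  have hs := fun j : Fin d => (hasTemperateGrowth_symT j).fun_mul (hp j)
  rw [h, fmul_sum fun j _ => (Function.HasTemperateGrowth.const _).fun_mul (hs j), schwartzA_eq,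
    schwartzA_eq, map_sum, ← Finset.sum_add_distrib]
  refine Finset.sum_congr rfl fun j _ => ?_
  rw [fmul_const_mul (hs j), ← fmul_fmul (hasTemperateGrowth_symT j) (hp j), map_smul, map_add,
    fmul_comm (hasTemperateGrowth_symT j) hg, mulS_coord_fmul j hg, mulS_coord_fmul j hg, map_add,
    fmul_comm (hasTemperateGrowth_symT j) hg, fmul_comm (hp j) (hasTemperateGrowth_symT j)]
  module
/-! ### The commutator of `A` with a cutoff in space -/

theorem pderiv_symT {d : ℕ} (j l : Fin d) (ξ : E d) :
    pderiv l (symT j) ξ = (((if j = l then 1 else 0) * symH ξ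
      - 2 * ξ j * ξ l * symH ξ ^ 2 : ℝ) : ℂ) := by
  have h1 : HasFDerivAt (symH (d := d)) (-((1 + ‖ξ‖ ^ 2) ^ 2)⁻¹ • (2 • innerSL ℝ ξ)) ξ :=
    (hasDerivAt_inv (by positivity)).comp_hasFDerivAt ξ ((hasFDerivAt_norm_sq ξ).const_add 1)
  have h2 := (Complex.ofRealCLM.hasFDerivAt (x := ξ j * symH ξ)).comp ξ
    ((hasFDerivAt_coord j ξ).mul h1)
  have h3 : symT (d := d) j = Complex.ofRealCLM ∘ ((fun ξ : E d => ξ j) * symH) := by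
    funext ξ
    simp [symT, coord]
  have h4 : inner ℝ ξ (EuclideanSpace.single l (1 : ℝ)) = ξ l := inner_single l ξ
  have h5 : ((1 + ‖ξ‖ ^ 2) ^ 2)⁻¹ = symH ξ ^ 2 := by simp [symH]
  rw [pderiv, h3, h2.fderiv, h5]
  simp only [ContinuousLinearMap.comp_apply, Complex.ofRealCLM_apply]
  congr 1
  simp
  rw [h4]
  ring

theorem norm_pderiv_symT_le {d : ℕ} (j l : Fin d) (ξ : E d) : ‖pderiv l (symT j) ξ‖ ≤ 3 := by
  rw [pderiv_symT, Complex.norm_real, Real.norm_eq_abs]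
  have h0 := symH_pos ξ
  have h1 := symH_le_one ξ
  have h2 : |2 * ξ j * ξ l * symH ξ ^ 2| ≤ 2 := by
    rw [abs_mul, abs_mul, abs_mul, abs_two, abs_of_nonneg (sq_nonneg (symH ξ))]
    have h3 : |ξ j| * |ξ l| ≤ ‖ξ‖ ^ 2 := by
      rw [sq]
      exact mul_le_mul (abs_coord_le j ξ) (abs_coord_le l ξ) (abs_nonneg _) (norm_nonneg _)
    have h4 := norm_sq_mul_symH_le ξ
    calc 2 * |ξ j| * |ξ l| * symH ξ ^ 2 = 2 * ((|ξ j| * |ξ l|) * symH ξ * symH ξ) := by ring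
      _ ≤ 2 * (‖ξ‖ ^ 2 * symH ξ * 1) := by gcongr
      _ ≤ 2 := by linarith
  have h3 : |(if j = l then (1 : ℝ) else 0) * symH ξ| ≤ 1 := by
    split_ifs
    · rw [one_mul, abs_of_pos h0]; exact h1
    · simp
  rw [abs_le] at h2 h3 ⊢
  constructor <;> linarith

/-- The symbol of the commutator of the coordinate `x_l` with `D_j (I - (2π)⁻²Δ)⁻¹`. -/
def symC {d : ℕ} (j l : Fin d) (ξ : E d) : ℂ := Complex.I / (2 * Real.pi) * pderiv l (symT j) ξ

theorem hasTemperateGrowth_symC {d : ℕ} (j l : Fin d) : (symC j l).HasTemperateGrowth :=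
  (Function.HasTemperateGrowth.const _).mul
    (hasTemperateGrowth_pderiv l (hasTemperateGrowth_symT j))

theorem norm_symC_le {d : ℕ} (j l : Fin d) (ξ : E d) : ‖symC j l ξ‖ ≤ 1 := by
  have h1 := norm_pderiv_symT_le j l ξ
  have h2 := Real.pi_gt_three
  rw [symC, norm_mul, norm_div, Complex.norm_I, norm_mul, Complex.norm_real,
    Real.norm_of_nonneg Real.pi_pos.le, Complex.norm_ofNat, one_div]
  have h3 : (2 * Real.pi)⁻¹ ≤ 3⁻¹ := inv_anti₀ (by norm_num) (by linarith)
  calc _ ≤ 3⁻¹ * (3 : ℝ) := mul_le_mul h3 h1 (norm_nonneg _) (by norm_num)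
    _ = 1 := by norm_num

theorem norm_toL2_fmul_symT_le {d : ℕ} (j : Fin d) (u : 𝓢(E d, ℂ)) :
    ‖toL2 d (fmul (symT j) u)‖ ≤ ‖toL2 d u‖ := by
  simpa using norm_toL2_fmul_le (hasTemperateGrowth_symT j) (norm_symT_le j) u

theorem norm_toL2_fmul_symC_le {d : ℕ} (j l : Fin d) (u : 𝓢(E d, ℂ)) :
    ‖toL2 d (fmul (symC j l) u)‖ ≤ ‖toL2 d u‖ := by
  simpa using norm_toL2_fmul_le (hasTemperateGrowth_symC j l) (norm_symC_le j l) u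

theorem mulS_coord_fmul_symT {d : ℕ} (j l : Fin d) (u : 𝓢(E d, ℂ)) :
    mulS (coord l) (fmul (symT j) u)
      = fmul (symT j) (mulS (coord l) u) + fmul (symC j l) u :=
  mulS_coord_fmul l (hasTemperateGrowth_symT j) u

/-- The commutator with x is a derivation and sends yt + ty to yc + cy. Each resulting term has
exactly two factors among x and y, to be absorbed later by two factors r. -/
theorem commutator_sq_identity {R : Type*} [Ring R] {x y t c : R} (h : x * t = t * x + c)
    (hxy : x * y = y * x) :
    x * x * (y * t + t * y) - (y * t + t * y) * (x * x)
      = x * (y * c + c * y) + (y * c + c * y) * x := by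
  have h1 : x * y * t = y * (t * x) + y * c := by rw [hxy, mul_assoc, h, mul_add]
  have h2 : x * t * y = t * (y * x) + c * y := by rw [h, add_mul, mul_assoc, hxy]
  have h3 : x * (y * t + t * y) = (y * t + t * y) * x + (y * c + c * y) := by
    calc x * (y * t + t * y) = x * y * t + x * t * y := by noncomm_ring
      _ = _ := by rw [h1, h2]; noncomm_ring
  generalize y * t + t * y = a at h3 ⊢
  generalize y * c + c * y = b at h3 ⊢
  rw [mul_assoc, h3, mul_add, ← mul_assoc x a x, h3]
  noncomm_ring

/-! ### Bounds for the spatial cutoffs -/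

/-- The cutoff `(1 + r²|x|²)⁻¹`. -/
def cutoff {d : ℕ} (r : ℝ) (x : E d) : ℝ := (1 + r ^ 2 * ‖x‖ ^ 2)⁻¹

theorem hasTemperateGrowth_cutoff (d : ℕ) (r : ℝ) : (cutoff (d := d) r).HasTemperateGrowth :=
  hasTemperateGrowth_inv ((Function.HasTemperateGrowth.const 1).add
    ((Function.HasTemperateGrowth.const _).mul (hasTemperateGrowth_norm_sq d)))
    one_pos fun x => by simpa using mul_nonneg (sq_nonneg r) (sq_nonneg ‖x‖)

theorem cutoff_pos {d : ℕ} (r : ℝ) (x : E d) : 0 < cutoff r x := by unfold cutoff; positivity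

theorem cutoff_mul {d : ℕ} (r : ℝ) (x : E d) : cutoff r x * (1 + r ^ 2 * ‖x‖ ^ 2) = 1 :=
  inv_mul_cancel₀ (by positivity)

theorem cutoff_le_one {d : ℕ} (r : ℝ) (x : E d) : cutoff r x ≤ 1 :=
  inv_le_one_of_one_le₀ (by nlinarith [mul_nonneg (sq_nonneg r) (sq_nonneg ‖x‖)])

theorem cutoff_mul_norm_le {d : ℕ} (r : ℝ) (x : E d) : r * ‖x‖ * cutoff r x ≤ 1 := by
  have h := cutoff_mul r x
  have h1 := cutoff_pos r x
  nlinarith [sq_nonneg (r * ‖x‖ - 1)]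

theorem cutoff_mul_sq_le {d : ℕ} (r : ℝ) (x : E d) : r ^ 2 * ‖x‖ ^ 2 * cutoff r x ≤ 1 := by
  have h := cutoff_mul r x
  have h1 := cutoff_pos r x
  nlinarith

/-- Multiplication by the cutoff. -/
abbrev cutS {d : ℕ} (r : ℝ) : 𝓢(E d, ℂ) →L[ℂ] 𝓢(E d, ℂ) := mulS fun x => ((cutoff r x : ℝ) : ℂ)

theorem norm_toL2_cutS_le {d : ℕ} (r : ℝ) (u : 𝓢(E d, ℂ)) :
    ‖toL2 d (cutS r u)‖ ≤ ‖toL2 d u‖ := by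
  refine (norm_toL2_mulS_le (C := 1) (hasTemperateGrowth_ofReal (hasTemperateGrowth_cutoff d r))
    (fun x => ?_) u).trans_eq (one_mul _)
  rw [Complex.norm_real, Real.norm_of_nonneg (cutoff_pos r x).le]
  exact cutoff_le_one r x

theorem norm_toL2_coord_cutS_le {d : ℕ} {r : ℝ} (hr : 0 ≤ r) (j : Fin d) (u : 𝓢(E d, ℂ)) :
    r * ‖toL2 d (mulS (coord j) (cutS r u))‖ ≤ ‖toL2 d u‖ := by
  have hg := (hasTemperateGrowth_coord j).fun_mul
    (hasTemperateGrowth_ofReal (hasTemperateGrowth_cutoff d r))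
  rw [mulS_mulS (hasTemperateGrowth_coord j)
    (hasTemperateGrowth_ofReal (hasTemperateGrowth_cutoff d r))]
  have h1 := norm_toL2_mulS_le (C := 1) ((Function.HasTemperateGrowth.const (r : ℂ)).fun_mul hg)
    (fun x => ?_) u
  · rw [one_mul] at h1
    have h2 : mulS (fun x : E d => (r : ℂ) * (coord j x * ((cutoff r x : ℝ) : ℂ))) u
        = (r : ℂ) • mulS (fun x : E d => coord j x * ((cutoff r x : ℝ) : ℂ)) u :=
      congrArg (fun T : 𝓢(E d, ℂ) →L[ℂ] 𝓢(E d, ℂ) => T u) (SchwartzMap.smulLeftCLM_smul hg (r : ℂ))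
    rwa [h2, map_smul, norm_smul, Complex.norm_real, Real.norm_of_nonneg hr] at h1
  · rw [norm_mul, norm_mul, Complex.norm_real, Complex.norm_real, Real.norm_of_nonneg hr,
      Real.norm_of_nonneg (cutoff_pos r x).le, ← mul_assoc]
    have h3 := norm_coord_le j x
    have h4 := cutoff_pos r x
    calc r * ‖coord j x‖ * cutoff r x ≤ r * ‖x‖ * cutoff r x := by gcongr
      _ ≤ 1 := cutoff_mul_norm_le r x

theorem norm_toL2_cutS_coord_coord_le {d : ℕ} (r : ℝ) (i j : Fin d) (u : 𝓢(E d, ℂ)) :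
    r ^ 2 * ‖toL2 d (cutS r (mulS (coord i) (mulS (coord j) u)))‖ ≤ ‖toL2 d u‖ := by
  have hJ := hasTemperateGrowth_ofReal (hasTemperateGrowth_cutoff d r)
  have hc := (hasTemperateGrowth_coord i).fun_mul (hasTemperateGrowth_coord j)
  have hg := hJ.fun_mul hc
  rw [mulS_mulS (hasTemperateGrowth_coord i) (hasTemperateGrowth_coord j), mulS_mulS hJ hc]
  have h1 := norm_toL2_mulS_le (C := 1)
    ((Function.HasTemperateGrowth.const ((r ^ 2 : ℝ) : ℂ)).fun_mul hg) (fun x => ?_) u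
  · rw [one_mul] at h1
    have h2 : mulS (fun x : E d => ((r ^ 2 : ℝ) : ℂ) * (((cutoff r x : ℝ) : ℂ) *
        (coord i x * coord j x))) u
        = ((r ^ 2 : ℝ) : ℂ) • mulS (fun x : E d => ((cutoff r x : ℝ) : ℂ) *
          (coord i x * coord j x)) u :=
      congrArg (fun T : 𝓢(E d, ℂ) →L[ℂ] 𝓢(E d, ℂ) => T u)
        (SchwartzMap.smulLeftCLM_smul hg ((r ^ 2 : ℝ) : ℂ))
    rwa [h2, map_smul, norm_smul, Complex.norm_real, Real.norm_of_nonneg (sq_nonneg r)] at h1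
  · rw [norm_mul, norm_mul, norm_mul, Complex.norm_real, Complex.norm_real,
      Real.norm_of_nonneg (sq_nonneg r), Real.norm_of_nonneg (cutoff_pos r x).le]
    have h3 := norm_coord_le i x
    have h3' := norm_coord_le j x
    have h4 := cutoff_pos r x
    calc r ^ 2 * (cutoff r x * (‖coord i x‖ * ‖coord j x‖))
        ≤ r ^ 2 * (cutoff r x * (‖x‖ * ‖x‖)) := by gcongr
      _ = r ^ 2 * ‖x‖ ^ 2 * cutoff r x := by ring
      _ ≤ 1 := cutoff_mul_sq_le r x

theorem mulS_comm {d : ℕ} {g h : E d → ℂ} (hg : g.HasTemperateGrowth) (hh : h.HasTemperateGrowth)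
    (u : 𝓢(E d, ℂ)) : mulS g (mulS h u) = mulS h (mulS g u) := by
  rw [mulS_mulS hg hh, mulS_mulS hh hg]
  simp only [mul_comm]

/-- The inverse of the cutoff, `1 + r²|x|²`. -/
theorem cutS_inverse {d : ℕ} (r : ℝ) (u : 𝓢(E d, ℂ)) :
    u = cutS r u + ((r ^ 2 : ℝ) : ℂ) • ∑ l, cutS r (mulS (coord l) (mulS (coord l) u)) := by
  have hJ := hasTemperateGrowth_ofReal (hasTemperateGrowth_cutoff d r)
  ext x
  simp only [add_apply, smul_apply, sum_apply, SchwartzMap.smulLeftCLM_apply_apply hJ,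
    SchwartzMap.smulLeftCLM_apply_apply (hasTemperateGrowth_coord _), smul_eq_mul]
  rw [← Finset.mul_sum]
  have h : ∑ l, coord l x * (coord l x * u x) = ((‖x‖ ^ 2 : ℝ) : ℂ) * u x := by
    rw [norm_sq_eq_sum]
    push_cast
    rw [Finset.sum_mul]
    refine Finset.sum_congr rfl fun l _ => ?_
    rw [coord]; ring
  rw [h]
  have h1 : ((cutoff r x : ℝ) : ℂ) * (1 + ((r ^ 2 : ℝ) : ℂ) * ((‖x‖ ^ 2 : ℝ) : ℂ)) = 1 := by
    exact_mod_cast cutoff_mul r x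
  linear_combination -(u x) * h1

/-! ### A criterion for essential self-adjointness -/

section Abstract

variable {H : Type*} [NormedAddCommGroup H] [InnerProductSpace ℂ H]

theorem im_mul_norm_le_of_real {x y : H} (h : (inner ℂ x y).im = 0) (w : ℂ) :
    |w.im| * ‖x‖ ≤ ‖y - w • x‖ := by
  have h2 : (inner ℂ x (y - w • x)).im = -(w.im * ‖x‖ ^ 2) := by
    rw [inner_sub_right, inner_smul_right, inner_self_eq_norm_sq_to_K, Complex.sub_im, h]
    simp [← Complex.ofReal_pow]
  have h3 : |w.im| * ‖x‖ ^ 2 ≤ ‖x‖ * ‖y - w • x‖ := by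
    calc |w.im| * ‖x‖ ^ 2 = |(inner ℂ x (y - w • x)).im| := by
          rw [h2, abs_neg, abs_mul, abs_of_nonneg (sq_nonneg ‖x‖)]
      _ ≤ ‖inner ℂ x (y - w • x)‖ := Complex.abs_im_le_norm _
      _ ≤ _ := norm_inner_le_norm _ _
  rcases (norm_nonneg x).eq_or_lt with h0 | h0
  · rw [← h0, mul_zero]; exact norm_nonneg _
  · nlinarith

theorem inner_im_eq_zero_of_symm {x y : H} (h : inner ℂ y x = inner ℂ x y) :
    (inner ℂ x y).im = 0 := by
  rw [← inner_conj_symm] at h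
  exact Complex.conj_eq_iff_im.1 h

/-- A densely defined symmetric operator `T` is essentially self-adjoint if the ranges of
`T ± iκ` are dense. -/
theorem isEssentiallySelfAdjoint_of_symm [CompleteSpace H] {T : H →ₗ.[ℂ] H}
    (hd : Dense (T.domain : Set H))
    (hsym : ∀ u v : T.domain, inner ℂ (T u) (v : H) = inner ℂ (u : H) (T v))
    {w : ℂ} (hw : w.im ≠ 0)
    (h : ∀ v : H, (∀ u : T.domain, inner ℂ v (T u - w • (u : H)) = 0) → v = 0)
    (h' : ∀ v : H, (∀ u : T.domain, inner ℂ v (T u - conj w • (u : H)) = 0) → v = 0) :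
    IsEssentiallySelfAdjoint T := by
  have hle : T ≤ T.adjoint := LinearPMap.IsFormalAdjoint.le_adjoint hd fun u v => hsym u v
  have hcl : T.IsClosable := (LinearPMap.adjoint_isClosed hd).isClosable.leIsClosable hle
  refine ⟨hd, hcl, ?_⟩
  have hg : T.closure.graph = T.graph.topologicalClosure :=
    hcl.graph_closure_eq_closure_graph.symm
  have hdS : Dense (T.closure.domain : Set H) := hd.mono T.le_closure.1
  have hadjcl : IsClosed (T.adjoint.graph : Set (H × H)) := LinearPMap.adjoint_isClosed hd
  have hgle : T.closure.graph ≤ T.adjoint.graph := by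
    rw [hg]
    exact Submodule.topologicalClosure_minimal _ (LinearPMap.le_graph_of_le hle) hadjcl
  have hform : ∀ {x y : H}, (x, y) ∈ T.adjoint.graph → ∀ u : T.domain,
      inner ℂ y (u : H) = inner ℂ x (T u) := by
    intro x y hxy u
    obtain ⟨a, ha1, ha2⟩ := (LinearPMap.mem_graph_iff _).1 hxy
    have := LinearPMap.adjoint_isFormalAdjoint hd a u
    simp only at ha1 ha2
    rwa [ha1, ha2] at this
  -- Density of the range of T - w and the lower bound by |Im w| give x in the domain of the closure
  -- with (T - w)x = y - wv there. Then v - x lies in the kernel of T* - w, which is orthogonal to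
  -- the range of T - w̄, so v = x.
  have hadj : T.adjoint.graph ≤ T.closure.graph := by
    rintro ⟨v, y⟩ hv
    let L : T.domain →ₗ[ℂ] H := T.toFun - w • T.domain.subtype
    have hL : ∀ u : T.domain, L u = T u - w • (u : H) := fun u => rfl
    have hdense : (LinearMap.range L).topologicalClosure = ⊤ := by
      rw [Submodule.topologicalClosure_eq_top_iff, Submodule.eq_bot_iff]
      intro z hz
      refine h z fun u => ?_
      exact (Submodule.mem_orthogonal' _ _).1 hz (L u) ⟨u, rfl⟩
    have hmem : y - w • v ∈ closure (LinearMap.range L : Set H) := by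
      have : y - w • v ∈ (LinearMap.range L).topologicalClosure := hdense ▸ Submodule.mem_top
      exact this
    obtain ⟨f, hf, hlim⟩ := mem_closure_iff_seq_limit.1 hmem
    choose u hu using hf
    have hz' : 0 < |w.im| := abs_pos.2 hw
    have hc : CauchySeq fun n => (u n : H) := by
      rw [Metric.cauchySeq_iff']
      intro ε hε
      obtain ⟨N, hN⟩ := Metric.cauchySeq_iff'.1 hlim.cauchySeq (|w.im| * ε) (by positivity)
      refine ⟨N, fun n hn => ?_⟩
      have h3 := im_mul_norm_le_of_real (x := ((u n - u N : T.domain) : H)) (y := T (u n - u N))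
        (inner_im_eq_zero_of_symm (hsym _ _)) w
      rw [← hL, map_sub, hu, hu] at h3
      have h2 := hN n hn
      rw [dist_eq_norm] at h2 ⊢
      exact lt_of_mul_lt_mul_left (h3.trans_lt h2) hz'.le
    obtain ⟨x, hx⟩ := cauchySeq_tendsto_of_complete hc
    have hTx : Tendsto (fun n => T (u n)) atTop (𝓝 ((y - w • v) + w • x)) := by
      have h3 : Tendsto (fun n => L (u n) + w • (u n : H)) atTop (𝓝 ((y - w • v) + w • x)) := by
        refine Tendsto.add ?_ (hx.const_smul w)
        simpa only [hu] using hlim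
      refine h3.congr fun n => ?_
      rw [hL, sub_add_cancel]
    have hxg : (x, (y - w • v) + w • x) ∈ T.closure.graph := by
      rw [hg]
      exact mem_closure_of_tendsto (hx.prodMk_nhds hTx) (.of_forall fun n => T.mem_graph (u n))
    have hvx : v - x = 0 := by
      refine h' (v - x) fun u => ?_
      have h5 := hform (T.adjoint.graph.sub_mem hv (hgle hxg)) u
      rw [inner_sub_right, inner_smul_right, ← h5]
      have h6 : y - (y - w • v + w • x) = w • (v - x) := by module
      rw [h6, inner_smul_left, sub_self]
    have h7 : x = v := (sub_eq_zero.1 hvx).symm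
    have h8 : (x, (y - w • v) + w • x) = (v, y) := by rw [h7]; simp
    rwa [h8] at hxg
  rw [LinearPMap.isSelfAdjoint_def]
  refine LinearPMap.eq_of_eq_graph ?_
  rw [LinearPMap.adjoint_graph_eq_graph_adjoint hdS]
  refine le_antisymm (le_trans ?_ hadj) fun x hx => ?_
  · rw [LinearPMap.adjoint_graph_eq_graph_adjoint hd]
    intro x hx
    rw [Submodule.mem_adjoint_iff] at hx ⊢
    exact fun a b hab => hx a b (LinearPMap.le_graph_of_le T.le_closure hab)
  · rw [Submodule.mem_adjoint_iff]
    intro a b hab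
    rw [hg] at hab
    -- Symmetry of the closure: for a fixed pair in its graph, the symmetry relation is a closed
    -- condition on the other pair and holds on the graph of `T`.
    have hcl2 : IsClosed {q : H × H | inner ℂ q.2 x.1 - inner ℂ q.1 x.2 = 0} :=
      isClosed_eq (by fun_prop) continuous_const
    have hsub : (T.graph : Set (H × H)) ⊆ {q : H × H | inner ℂ q.2 x.1 - inner ℂ q.1 x.2 = 0} := by
      rintro ⟨p, q⟩ hpq
      have h9 := hgle hx
      rw [LinearPMap.adjoint_graph_eq_graph_adjoint hd, Submodule.mem_adjoint_iff] at h9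
      exact h9 p q hpq
    exact closure_minimal hsub hcl2 hab

end Abstract

/-! ### Bounds for `A` -/

/-- Moving the coordinate to the right of `symT j` costs only the bounded commutator `symC j j`, so
each summand of `A` becomes twice a contraction applied to x_j u, plus a contraction. -/
theorem norm_toL2_schwartzA_le (k d : ℕ) (u : 𝓢(E d, ℂ)) :
    ‖toL2 d (schwartzA k d u)‖ ≤ ∑ j : Fin d, (2 * ‖toL2 d (mulS (coord j) u)‖ + ‖toL2 d u‖) := by
  rw [schwartzA_eq, map_sum]
  refine (norm_sum_le _ _).trans (Finset.sum_le_sum fun j _ => ?_)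
  rw [map_smul, norm_smul, Complex.norm_real, Real.norm_eq_abs, abs_sgn, one_mul,
    mulS_coord_fmul_symT, map_add, map_add]
  have h1 := norm_toL2_fmul_symT_le j (mulS (coord j) u)
  have h2 := norm_toL2_fmul_symC_le j j u
  calc _ ≤ (‖toL2 d (fmul (symT j) (mulS (coord j) u))‖ + ‖toL2 d (fmul (symC j j) u)‖)
        + ‖toL2 d (fmul (symT j) (mulS (coord j) u))‖ :=
        (norm_add_le _ _).trans (add_le_add_left (norm_add_le _ _) _)
    _ ≤ _ := by linarith

/-- The commutator of `x_l` with the `j`-th summand of `A`, up to sign. -/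
def commX {d : ℕ} (j l : Fin d) : 𝓢(E d, ℂ) →L[ℂ] 𝓢(E d, ℂ) :=
  mulS (coord j) * fmul (symC j l) + fmul (symC j l) * mulS (coord j)

theorem mulS_coord_sq_schwartzA (k : ℕ) {d : ℕ} (l : Fin d) (u : 𝓢(E d, ℂ)) :
    mulS (coord l) (mulS (coord l) (schwartzA k d u))
      - schwartzA k d (mulS (coord l) (mulS (coord l) u))
      = ∑ j, ((sgn k j : ℝ) : ℂ) •
        (mulS (coord l) (commX j l u) + commX j l (mulS (coord l) u)) := by
  rw [schwartzA_eq, schwartzA_eq, map_sum, map_sum, ← Finset.sum_sub_distrib]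
  refine Finset.sum_congr rfl fun j _ => ?_
  have h1 : (mulS (coord l) * fmul (symT j) : 𝓢(E d, ℂ) →L[ℂ] 𝓢(E d, ℂ))
      = fmul (symT j) * mulS (coord l) + fmul (symC j l) :=
    ContinuousLinearMap.ext fun v => mulS_coord_fmul_symT j l v
  have h2 : (mulS (coord l) * mulS (coord j) : 𝓢(E d, ℂ) →L[ℂ] 𝓢(E d, ℂ))
      = mulS (coord j) * mulS (coord l) :=
    ContinuousLinearMap.ext fun v =>
      mulS_comm (hasTemperateGrowth_coord l) (hasTemperateGrowth_coord j) v
  have h3 := congrArg (fun S : 𝓢(E d, ℂ) →L[ℂ] 𝓢(E d, ℂ) => S u) (commutator_sq_identity h1 h2)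
  rw [map_smul, map_smul, ← smul_sub]
  congr 1

/-- With J the cutoff, AJ - JA = J(J⁻¹A - AJ⁻¹)J, and J⁻¹ = 1 + r²|x|² contributes only r² times
commutators with x_l². The factor J survives on both sides. -/
theorem schwartzA_cutS (k d : ℕ) (r : ℝ) (u : 𝓢(E d, ℂ)) :
    schwartzA k d (cutS r u) - cutS r (schwartzA k d u)
      = ((r ^ 2 : ℝ) : ℂ) • ∑ l, ∑ j, ((sgn k j : ℝ) : ℂ) •
        cutS r (mulS (coord l) (commX j l (cutS r u)) + commX j l (mulS (coord l) (cutS r u))) := by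
  have hJ := hasTemperateGrowth_ofReal (hasTemperateGrowth_cutoff d r)
  have hc := fun l : Fin d => hasTemperateGrowth_coord l
  have h1 := cutS_inverse r (schwartzA k d (cutS r u))
  have h2 : cutS r (schwartzA k d u) = cutS r (schwartzA k d (cutS r u))
      + ((r ^ 2 : ℝ) : ℂ) • ∑ l, cutS r (schwartzA k d
        (mulS (coord l) (mulS (coord l) (cutS r u)))) := by
    conv_lhs => rw [cutS_inverse r u]
    simp only [map_add, map_smul, map_sum]
    congr 2
    refine Finset.sum_congr rfl fun l _ => ?_
    rw [mulS_comm hJ (hc l), mulS_comm hJ (hc l)]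
  have h3 : ∀ a b c e : 𝓢(E d, ℂ), a = b + c → a - (b + e) = c - e := fun a b c e h => by
    rw [h, add_sub_add_left_eq_sub]
  rw [h2, h3 _ _ _ _ h1, ← smul_sub, ← Finset.sum_sub_distrib]
  congr 1
  refine Finset.sum_congr rfl fun l _ => ?_
  rw [← map_sub, mulS_coord_sq_schwartzA, map_sum]
  refine Finset.sum_congr rfl fun j _ => ?_
  rw [map_smul]

theorem norm_cutS_commX_le {d : ℕ} {r : ℝ} (hr : 0 ≤ r) (j l : Fin d) (u : 𝓢(E d, ℂ)) :
    r ^ 2 * ‖toL2 d (cutS r (mulS (coord l) (commX j l (cutS r u))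
      + commX j l (mulS (coord l) (cutS r u))))‖ ≤ 4 * ‖toL2 d u‖ := by
  have hJ := hasTemperateGrowth_ofReal (hasTemperateGrowth_cutoff d r)
  have hc := fun l : Fin d => hasTemperateGrowth_coord l
  -- The two coordinates are distributed so that each has a cutoff to absorb it: r x J and r² x x J
  -- have norm at most one. Four terms arise, hence the constant 4.
  have e : cutS r (mulS (coord l) (commX j l (cutS r u)) + commX j l (mulS (coord l) (cutS r u)))
      = cutS r (mulS (coord l) (mulS (coord j) (fmul (symC j l) (cutS r u))))
        + mulS (coord l) (cutS r (fmul (symC j l) (mulS (coord j) (cutS r u))))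
        + mulS (coord j) (cutS r (fmul (symC j l) (mulS (coord l) (cutS r u))))
        + cutS r (fmul (symC j l) (cutS r (mulS (coord j) (mulS (coord l) u)))) := by
    have e1 : cutS r (mulS (coord j) (mulS (coord l) u))
        = mulS (coord j) (mulS (coord l) (cutS r u)) := by
      rw [mulS_comm hJ (hc j), mulS_comm hJ (hc l)]
    rw [e1, mulS_comm (hc l) hJ (fmul (symC j l) (mulS (coord j) (cutS r u))),
      mulS_comm (hc j) hJ (fmul (symC j l) (mulS (coord l) (cutS r u)))]
    simp only [commX, add_apply, mul_apply_eq_comp, map_add]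
    abel
  have t1 : r ^ 2 * ‖toL2 d (cutS r (mulS (coord l) (mulS (coord j)
      (fmul (symC j l) (cutS r u)))))‖ ≤ ‖toL2 d u‖ :=
    (norm_toL2_cutS_coord_coord_le r l j _).trans
      ((norm_toL2_fmul_symC_le j l _).trans (norm_toL2_cutS_le r u))
  have t2 : ∀ i i' : Fin d, r ^ 2 * ‖toL2 d (mulS (coord i) (cutS r (fmul (symC j l)
      (mulS (coord i') (cutS r u)))))‖ ≤ ‖toL2 d u‖ := by
    intro i i'
    calc _ = r * (r * ‖toL2 d (mulS (coord i) (cutS r (fmul (symC j l)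
          (mulS (coord i') (cutS r u)))))‖) := by ring
      _ ≤ r * ‖toL2 d (mulS (coord i') (cutS r u))‖ :=
        mul_le_mul_of_nonneg_left ((norm_toL2_coord_cutS_le hr i _).trans
          (norm_toL2_fmul_symC_le j l _)) hr
      _ ≤ _ := norm_toL2_coord_cutS_le hr i' u
  have t3 : r ^ 2 * ‖toL2 d (cutS r (fmul (symC j l) (cutS r (mulS (coord j)
      (mulS (coord l) u)))))‖ ≤ ‖toL2 d u‖ :=
    (mul_le_mul_of_nonneg_left ((norm_toL2_cutS_le r _).trans (norm_toL2_fmul_symC_le j l _))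
      (sq_nonneg r)).trans (norm_toL2_cutS_coord_coord_le r j l u)
  rw [e, map_add, map_add, map_add]
  calc _ ≤ r ^ 2 * (‖_‖ + ‖_‖ + ‖_‖ + ‖_‖) :=
        mul_le_mul_of_nonneg_left norm_add₄_le (sq_nonneg r)
    _ ≤ 4 * ‖toL2 d u‖ := by
      have := t2 l j
      have := t2 j l
      linarith

/-- The commutators of `A` with the cutoffs are bounded uniformly. -/
theorem norm_schwartzA_cutS_le (k d : ℕ) {r : ℝ} (hr : 0 ≤ r) (u : 𝓢(E d, ℂ)) :
    ‖toL2 d (schwartzA k d (cutS r u) - cutS r (schwartzA k d u))‖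
      ≤ 4 * (d : ℝ) ^ 2 * ‖toL2 d u‖ := by
  rw [schwartzA_cutS, map_smul, norm_smul, Complex.norm_real, Real.norm_of_nonneg (sq_nonneg r),
    map_sum]
  refine (mul_le_mul_of_nonneg_left (norm_sum_le _ _) (sq_nonneg r)).trans ?_
  rw [Finset.mul_sum]
  have h : ∀ l : Fin d, r ^ 2 * ‖toL2 d (∑ j, ((sgn k j : ℝ) : ℂ) • cutS r (mulS (coord l)
      (commX j l (cutS r u)) + commX j l (mulS (coord l) (cutS r u))))‖
      ≤ ∑ _j : Fin d, 4 * ‖toL2 d u‖ := by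
    intro l
    rw [map_sum]
    refine (mul_le_mul_of_nonneg_left (norm_sum_le _ _) (sq_nonneg r)).trans ?_
    rw [Finset.mul_sum]
    refine Finset.sum_le_sum fun j _ => ?_
    rw [map_smul, norm_smul, Complex.norm_real, Real.norm_eq_abs, abs_sgn, one_mul]
    exact norm_cutS_commX_le hr j l u
  refine (Finset.sum_le_sum fun l _ => h l).trans_eq ?_
  simp
  ring

theorem norm_schwartzA_cutS_le_mul (k d : ℕ) {r : ℝ} (hr : 0 < r) (u : 𝓢(E d, ℂ)) :
    ‖toL2 d (schwartzA k d (cutS r u))‖ ≤ d * (2 * r⁻¹ + 1) * ‖toL2 d u‖ := by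
  refine (norm_toL2_schwartzA_le k d _).trans ?_
  have h : ∀ j : Fin d, 2 * ‖toL2 d (mulS (coord j) (cutS r u))‖ + ‖toL2 d (cutS r u)‖
      ≤ (2 * r⁻¹ + 1) * ‖toL2 d u‖ := by
    intro j
    have h1 := norm_toL2_coord_cutS_le hr.le j u
    have h2 := norm_toL2_cutS_le r u
    have h3 : ‖toL2 d (mulS (coord j) (cutS r u))‖ ≤ r⁻¹ * ‖toL2 d u‖ := by
      rw [inv_mul_eq_div, le_div_iff₀ hr, mul_comm]
      exact h1
    linarith
  refine (Finset.sum_le_sum fun j _ => h j).trans_eq ?_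
  simp
  ring

/-! ### Density of the test functions in the Schwartz space -/

theorem mem_closure_testFunctions {d : ℕ} (u : 𝓢(E d, ℂ)) :
    ∃ v : ℕ → 𝓢(E d, ℂ), (∀ n, v n ∈ testFunctions d) ∧ Tendsto v atTop (𝓝 u) := by
  let θ : ContDiffBump (0 : E d) := ⟨1, 2, one_pos, one_lt_two⟩
  let δ : ℕ → ℝ := fun n => ((n : ℝ) + 1)⁻¹
  have hδ : ∀ n, 0 < δ n := fun n => by positivity
  have hδ1 : ∀ n, δ n ≤ 1 := fun n => inv_le_one_of_one_le₀ (by linarith [n.cast_nonneg (α := ℝ)])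
  have hθ : ContDiff ℝ ∞ (θ : E d → ℝ) := θ.contDiff
  have hB : ∀ i : ℕ, ∃ B : ℝ, ∀ x, ‖iteratedFDeriv ℝ i (θ : E d → ℝ) x‖ ≤ B := by
    intro i
    have hc : Continuous fun x => ‖iteratedFDeriv ℝ i (θ : E d → ℝ) x‖ :=
      (hθ.continuous_iteratedFDeriv (mod_cast le_top)).norm
    obtain ⟨x₀, hx₀⟩ := hc.exists_forall_ge_of_hasCompactSupport
      ((θ.hasCompactSupport.iteratedFDeriv (𝕜 := ℝ) i).norm)
    exact ⟨_, hx₀⟩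
  choose B hB using hB
  have hB0 : ∀ i, 0 ≤ B i := fun i => (norm_nonneg _).trans (hB i 0)
  let ψ : ℕ → E d → ℝ := fun n x => θ (δ n • x)
  have hψ : ∀ n, ContDiff ℝ ∞ (ψ n) := fun n => hθ.comp (contDiff_const_smul (δ n))
  have hψs : ∀ n, HasCompactSupport (ψ n) := fun n =>
    θ.hasCompactSupport.comp_homeomorph (Homeomorph.smulOfNeZero (δ n) (hδ n).ne')
  have hψt : ∀ n, (ψ n).HasTemperateGrowth := fun n => (hψs n).hasTemperateGrowth (hψ n)
  have hψB : ∀ n i x, ‖iteratedFDeriv ℝ i (ψ n) x‖ ≤ B i := by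
    intro n i x
    have h := iteratedFDeriv_comp_const_smul (δ n) (i := i) (hθ.of_le (mod_cast le_top))
    rw [show ψ n = fun z => θ (δ n • z) from rfl, h, norm_smul, norm_pow,
      Real.norm_of_nonneg (hδ n).le]
    exact (mul_le_of_le_one_left (norm_nonneg _) (pow_le_one₀ (hδ n).le (hδ1 n))).trans (hB i _)
  have happ : ∀ n x, SchwartzMap.smulLeftCLM ℂ (ψ n) u x = ψ n x • u x := fun n x =>
    SchwartzMap.smulLeftCLM_apply_apply (hψt n) u x
  refine ⟨fun n => SchwartzMap.smulLeftCLM ℂ (ψ n) u, fun n => ?_, ?_⟩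
  · change HasCompactSupport _
    rw [SchwartzMap.smulLeftCLM_apply (hψt n)]
    exact (hψs n).smul_right
  rw [(schwartz_withSeminorms ℝ (E d) ℂ).tendsto_nhds]
  rintro ⟨k, l⟩ ε hε
  let S : ℕ → ℝ := fun i => SchwartzMap.seminorm ℝ (k + 1) i u
  let M : ℝ := (∑ i ∈ Finset.range (l + 1), (l.choose i : ℝ) * B i * S (l - i)) + S l
  have hS0 : ∀ i, 0 ≤ S i := fun i => apply_nonneg _ _
  have hM0 : 0 ≤ M := add_nonneg (Finset.sum_nonneg fun i _ =>
    mul_nonneg (mul_nonneg (Nat.cast_nonneg _) (hB0 i)) (hS0 _)) (hS0 _)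
  have hbound : ∀ n, SchwartzMap.seminorm ℝ k l (SchwartzMap.smulLeftCLM ℂ (ψ n) u - u)
      ≤ δ n * M := by
    intro n
    refine SchwartzMap.seminorm_le_bound ℝ k l _ (mul_nonneg (hδ n).le hM0) fun x => ?_
    -- Where δ|x| < 1 the cutoff is 1 near x and the difference vanishes. Elsewhere 1 ≤ δ|x| buys a
    -- factor δ for one more power of |x|, which is why the seminorms of weight k + 1 enter.
    rcases lt_or_ge (δ n * ‖x‖) 1 with hx | hx
    · have hev : (fun y => (SchwartzMap.smulLeftCLM ℂ (ψ n) u - u) y) =ᶠ[𝓝 x] fun _ => 0 := by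
        have hopen : ∀ᶠ y in 𝓝 x, δ n * ‖y‖ < 1 :=
          (continuous_const.mul continuous_norm).continuousAt.eventually_lt continuousAt_const hx
        filter_upwards [hopen] with y hy
        have h1 : ψ n y = 1 := by
          refine θ.one_of_mem_closedBall ?_
          rw [mem_closedBall_zero_iff, norm_smul, Real.norm_of_nonneg (hδ n).le]
          exact hy.le
        rw [sub_apply, happ, h1, one_smul, sub_self]
      have h2 : iteratedFDeriv ℝ l (⇑(SchwartzMap.smulLeftCLM ℂ (ψ n) u - u)) x = 0 := by
        rw [(hev.iteratedFDeriv ℝ l).eq_of_nhds]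
        simp
      rw [h2, norm_zero, mul_zero]
      exact mul_nonneg (hδ n).le hM0
    · have hk : ∀ i, ‖x‖ ^ k * ‖iteratedFDeriv ℝ i u x‖ ≤ δ n * S i := by
        intro i
        have h1 := SchwartzMap.le_seminorm ℝ (k + 1) i u x
        calc ‖x‖ ^ k * ‖iteratedFDeriv ℝ i u x‖
            ≤ (δ n * ‖x‖) * (‖x‖ ^ k * ‖iteratedFDeriv ℝ i u x‖) :=
              le_mul_of_one_le_left (by positivity) hx
          _ = δ n * (‖x‖ ^ (k + 1) * ‖iteratedFDeriv ℝ i u x‖) := by ring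
          _ ≤ δ n * S i := mul_le_mul_of_nonneg_left h1 (hδ n).le
      have h1 : iteratedFDeriv ℝ l (⇑(SchwartzMap.smulLeftCLM ℂ (ψ n) u - u)) x
          = iteratedFDeriv ℝ l (fun y => ψ n y • u y) x - iteratedFDeriv ℝ l u x := by
        have h3 : (⇑(SchwartzMap.smulLeftCLM ℂ (ψ n) u - u) : E d → ℂ)
            = (fun y => ψ n y • u y) - ⇑u := by
          funext y
          rw [sub_apply, happ, Pi.sub_apply]
        have h4 : ContDiff ℝ ∞ fun y => ψ n y • u y := (hψ n).smul (u.smooth ⊤)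
        rw [h3, iteratedFDeriv_sub_apply (h4.contDiffAt.of_le (mod_cast le_top))
          ((u.smooth ⊤).contDiffAt.of_le (mod_cast le_top))]
      have h2 : ‖x‖ ^ k * ‖iteratedFDeriv ℝ l (fun y => ψ n y • u y) x‖
          ≤ ∑ i ∈ Finset.range (l + 1), δ n * ((l.choose i : ℝ) * B i * S (l - i)) := by
        refine (mul_le_mul_of_nonneg_left (norm_iteratedFDeriv_smul_le (N := ∞) (hψ n)
          (u.smooth ⊤) x (mod_cast le_top)) (by positivity)).trans ?_
        rw [Finset.mul_sum]
        refine Finset.sum_le_sum fun i _ => ?_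
        calc ‖x‖ ^ k * ((l.choose i : ℝ) * ‖iteratedFDeriv ℝ i (ψ n) x‖
              * ‖iteratedFDeriv ℝ (l - i) u x‖)
            = (l.choose i : ℝ) * ‖iteratedFDeriv ℝ i (ψ n) x‖
              * (‖x‖ ^ k * ‖iteratedFDeriv ℝ (l - i) u x‖) := by ring
          _ ≤ (l.choose i : ℝ) * B i * (δ n * S (l - i)) :=
            mul_le_mul (mul_le_mul_of_nonneg_left (hψB n i x) (Nat.cast_nonneg _)) (hk _)
              (by positivity) (mul_nonneg (Nat.cast_nonneg _) (hB0 i))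
          _ = _ := by ring
      rw [h1]
      calc ‖x‖ ^ k * ‖iteratedFDeriv ℝ l (fun y => ψ n y • u y) x - iteratedFDeriv ℝ l u x‖
          ≤ ‖x‖ ^ k * (‖iteratedFDeriv ℝ l (fun y => ψ n y • u y) x‖
            + ‖iteratedFDeriv ℝ l u x‖) :=
            mul_le_mul_of_nonneg_left (norm_sub_le _ _) (by positivity)
        _ ≤ (∑ i ∈ Finset.range (l + 1), δ n * ((l.choose i : ℝ) * B i * S (l - i)))
            + δ n * S l := by
            rw [mul_add]
            exact add_le_add h2 (hk l)
        _ = δ n * M := by rw [← Finset.mul_sum, mul_add]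
  have hlim : Tendsto (fun n => δ n * M) atTop (𝓝 0) := by
    have h := (tendsto_one_div_add_atTop_nhds_zero_nat (𝕜 := ℝ)).mul_const M
    simpa [δ] using h
  filter_upwards [hlim.eventually_lt_const hε] with n hn
  exact (hbound n).trans_lt hn

/-! ### Operators on test functions and their closures -/

/-- Allows all computations to be done on Schwartz functions, which Fourier multipliers preserve
while compact support is lost. It holds since `T` is continuous and test functions are dense in the
Schwartz topology. -/
theorem mem_closure_graph_onTest {d : ℕ} (T : 𝓢(E d, ℂ) →L[ℂ] 𝓢(E d, ℂ)) (u : 𝓢(E d, ℂ)) :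
    (toL2 d u, toL2 d (T u)) ∈ (onTest T).graph.topologicalClosure := by
  obtain ⟨v, hv, hlim⟩ := mem_closure_testFunctions u
  have h1 := ((toL2 d).continuous.tendsto u).comp hlim
  have h2 := ((toL2 d ∘L T).continuous.tendsto u).comp hlim
  refine mem_closure_of_tendsto (h1.prodMk_nhds h2) (.of_forall fun n => ?_)
  refine (LinearPMap.mem_graph_iff _).2
    ⟨⟨testToL2 d ⟨v n, hv n⟩, LinearMap.mem_range_self _ _⟩, rfl, ?_⟩
  exact onTest_apply T ⟨v n, hv n⟩

theorem exists_test_of_domain {d : ℕ} (T : 𝓢(E d, ℂ) →L[ℂ] 𝓢(E d, ℂ))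
    (x : (onTest T).domain) : ∃ u : 𝓢(E d, ℂ), toL2 d u = x ∧ toL2 d (T u) = onTest T x := by
  obtain ⟨x, hx⟩ := x
  obtain ⟨u, rfl⟩ := hx
  exact ⟨u, rfl, (onTest_apply T u).symm⟩

theorem exists_seq_of_mem_closure_graph {d : ℕ} {T : 𝓢(E d, ℂ) →L[ℂ] 𝓢(E d, ℂ)}
    {x y : L2 d} (h : (x, y) ∈ (onTest T).graph.topologicalClosure) :
    ∃ u : ℕ → 𝓢(E d, ℂ), Tendsto (fun n => toL2 d (u n)) atTop (𝓝 x) ∧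
      Tendsto (fun n => toL2 d (T (u n))) atTop (𝓝 y) := by
  obtain ⟨f, hf, hlim⟩ := mem_closure_iff_seq_limit.1 h
  have hu : ∀ n, ∃ u : 𝓢(E d, ℂ), toL2 d u = (f n).1 ∧ toL2 d (T u) = (f n).2 := by
    intro n
    obtain ⟨a, ha1, ha2⟩ := (LinearPMap.mem_graph_iff _).1 (hf n)
    obtain ⟨u, hu1, hu2⟩ := exists_test_of_domain T a
    exact ⟨u, hu1.trans ha1, hu2.trans ha2⟩
  choose u hu1 hu2 using hu
  refine ⟨u, ?_, ?_⟩
  · simp only [hu1]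
    exact (continuous_fst.tendsto _).comp hlim
  · simp only [hu2]
    exact (continuous_snd.tendsto _).comp hlim

theorem dense_domain_onTest {d : ℕ} (T : 𝓢(E d, ℂ) →L[ℂ] 𝓢(E d, ℂ)) :
    Dense ((onTest T).domain : Set (L2 d)) := by
  have h : Set.range (toL2 d) ⊆ closure ((onTest T).domain : Set (L2 d)) := by
    rintro - ⟨u, rfl⟩
    obtain ⟨v, hv, hlim⟩ := mem_closure_testFunctions u
    refine mem_closure_of_tendsto (((toL2 d).continuous.tendsto u).comp hlim)
      (.of_forall fun n => ?_)
    exact ⟨⟨v n, hv n⟩, rfl⟩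
  have h2 : Dense (Set.range (toL2 d)) := denseRange_toL2 d
  exact dense_closure.1 (h2.mono h)

/-- A symmetric operator on the Schwartz space is essentially self-adjoint on the test functions
if the orthogonal complements of the ranges of `T - w` and `T - w̄` are trivial. -/
theorem isEssentiallySelfAdjoint_onTest {d : ℕ} {T : 𝓢(E d, ℂ) →L[ℂ] 𝓢(E d, ℂ)}
    (hsym : ∀ u v, inner ℂ (toL2 d (T u)) (toL2 d v) = inner ℂ (toL2 d u) (toL2 d (T v)))
    {κ : ℝ} (hκ : 0 < κ)
    (h : ∀ w : ℂ, |w.im| = κ → ∀ v : L2 d,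
      (∀ u, inner ℂ v (toL2 d (T u)) = w * inner ℂ v (toL2 d u)) → v = 0) :
    IsEssentiallySelfAdjoint (onTest T) := by
  have key : ∀ w : ℂ, |w.im| = κ → ∀ v : L2 d,
      (∀ u : (onTest T).domain, inner ℂ v (onTest T u - w • (u : L2 d)) = 0) → v = 0 := by
    intro w hw v hv
    refine h w hw v fun u => ?_
    have hcl : IsClosed {q : L2 d × L2 d | inner ℂ v q.2 = w * inner ℂ v q.1} :=
      isClosed_eq (by fun_prop) (by fun_prop)
    have hsub : ((onTest T).graph : Set (L2 d × L2 d))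
        ⊆ {q : L2 d × L2 d | inner ℂ v q.2 = w * inner ℂ v q.1} := by
      rintro q hq
      obtain ⟨a, ha1, ha2⟩ := (LinearPMap.mem_graph_iff _).1 hq
      have h3 := hv a
      rw [inner_sub_right, inner_smul_right, sub_eq_zero] at h3
      change inner ℂ v q.2 = w * inner ℂ v q.1
      rw [← ha1, ← ha2, h3]
    exact closure_minimal hsub hcl (mem_closure_graph_onTest T u)
  refine isEssentiallySelfAdjoint_of_symm (w := κ * Complex.I) (dense_domain_onTest T) ?_
    (by simpa using hκ.ne') (key _ (by simpa using hκ.le))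
    (key _ (by simpa using hκ.le))
  intro x y
  obtain ⟨u, hu1, hu2⟩ := exists_test_of_domain T x
  obtain ⟨v, hv1, hv2⟩ := exists_test_of_domain T y
  rw [← hu1, ← hu2, ← hv1, ← hv2]
  exact hsym u v

/-! ### Essential self-adjointness of `P` -/

/-- The symbol of the resolvent of `P`. -/
def symR (k : ℕ) {d : ℕ} (z : ℂ) (ξ : E d) : ℂ := ((symP k ξ : ℂ) - z)⁻¹

theorem hasTemperateGrowth_symR (k d : ℕ) {z : ℂ} (hz : z.im ≠ 0) :
    (symR k (d := d) z).HasTemperateGrowth :=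
  hasTemperateGrowth_inv_ofReal_sub (hasTemperateGrowth_symP k d) hz

theorem ofReal_sub_ne_zero (t : ℝ) {z : ℂ} (hz : z.im ≠ 0) : (t : ℂ) - z ≠ 0 := by
  intro h
  apply hz
  have := congrArg Complex.im h
  simpa using this

theorem schwartzP_fmul_symR (k d : ℕ) {z : ℂ} (hz : z.im ≠ 0) (u : 𝓢(E d, ℂ)) :
    schwartzP k d (fmul (symR k z) u) - z • fmul (symR k z) u = u := by
  have hP := hasTemperateGrowth_ofReal (hasTemperateGrowth_symP k d)
  have hR := hasTemperateGrowth_symR k d hz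
  rw [schwartzP_eq_fmul, fmul_fmul hP hR, sub_eq_iff_eq_add, ← fmul_const_mul hR]
  conv_rhs => enter [1]; rw [← fmul_one u]
  rw [← fmul_add (.const _) ((Function.HasTemperateGrowth.const _).fun_mul hR)]
  congr 2
  funext ξ
  have h := mul_inv_cancel₀ (ofReal_sub_ne_zero (symP k ξ) hz)
  rw [symR]
  linear_combination h

/-- The multiplier `symR k w` solves (P - w)u = f within the Schwartz space, so a vector orthogonal
to the range is orthogonal to a dense set. -/
theorem isEssentiallySelfAdjoint_opP₀ (k d : ℕ) : IsEssentiallySelfAdjoint (opP₀ k d) := by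
  refine isEssentiallySelfAdjoint_onTest (inner_schwartzP k d) one_pos fun w hw v hv => ?_
  have hw' : w.im ≠ 0 := by
    intro h; rw [h] at hw; simp at hw
  have h1 : ∀ u, inner ℂ v (toL2 d u) = 0 := by
    intro u
    conv_lhs => rw [← schwartzP_fmul_symR k d hw' u]
    rw [map_sub, map_smul, inner_sub_right, inner_smul_right, hv, sub_self]
  have h2 : Dense (Set.range (toL2 d)) := denseRange_toL2 d
  refine h2.eq_zero_of_inner_left ℂ ?_
  rintro - ⟨u, rfl⟩
  exact h1 u

/-! ### Essential self-adjointness of `A` -/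

theorem memLp_top_ofReal {d : ℕ} {g : E d → ℝ} (hg : Continuous g) {C : ℝ} (h : ∀ x, |g x| ≤ C) :
    MemLp (fun x => ((g x : ℝ) : ℂ)) ∞ (volume : Measure (E d)) :=
  memLp_top_of_bound (Complex.continuous_ofReal.comp hg).aestronglyMeasurable C
    (.of_forall fun x => by rw [Complex.norm_real]; exact h x)

theorem mulOp_toL2 {d : ℕ} {g : E d → ℂ} (hg : MemLp g ∞ (volume : Measure (E d)))
    (hg' : g.HasTemperateGrowth) (u : 𝓢(E d, ℂ)) : mulOp g (toL2 d u) = toL2 d (mulS g u) := by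
  apply Lp.ext
  filter_upwards [mulOp_apply hg (toL2 d u), u.coeFn_toLp 2 (volume : Measure (E d)),
    (mulS g u).coeFn_toLp 2 (volume : Measure (E d))] with x h1 h2 h3
  rw [h1]
  rw [SchwartzMap.toLpCLM_apply, SchwartzMap.toLpCLM_apply, h2, h3,
    SchwartzMap.smulLeftCLM_apply_apply hg', smul_eq_mul]

theorem norm_mulOp_apply_le {d : ℕ} {g : E d → ℂ} (hg : MemLp g ∞ (volume : Measure (E d)))
    {C : ℝ} (hC : ∀ x, ‖g x‖ ≤ C) (f : L2 d) : ‖mulOp g f‖ ≤ C * ‖f‖ := by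
  refine Lp.norm_le_mul_norm_of_ae_le_mul ?_
  filter_upwards [mulOp_apply hg f] with x h
  rw [h, norm_mul]
  exact mul_le_mul_of_nonneg_right (hC x) (norm_nonneg _)

theorem inner_mulOp {d : ℕ} {g : E d → ℝ}
    (hg : MemLp (fun x => ((g x : ℝ) : ℂ)) ∞ (volume : Measure (E d))) (f f' : L2 d) :
    inner ℂ (mulOp (fun x => ((g x : ℝ) : ℂ)) f) f'
      = inner ℂ f (mulOp (fun x => ((g x : ℝ) : ℂ)) f') := by
  rw [L2.inner_def, L2.inner_def]
  refine integral_congr_ae ?_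
  filter_upwards [mulOp_apply hg f, mulOp_apply hg f'] with x h1 h2
  rw [h1, h2]
  simp
  ring

theorem continuous_cutoff (d : ℕ) (r : ℝ) : Continuous (cutoff (d := d) r) :=
  (hasTemperateGrowth_cutoff d r).1.continuous

theorem abs_cutoff_le {d : ℕ} (r : ℝ) (x : E d) : |cutoff r x| ≤ 1 := by
  rw [abs_of_pos (cutoff_pos r x)]; exact cutoff_le_one r x

/-- The bounded operator of multiplication by the cutoff. -/
def cutOp (d : ℕ) (r : ℝ) : L2 d →L[ℂ] L2 d := mulOp fun x => ((cutoff r x : ℝ) : ℂ)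

theorem memLp_cutoff (d : ℕ) (r : ℝ) :
    MemLp (fun x : E d => ((cutoff r x : ℝ) : ℂ)) ∞ (volume : Measure (E d)) :=
  memLp_top_ofReal (continuous_cutoff d r) (abs_cutoff_le r)

theorem cutOp_toL2 {d : ℕ} (r : ℝ) (u : 𝓢(E d, ℂ)) :
    cutOp d r (toL2 d u) = toL2 d (cutS r u) :=
  mulOp_toL2 (memLp_cutoff d r) (hasTemperateGrowth_ofReal (hasTemperateGrowth_cutoff d r)) u

theorem norm_cutOp_apply_le {d : ℕ} (r : ℝ) (f : L2 d) : ‖cutOp d r f‖ ≤ ‖f‖ := by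
  have h := norm_mulOp_apply_le (memLp_cutoff d r) (C := 1)
    (fun x => by rw [Complex.norm_real]; exact abs_cutoff_le r x) f
  rwa [one_mul] at h

theorem tendsto_cutOp {d : ℕ} (f : L2 d) :
    Tendsto (fun n : ℕ => cutOp d ((n : ℝ) + 1)⁻¹ f) atTop (𝓝 f) := by
  have hS : ∀ u : 𝓢(E d, ℂ), Tendsto (fun n : ℕ => cutOp d ((n : ℝ) + 1)⁻¹ (toL2 d u)) atTop
      (𝓝 (toL2 d u)) := by
    intro u
    -- On Schwartz functions u - Ju = r² J|x|²u gives a rate; the general case follows by density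
    -- since the cutoffs are contractions.
    have hb : ∀ r : ℝ, 0 ≤ r → ‖toL2 d u - cutOp d r (toL2 d u)‖
        ≤ r * (r * ∑ l, ‖toL2 d (mulS (coord l) (mulS (coord l) u))‖) := by
      intro r hr
      rw [cutOp_toL2, ← map_sub]
      conv_lhs => enter [1, 2, 1]; rw [cutS_inverse r u]
      rw [add_sub_cancel_left, map_smul, norm_smul, Complex.norm_real,
        Real.norm_of_nonneg (sq_nonneg r), map_sum, sq, mul_assoc]
      gcongr
      exact (norm_sum_le _ _).trans (Finset.sum_le_sum fun l _ => norm_toL2_cutS_le r _)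
    rw [tendsto_iff_norm_sub_tendsto_zero]
    set M := ∑ l, ‖toL2 d (mulS (coord l) (mulS (coord l) u))‖
    have h0 : Tendsto (fun n : ℕ => ((n : ℝ) + 1)⁻¹) atTop (𝓝 0) := by
      simpa using tendsto_one_div_add_atTop_nhds_zero_nat (𝕜 := ℝ)
    have h1 : Tendsto (fun n : ℕ => ((n : ℝ) + 1)⁻¹ * (((n : ℝ) + 1)⁻¹ * M)) atTop (𝓝 0) := by
      simpa using h0.mul (h0.mul_const M)
    refine squeeze_zero (fun n => norm_nonneg _) (fun n => ?_) h1
    rw [norm_sub_rev]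
    exact hb _ (by positivity)
  rw [Metric.tendsto_atTop]
  intro ε hε
  obtain ⟨-, ⟨u, rfl⟩, hu⟩ := Metric.mem_closure_iff.1 (denseRange_toL2 d f) (ε / 3) (by positivity)
  obtain ⟨N, hN⟩ := Metric.tendsto_atTop.1 (hS u) (ε / 3) (by positivity)
  refine ⟨N, fun n hn => ?_⟩
  have h1 := hN n hn
  rw [dist_eq_norm] at h1 hu ⊢
  have h2 := norm_cutOp_apply_le ((n : ℝ) + 1)⁻¹ (f - toL2 d u)
  calc ‖cutOp d ((n : ℝ) + 1)⁻¹ f - f‖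
      = ‖cutOp d ((n : ℝ) + 1)⁻¹ (f - toL2 d u) + (cutOp d ((n : ℝ) + 1)⁻¹ (toL2 d u) - toL2 d u)
        - (f - toL2 d u)‖ := by
        congr 1
        rw [map_sub]; abel
    _ ≤ ‖cutOp d ((n : ℝ) + 1)⁻¹ (f - toL2 d u)‖ + ‖cutOp d ((n : ℝ) + 1)⁻¹ (toL2 d u) - toL2 d u‖
        + ‖f - toL2 d u‖ := (norm_sub_le _ _).trans (add_le_add_left (norm_add_le _ _) _)
    _ < ε := by linarith

/-- Formally, testing with J²v gives w‖Jv‖² = ⟨Jv, AJv⟩ plus a commutator term ⟨v, (JA - AJ)Jv⟩. The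
first term is real, so |Im w| sees only the commutator. As AJ is bounded for fixed r, an
approximation of v by Schwartz functions makes this rigorous. -/
theorem norm_cutOp_le_of_deficiency (k d : ℕ) {r : ℝ} (hr : 0 < r) {w : ℂ}
    {v : L2 d} (hv : ∀ u, inner ℂ v (toL2 d (schwartzA k d u)) = w * inner ℂ v (toL2 d u)) :
    |w.im| * ‖cutOp d r v‖ ^ 2 ≤ 4 * (d : ℝ) ^ 2 * ‖v‖ * ‖cutOp d r v‖ := by
  have hd : Dense (Set.range (toL2 d)) := denseRange_toL2 d
  obtain ⟨f, hf, hlim⟩ := mem_closure_iff_seq_limit.1 (hd v)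
  choose u hu using hf
  have hlim' : Tendsto (fun n => toL2 d (u n)) atTop (𝓝 v) := by simpa only [hu] using hlim
  have hJ : Tendsto (fun n => toL2 d (cutS r (u n))) atTop (𝓝 (cutOp d r v)) := by
    have := ((cutOp d r).continuous.tendsto v).comp hlim'
    refine this.congr fun n => ?_
    rw [Function.comp_apply, cutOp_toL2]
  have hA : ∃ y, Tendsto (fun n => toL2 d (schwartzA k d (cutS r (u n)))) atTop (𝓝 y) := by
    refine cauchySeq_tendsto_of_complete ?_
    have hK : 0 < d * (2 * r⁻¹ + 1) + 1 := by positivity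
    rw [Metric.cauchySeq_iff']
    intro ε hε
    obtain ⟨N, hN⟩ := Metric.cauchySeq_iff'.1 hlim'.cauchySeq
      (ε / (d * (2 * r⁻¹ + 1) + 1)) (by positivity)
    refine ⟨N, fun n hn => ?_⟩
    have h2 := hN n hn
    rw [dist_eq_norm, lt_div_iff₀ hK, ← map_sub] at h2
    have h3 := norm_schwartzA_cutS_le_mul k d hr (u n - u N)
    rw [dist_eq_norm, ← map_sub, ← map_sub, ← map_sub]
    have := norm_nonneg (toL2 d (u n - u N))
    linarith
  obtain ⟨y, hy⟩ := hA
  have hreal : (inner ℂ (cutOp d r v) y).im = 0 := by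
    have h1 : Tendsto (fun n => (inner ℂ (toL2 d (cutS r (u n)))
        (toL2 d (schwartzA k d (cutS r (u n))))).im) atTop (𝓝 (inner ℂ (cutOp d r v) y).im) :=
      (Complex.continuous_im.tendsto _).comp (hJ.inner hy)
    refine tendsto_nhds_unique h1 (tendsto_const_nhds.congr fun n => ?_)
    exact (inner_im_eq_zero_of_symm (inner_schwartzA k d _ _)).symm
  have hstep : ∀ n, ‖inner ℂ (cutOp d r v) (toL2 d (schwartzA k d (cutS r (u n))))
      - w * inner ℂ (cutOp d r v) (toL2 d (cutS r (u n)))‖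
      ≤ 4 * (d : ℝ) ^ 2 * ‖v‖ * ‖toL2 d (cutS r (u n))‖ := by
    intro n
    have h1 : ∀ g : 𝓢(E d, ℂ), inner ℂ (cutOp d r v) (toL2 d g)
        = inner ℂ v (toL2 d (cutS r g)) := fun g => by
      rw [← cutOp_toL2]; exact inner_mulOp (memLp_cutoff d r) v (toL2 d g)
    rw [h1, h1, ← hv, ← inner_sub_right, ← map_sub]
    have h2 := norm_schwartzA_cutS_le k d hr.le (cutS r (u n))
    rw [map_sub, norm_sub_rev, ← map_sub] at h2
    refine (norm_inner_le_norm _ _).trans ?_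
    have := norm_nonneg v
    nlinarith
  have hlim2 : ‖inner ℂ (cutOp d r v) y - w * inner ℂ (cutOp d r v) (cutOp d r v)‖
      ≤ 4 * (d : ℝ) ^ 2 * ‖v‖ * ‖cutOp d r v‖ := by
    refine le_of_tendsto_of_tendsto (((tendsto_const_nhds.inner hy).sub
      ((tendsto_const_nhds.inner hJ).const_mul w)).norm) (hJ.norm.const_mul _) (.of_forall hstep)
  refine le_trans ?_ ((Complex.abs_im_le_norm _).trans hlim2)
  have h1 : (w * inner ℂ (cutOp d r v) (cutOp d r v)).im = w.im * ‖cutOp d r v‖ ^ 2 := by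
    rw [inner_self_eq_norm_sq_to_K]
    simp [← Complex.ofReal_pow]
  rw [Complex.sub_im, hreal, h1, zero_sub, abs_neg, abs_mul,
    abs_of_nonneg (sq_nonneg ‖cutOp d r v‖)]

theorem isEssentiallySelfAdjoint_opA₀ (k d : ℕ) : IsEssentiallySelfAdjoint (opA₀ k d) := by
  -- The spectral parameter is taken just beyond the commutator bound 4d². As r → 0 a deficiency
  -- vector satisfies (4d² + 1)‖v‖² ≤ 4d²‖v‖², so it vanishes.
  refine isEssentiallySelfAdjoint_onTest (inner_schwartzA k d) (κ := 4 * (d : ℝ) ^ 2 + 1)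
    (by positivity) fun w hw v hv => ?_
  have h1 : ∀ n : ℕ, (4 * (d : ℝ) ^ 2 + 1) * ‖cutOp d ((n : ℝ) + 1)⁻¹ v‖ ^ 2
      ≤ 4 * (d : ℝ) ^ 2 * ‖v‖ * ‖cutOp d ((n : ℝ) + 1)⁻¹ v‖ := fun n => by
    rw [← hw]
    exact norm_cutOp_le_of_deficiency k d (by positivity) hv
  have h2 := (tendsto_cutOp v).norm
  have h3 : (4 * (d : ℝ) ^ 2 + 1) * ‖v‖ ^ 2 ≤ 4 * (d : ℝ) ^ 2 * ‖v‖ * ‖v‖ :=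
    le_of_tendsto_of_tendsto ((h2.pow 2).const_mul _) (h2.const_mul _) (.of_forall h1)
  have h4 : ‖v‖ ^ 2 ≤ 0 := by nlinarith
  exact norm_eq_zero.1 (pow_eq_zero_iff two_ne_zero |>.1 (le_antisymm h4 (sq_nonneg _)))

/-! ### The commutator estimate -/

theorem fderiv_ofReal_comp {d : ℕ} {g : E d → ℝ} {g' : E d →L[ℝ] ℝ} {ξ : E d}
    (h : HasFDerivAt g g' ξ) (v : E d) :
    fderiv ℝ (fun ξ => ((g ξ : ℝ) : ℂ)) ξ v = ((g' v : ℝ) : ℂ) := by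
  have h2 : HasFDerivAt (fun ξ => ((g ξ : ℝ) : ℂ)) (Complex.ofRealCLM ∘L g') ξ :=
    Complex.ofRealCLM.hasFDerivAt.comp ξ h
  rw [h2.fderiv]
  rfl

theorem hasFDerivAt_symP (k : ℕ) {d : ℕ} (ξ : E d) :
    HasFDerivAt (symP k (d := d)) (fderiv ℝ (symP k) ξ) ξ :=
  ((hasTemperateGrowth_symP k d).1.differentiable (by simp) ξ).hasFDerivAt

theorem fderiv_symR_tilde (k : ℕ) {d : ℕ} {z : ℂ} (hz : z.im ≠ 0) (ξ : E d) :
    fderiv ℝ (symR k z) ξ (tilde k ξ) = -(symR k z ξ * symR k z ξ * (2 * (‖ξ‖ : ℂ) ^ 2)) := by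
  have h1 : HasFDerivAt (fun ξ : E d => ((symP k ξ : ℝ) : ℂ) - z)
      (Complex.ofRealCLM ∘L fderiv ℝ (symP k) ξ) ξ :=
    (Complex.ofRealCLM.hasFDerivAt.comp ξ (hasFDerivAt_symP k ξ)).sub_const z
  have h2 : HasFDerivAt (symR k z) _ ξ :=
    (hasFDerivAt_inv' (𝕜 := ℝ) (ofReal_sub_ne_zero (symP k ξ) hz)).comp ξ h1
  rw [h2.fderiv]
  simp [fderiv_symP_tilde, symR]
  ring

/-! ### Inverting the commutator near the energy surface -/

/-- The denominator `|ξ|⁴ + (p(ξ) - λ)²`. -/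
def symQ (k : ℕ) {d : ℕ} (lam : ℝ) (ξ : E d) : ℝ := (‖ξ‖ ^ 2) ^ 2 + (symP k ξ - lam) ^ 2

/-- The function `h` for which `h` times the derivative of `p` along the flow is `1` on the
energy surface `p = λ`. -/
def symh (k : ℕ) {d : ℕ} (lam : ℝ) (ξ : E d) : ℝ :=
  ‖ξ‖ ^ 2 * (1 + ‖ξ‖ ^ 2) / 2 * (symQ k lam ξ)⁻¹

/-- Since |λ| ≤ |p - λ| + |ξ|², the two squares in `symQ` cannot both be small: δ² ≤ 2Q. Together
with |ξ|⁴ ≤ Q and (1+|ξ|²)² ≤ 2 + 2|ξ|⁴ this gives the constant. -/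
theorem sq_le_symQ (k : ℕ) {d : ℕ} {δ lam : ℝ} (hδ : 0 < δ) (hl : δ ≤ |lam|) (ξ : E d) :
    (2 + 4 / δ ^ 2)⁻¹ * (1 + ‖ξ‖ ^ 2) ^ 2 ≤ symQ k lam ξ := by
  have hp := abs_symP_le k ξ
  have h1 : |lam| ≤ |symP k ξ - lam| + ‖ξ‖ ^ 2 := by
    have := abs_sub_abs_le_abs_sub lam (symP k ξ)
    rw [abs_sub_comm] at this
    linarith
  have h2 : δ ^ 2 ≤ 2 * symQ k lam ξ := by
    have h3 : δ ^ 2 ≤ (|symP k ξ - lam| + ‖ξ‖ ^ 2) ^ 2 := by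
      have := hl.trans h1
      gcongr
    have h4 : |symP k ξ - lam| ^ 2 = (symP k ξ - lam) ^ 2 := sq_abs _
    unfold symQ
    nlinarith [sq_nonneg (|symP k ξ - lam| - ‖ξ‖ ^ 2)]
  have h5 : (‖ξ‖ ^ 2) ^ 2 ≤ symQ k lam ξ := by
    unfold symQ; nlinarith [sq_nonneg (symP k ξ - lam)]
  rw [inv_mul_le_iff₀ (by positivity)]
  have h6 : 2 ≤ 4 / δ ^ 2 * symQ k lam ξ := by
    rw [div_mul_eq_mul_div, le_div_iff₀ (by positivity)]
    linarith
  nlinarith [sq_nonneg (‖ξ‖ ^ 2 - 1)]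

theorem hasTemperateGrowth_symQ (k d : ℕ) (lam : ℝ) : (symQ k (d := d) lam).HasTemperateGrowth :=
  ((hasTemperateGrowth_norm_sq d).pow 2).add
    (((hasTemperateGrowth_symP k d).sub (.const lam)).pow 2)

theorem symQ_ge (k : ℕ) {d : ℕ} {δ lam : ℝ} (hδ : 0 < δ) (hl : δ ≤ |lam|) (ξ : E d) :
    (2 + 4 / δ ^ 2)⁻¹ ≤ symQ k lam ξ := by
  refine le_trans ?_ (sq_le_symQ k hδ hl ξ)
  have h : 1 ≤ (1 + ‖ξ‖ ^ 2) ^ 2 := by nlinarith [sq_nonneg ‖ξ‖, sq_nonneg (‖ξ‖ ^ 2)]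
  exact le_mul_of_one_le_right (by positivity) h

theorem hasTemperateGrowth_symh (k d : ℕ) {δ lam : ℝ} (hδ : 0 < δ) (hl : δ ≤ |lam|) :
    (symh k (d := d) lam).HasTemperateGrowth := by
  have h1 := hasTemperateGrowth_inv (hasTemperateGrowth_symQ k d lam)
    (c := (2 + 4 / δ ^ 2)⁻¹) (by positivity) (symQ_ge k hδ hl)
  have h2 : (fun ξ : E d => ‖ξ‖ ^ 2 * (1 + ‖ξ‖ ^ 2) / 2).HasTemperateGrowth := by
    simp only [div_eq_mul_inv]
    exact ((hasTemperateGrowth_norm_sq d).mul ((Function.HasTemperateGrowth.const 1).add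
      (hasTemperateGrowth_norm_sq d))).mul (.const _)
  exact h2.mul h1

theorem abs_symh_le (k : ℕ) {d : ℕ} {δ lam : ℝ} (hδ : 0 < δ) (hl : δ ≤ |lam|) (ξ : E d) :
    |symh k lam ξ| ≤ 2 + 4 / δ ^ 2 := by
  have h1 := sq_le_symQ k hδ hl ξ
  have h2 : 0 < symQ k lam ξ := lt_of_lt_of_le (by positivity) h1
  rw [inv_mul_le_iff₀ (by positivity)] at h1
  rw [abs_of_nonneg (by unfold symh; positivity), symh, ← div_eq_mul_inv, div_le_iff₀ h2]
  refine le_trans ?_ h1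
  nlinarith [sq_nonneg ‖ξ‖]

/-- This derivative is the cost of commuting `A` with h. Along ξ̃ the functions |ξ|² and p have
derivatives 2p and 2|ξ|², both of order 1+|ξ|² at most, so the quotient by `symQ` stays bounded,
uniformly for λ in a compact set avoiding zero. -/
theorem exists_fderiv_symh_bound (k d : ℕ) {δ L : ℝ} (hδ : 0 < δ) (hL : 0 ≤ L) :
    ∃ C : ℝ, 0 ≤ C ∧ ∀ lam : ℝ, δ ≤ |lam| → |lam| ≤ L → ∀ ξ : E d,
      |fderiv ℝ (symh k lam) ξ (tilde k ξ)| ≤ C := by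
  set κ : ℝ := 2 + 4 / δ ^ 2 with hκ
  refine ⟨2 * κ + (4 + 2 * L) * κ ^ 2, by positivity, fun lam hl hlL ξ => ?_⟩
  have h1 := sq_le_symQ k hδ hl ξ
  have hQ : 0 < symQ k lam ξ := lt_of_lt_of_le (by positivity) h1
  have hn := hasFDerivAt_norm_sq ξ
  have hp := hasFDerivAt_symP k ξ
  have hQ' : HasFDerivAt (symQ k lam) _ ξ := (hn.pow 2).add ((hp.sub_const lam).pow 2)
  have hd : HasFDerivAt (symh k lam) _ ξ :=
    ((hn.mul (hn.const_add 1)).mul_const (2⁻¹ : ℝ)).mul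
      ((hasDerivAt_inv hQ.ne').comp_hasFDerivAt ξ hQ')
  have hin : inner ℝ ξ (tilde k ξ) = symP k ξ := inner_tilde_self k ξ
  have hval : fderiv ℝ (symh k lam) ξ (tilde k ξ)
      = symP k ξ * (1 + 2 * ‖ξ‖ ^ 2) * (symQ k lam ξ)⁻¹
        - ‖ξ‖ ^ 2 * (1 + ‖ξ‖ ^ 2) / 2 * ((symQ k lam ξ)⁻¹ ^ 2
          * (4 * ‖ξ‖ ^ 2 * symP k ξ + 4 * (symP k ξ - lam) * ‖ξ‖ ^ 2)) := by
    rw [hd.fderiv]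
    simp [fderiv_symP_tilde, hin]
    ring
  rw [hval]
  set N : ℝ := 1 + ‖ξ‖ ^ 2 with hN
  have hN1 : 1 ≤ N := by rw [hN]; nlinarith [sq_nonneg ‖ξ‖]
  have hQi : (symQ k lam ξ)⁻¹ * N ^ 2 ≤ κ := by
    rw [inv_mul_le_iff₀ (by positivity)] at h1
    rw [inv_mul_le_iff₀ hQ, mul_comm]
    exact h1
  set q := (symQ k lam ξ)⁻¹ with hq
  have hq0 : 0 < q := inv_pos.2 hQ
  have hpN : |symP k ξ| ≤ N := (abs_symP_le k ξ).trans (by rw [hN]; linarith)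
  have hnN : ‖ξ‖ ^ 2 ≤ N := by rw [hN]; linarith
  have hn0 : 0 ≤ ‖ξ‖ ^ 2 := sq_nonneg _
  have hplN : |symP k ξ - lam| ≤ (1 + L) * N := by
    have h5 := abs_sub (symP k ξ) lam
    nlinarith
  have t1 : |symP k ξ * (1 + 2 * ‖ξ‖ ^ 2) * q| ≤ 2 * κ := by
    rw [abs_mul, abs_mul, abs_of_pos hq0, abs_of_nonneg (by positivity : 0 ≤ 1 + 2 * ‖ξ‖ ^ 2)]
    calc |symP k ξ| * (1 + 2 * ‖ξ‖ ^ 2) * q ≤ N * (2 * N) * q := by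
          have : 1 + 2 * ‖ξ‖ ^ 2 ≤ 2 * N := by rw [hN]; linarith
          gcongr
      _ = 2 * (q * N ^ 2) := by ring
      _ ≤ 2 * κ := by linarith
  have t2 : |‖ξ‖ ^ 2 * N / 2 * (q ^ 2
          * (4 * ‖ξ‖ ^ 2 * symP k ξ + 4 * (symP k ξ - lam) * ‖ξ‖ ^ 2))| ≤ (4 + 2 * L) * κ ^ 2 := by
    have h6 : |4 * ‖ξ‖ ^ 2 * symP k ξ + 4 * (symP k ξ - lam) * ‖ξ‖ ^ 2|
        ≤ (8 + 4 * L) * N ^ 2 := by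
      calc _ ≤ |4 * ‖ξ‖ ^ 2 * symP k ξ| + |4 * (symP k ξ - lam) * ‖ξ‖ ^ 2| := abs_add_le _ _
        _ = 4 * ‖ξ‖ ^ 2 * |symP k ξ| + 4 * |symP k ξ - lam| * ‖ξ‖ ^ 2 := by
          rw [abs_mul, abs_mul (4 * (symP k ξ - lam)), abs_mul 4 (symP k ξ - lam),
            abs_of_nonneg (by positivity : 0 ≤ 4 * ‖ξ‖ ^ 2), abs_of_nonneg hn0,
            abs_of_pos (four_pos : (0 : ℝ) < 4)]
        _ ≤ 4 * N * N + 4 * ((1 + L) * N) * N := by gcongr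
        _ = _ := by ring
    rw [abs_mul, abs_mul (q ^ 2), abs_of_nonneg (by positivity : 0 ≤ q ^ 2),
      abs_of_nonneg (by positivity : 0 ≤ ‖ξ‖ ^ 2 * N / 2)]
    calc _ ≤ N * N / 2 * (q ^ 2 * ((8 + 4 * L) * N ^ 2)) := by gcongr
      _ = (4 + 2 * L) * (q * N ^ 2) ^ 2 := by ring
      _ ≤ (4 + 2 * L) * κ ^ 2 := by gcongr
  rw [abs_le] at t1 t2 ⊢
  constructor <;> linarith

/-- The symbol of the remainder in the commutator representation of the squared resolvent. -/
def symE (k : ℕ) {d : ℕ} (z : ℂ) (ξ : E d) : ℂ :=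
  (1 - 2 * (symh k z.re ξ : ℂ) * (symH ξ : ℂ) * (‖ξ‖ : ℂ) ^ 2) * (symR k z ξ * symR k z ξ)

theorem hasTemperateGrowth_symE (k d : ℕ) {δ : ℝ} (hδ : 0 < δ) {z : ℂ} (hl : δ ≤ |z.re|)
    (hz : z.im ≠ 0) : (symE k (d := d) z).HasTemperateGrowth := by
  have h1 := hasTemperateGrowth_ofReal (hasTemperateGrowth_symh k d hδ hl)
  have h2 := hasTemperateGrowth_ofReal (hasTemperateGrowth_symH d)
  have h3 : (fun ξ : E d => (‖ξ‖ : ℂ) ^ 2).HasTemperateGrowth := by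
    simpa only [Complex.ofReal_pow] using hasTemperateGrowth_ofReal (hasTemperateGrowth_norm_sq d)
  have h4 := hasTemperateGrowth_symR k d hz
  have h5 := ((Function.HasTemperateGrowth.const (1 : ℂ)).sub
    ((((Function.HasTemperateGrowth.const (2 : ℂ)).mul h1).mul h2).mul h3)).mul (h4.mul h4)
  exact h5

/-- The choice of `symh` makes the first factor equal to (p - Re z)²/Q. Its double zero on the
energy surface cancels the square of the resolvent, uniformly in Im z. -/
theorem norm_symE_le (k : ℕ) {d : ℕ} {δ : ℝ} (hδ : 0 < δ) {z : ℂ} (hl : δ ≤ |z.re|)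
    (hz : z.im ≠ 0) (ξ : E d) : ‖symE k z ξ‖ ≤ 2 + 4 / δ ^ 2 := by
  have hQ := symQ_ge k hδ hl ξ
  have hQ0 : 0 < symQ k z.re ξ := lt_of_lt_of_le (by positivity) hQ
  have h1 : (1 - 2 * (symh k z.re ξ : ℂ) * (symH ξ : ℂ) * (‖ξ‖ : ℂ) ^ 2)
      = (((symP k ξ - z.re) ^ 2 * (symQ k z.re ξ)⁻¹ : ℝ) : ℂ) := by
    have h2 : 1 - 2 * symh k z.re ξ * symH ξ * ‖ξ‖ ^ 2
        = (symP k ξ - z.re) ^ 2 * (symQ k z.re ξ)⁻¹ := by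
      have h3 : symQ k z.re ξ * (symQ k z.re ξ)⁻¹ = 1 := mul_inv_cancel₀ hQ0.ne'
      have h4 : symQ k z.re ξ = (‖ξ‖ ^ 2) ^ 2 + (symP k ξ - z.re) ^ 2 := rfl
      have h5 := symH_mul ξ
      rw [symh]
      set q := (symQ k z.re ξ)⁻¹
      rw [h4] at h3
      linear_combination (-(‖ξ‖ ^ 2) ^ 2 * q) * h5 - h3
    rw [← h2]
    push_cast
    ring
  have h6 : (symP k ξ - z.re) ^ 2 * ‖symR k z ξ‖ ^ 2 ≤ 1 := by
    rw [symR, norm_inv, inv_pow, ← div_eq_mul_inv, div_le_one (by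
      have := norm_pos_iff.2 (ofReal_sub_ne_zero (symP k ξ) hz)
      positivity)]
    rw [← Complex.normSq_eq_norm_sq, Complex.normSq_apply]
    simp
    nlinarith [mul_self_nonneg z.im]
  have h7 : (symQ k z.re ξ)⁻¹ ≤ 2 + 4 / δ ^ 2 := by
    rw [inv_le_comm₀ hQ0 (by positivity)]; exact hQ
  rw [symE, h1, norm_mul, Complex.norm_real, Real.norm_of_nonneg (by positivity), norm_mul]
  calc _ = ((symP k ξ - z.re) ^ 2 * ‖symR k z ξ‖ ^ 2) * (symQ k z.re ξ)⁻¹ := by ring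
    _ ≤ 1 * (2 + 4 / δ ^ 2) := by gcongr
    _ = _ := one_mul _

/-- Here [A, R] = -(2i/π)(1+|ξ|²)⁻¹|ξ|²R², so iπh[A, R] reproduces R² up to a factor equal to 1 on
the energy surface; `symE` is the difference. -/
theorem fmul_symR_sq (k d : ℕ) {δ : ℝ} (hδ : 0 < δ) {z : ℂ} (hl : δ ≤ |z.re|)
    (hz : z.im ≠ 0) (u : 𝓢(E d, ℂ)) :
    fmul (symR k z) (fmul (symR k z) u)
      = (Complex.I * Real.pi) • fmul (fun ξ => (symh k z.re ξ : ℂ))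
          (schwartzA k d (fmul (symR k z) u) - fmul (symR k z) (schwartzA k d u))
        + fmul (symE k z) u := by
  have hR := hasTemperateGrowth_symR k d hz
  have hh := hasTemperateGrowth_ofReal (hasTemperateGrowth_symh k d hδ hl)
  have hE := hasTemperateGrowth_symE k d hδ hl hz
  have hc : (fun ξ : E d => Complex.I / Real.pi *
      ((symH ξ : ℂ) * fderiv ℝ (symR k z) ξ (tilde k ξ))).HasTemperateGrowth := by
    have h3 : (fun ξ : E d => (‖ξ‖ : ℂ) ^ 2).HasTemperateGrowth := by
      simpa only [Complex.ofReal_pow] using hasTemperateGrowth_ofReal (hasTemperateGrowth_norm_sq d)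
    have h4 := (Function.HasTemperateGrowth.const (Complex.I / Real.pi)).mul
      ((hasTemperateGrowth_ofReal (hasTemperateGrowth_symH d)).mul
        ((hR.mul hR).mul ((Function.HasTemperateGrowth.const (2 : ℂ)).mul h3)).neg)
    simp only [fderiv_symR_tilde k hz]
    exact h4
  rw [schwartzA_fmul k d hR, add_sub_cancel_left, fmul_fmul hh hc,
    ← fmul_const_mul (hh.fun_mul hc),
    ← fmul_add ((Function.HasTemperateGrowth.const _).fun_mul (hh.fun_mul hc)) hE, fmul_fmul hR hR]
  congr 2
  funext ξ
  rw [fderiv_symR_tilde k hz, symE]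
  have h1 : Complex.I * Real.pi * (Complex.I / Real.pi) = -1 := by
    have : (Real.pi : ℂ) ≠ 0 := by exact_mod_cast Real.pi_ne_zero
    field_simp
    simp
  linear_combination (symh k z.re ξ : ℂ) * ((symH ξ : ℂ) *
    (symR k z ξ * symR k z ξ * (2 * (‖ξ‖ : ℂ) ^ 2))) * h1

theorem conj_symR (k : ℕ) {d : ℕ} (z : ℂ) (ξ : E d) : conj (symR k z ξ) = symR k (conj z) ξ := by
  simp [symR]

/-- The commutator estimate: matrix elements of the squared resolvent are controlled by the
resolvent applied to vectors in the domain of `A`. -/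
theorem exists_bound_symR_sq (k d : ℕ) {δ L : ℝ} (hδ : 0 < δ) (hL : 0 ≤ L) :
    ∃ C : ℝ, 0 ≤ C ∧ ∀ z : ℂ, δ ≤ |z.re| → |z.re| ≤ L → z.im ≠ 0 → ∀ f g : 𝓢(E d, ℂ),
      ‖inner ℂ (toL2 d f) (toL2 d (fmul (symR k z) (fmul (symR k z) g)))‖
        ≤ C * ((‖toL2 d f‖ + ‖toL2 d (schwartzA k d f)‖) * ‖toL2 d (fmul (symR k z) g)‖
          + ‖toL2 d (fmul (symR k (conj z)) f)‖ * (‖toL2 d g‖ + ‖toL2 d (schwartzA k d g)‖)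
          + ‖toL2 d f‖ * ‖toL2 d g‖) := by
  obtain ⟨C₁, hC₁, hb⟩ := exists_fderiv_symh_bound k d hδ hL
  set κ : ℝ := 2 + 4 / δ ^ 2 with hκ
  have hκ0 : 0 < κ := by positivity
  refine ⟨Real.pi * κ + C₁ + κ, by positivity, fun z hl hlL hz f g => ?_⟩
  have hz' : (conj z).im ≠ 0 := by simpa using hz
  have hR := hasTemperateGrowth_symR k d hz
  have hR' := hasTemperateGrowth_symR k d hz'
  have hh := hasTemperateGrowth_ofReal (hasTemperateGrowth_symh k d hδ hl)
  have hE := hasTemperateGrowth_symE k d hδ hl hz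
  have hhd : ∀ ξ : E d, fderiv ℝ (fun ξ => ((symh k z.re ξ : ℝ) : ℂ)) ξ (tilde k ξ)
      = ((fderiv ℝ (symh k z.re) ξ (tilde k ξ) : ℝ) : ℂ) := fun ξ =>
    fderiv_ofReal_comp (((hasTemperateGrowth_symh k d hδ hl).1.differentiable
      (by simp) ξ).hasFDerivAt) _
  set h₁ : E d → ℂ := fun ξ => Complex.I / Real.pi *
    ((symH ξ : ℂ) * fderiv ℝ (fun ξ => ((symh k z.re ξ : ℝ) : ℂ)) ξ (tilde k ξ)) with hh₁
  have hh₁t : h₁.HasTemperateGrowth := by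
    have ht : (fun ξ : E d => tilde k ξ).HasTemperateGrowth := by
      have h3 : (fun ξ : E d => tilde k ξ)
          = fun ξ => ∑ j, (sgn k j * ξ j) • EuclideanSpace.single j (1 : ℝ) := by
        funext ξ
        ext i
        simp [tilde, Pi.single_apply, WithLp.ofLp_sum, Finset.sum_apply]
      rw [h3]
      exact Function.HasTemperateGrowth.sum (s := Finset.univ) fun j _ =>
        ((Function.HasTemperateGrowth.const (sgn k j)).mul (hasTemperateGrowth_coord_real j)).smul
          (.const _)
    have h4 : (fun ξ : E d => fderiv ℝ (fun ξ => ((symh k z.re ξ : ℝ) : ℂ)) ξ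
        (tilde k ξ)).HasTemperateGrowth :=
      (ContinuousLinearMap.id ℝ (E d →L[ℝ] ℂ)).bilinear_hasTemperateGrowth
        (hasTemperateGrowth_fderiv hh) ht
    exact (Function.HasTemperateGrowth.const (Complex.I / Real.pi)).mul
      ((hasTemperateGrowth_ofReal (hasTemperateGrowth_symH d)).mul h4)
  have hh₁b : ∀ ξ, ‖h₁ ξ‖ ≤ C₁ / Real.pi := by
    intro ξ
    have h5 := hb z.re hl hlL ξ
    rw [hh₁]
    simp only [hhd]
    rw [norm_mul, norm_mul, norm_div, Complex.norm_I, Complex.norm_real, Complex.norm_real,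
      Complex.norm_real, Real.norm_of_nonneg Real.pi_pos.le, Real.norm_of_nonneg (symH_pos ξ).le,
      Real.norm_eq_abs, one_div, div_eq_inv_mul]
    have h6 := symH_le_one ξ
    have h7 := symH_pos ξ
    gcongr
    calc _ ≤ 1 * C₁ := by gcongr
      _ = C₁ := one_mul _
  have hhb : ∀ ξ : E d, ‖((symh k z.re ξ : ℝ) : ℂ)‖ ≤ κ := fun ξ => by
    rw [Complex.norm_real]; exact abs_symh_le k hδ hl ξ
  have hhconj : ∀ u v : 𝓢(E d, ℂ), inner ℂ (toL2 d u)
      (toL2 d (fmul (fun ξ => ((symh k z.re ξ : ℝ) : ℂ)) v))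
      = inner ℂ (toL2 d (fmul (fun ξ => ((symh k z.re ξ : ℝ) : ℂ)) u)) (toL2 d v) := by
    intro u v
    rw [inner_toL2_fmul hh]
    simp only [Complex.conj_ofReal]
  -- `A` is removed from the resolvents: in one term it passes through h onto f, leaving the bounded
  -- remainder `h₁`, and in the other it already acts on g while R is moved to f. Only first powers
  -- of the resolvent remain.
  have e1 : inner ℂ (toL2 d f) (toL2 d (fmul (symR k z) (fmul (symR k z) g)))
      = (Complex.I * Real.pi) * (inner ℂ (toL2 d (fmul (fun ξ => ((symh k z.re ξ : ℝ) : ℂ))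
            (schwartzA k d f) + fmul h₁ f)) (toL2 d (fmul (symR k z) g))
          - inner ℂ (toL2 d (fmul (symR k (conj z)) f))
            (toL2 d (fmul (fun ξ => ((symh k z.re ξ : ℝ) : ℂ)) (schwartzA k d g))))
        + inner ℂ (toL2 d f) (toL2 d (fmul (symE k z) g)) := by
    have e3 : inner ℂ (toL2 d f) (toL2 d (fmul (fun ξ => ((symh k z.re ξ : ℝ) : ℂ))
        (schwartzA k d (fmul (symR k z) g))))
        = inner ℂ (toL2 d (fmul (fun ξ => ((symh k z.re ξ : ℝ) : ℂ))
            (schwartzA k d f) + fmul h₁ f)) (toL2 d (fmul (symR k z) g)) := by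
      rw [hhconj, ← inner_schwartzA, schwartzA_fmul k d hh]
    have e2 : inner ℂ (toL2 d f) (toL2 d (fmul (fun ξ => ((symh k z.re ξ : ℝ) : ℂ))
        (fmul (symR k z) (schwartzA k d g))))
        = inner ℂ (toL2 d (fmul (symR k (conj z)) f))
            (toL2 d (fmul (fun ξ => ((symh k z.re ξ : ℝ) : ℂ)) (schwartzA k d g))) := by
      rw [fmul_comm hh hR, inner_toL2_fmul hR']
      simp only [conj_symR, Complex.conj_conj]
    rw [fmul_symR_sq k d hδ hl hz, map_add, inner_add_right, map_smul, inner_smul_right, map_sub,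
      map_sub, inner_sub_right, e3, e2]
  have b1 := norm_toL2_fmul_le hh hhb (schwartzA k d f)
  have b2 := norm_toL2_fmul_le hh₁t hh₁b f
  have b3 := norm_toL2_fmul_le hh hhb (schwartzA k d g)
  have b4 := norm_toL2_fmul_le hE (norm_symE_le k hδ hl hz) g
  rw [← hκ] at b4
  rw [e1]
  have hπ := Real.pi_pos
  set a := ‖toL2 d f‖
  set a' := ‖toL2 d (schwartzA k d f)‖
  set b := ‖toL2 d g‖
  set b' := ‖toL2 d (schwartzA k d g)‖
  set x := ‖toL2 d (fmul (symR k z) g)‖ with hx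
  set y := ‖toL2 d (fmul (symR k (conj z)) f)‖ with hy
  have ha : 0 ≤ a := norm_nonneg _
  have ha' : 0 ≤ a' := norm_nonneg _
  have hb : 0 ≤ b := norm_nonneg _
  have hb' : 0 ≤ b' := norm_nonneg _
  have hx0 : 0 ≤ x := norm_nonneg _
  have hy0 : 0 ≤ y := norm_nonneg _
  calc _ ≤ Real.pi * ((κ * a' + C₁ / Real.pi * a) * x + y * (κ * b')) + a * (κ * b) := by
        refine (norm_add_le _ _).trans (add_le_add ?_ ?_)
        · rw [norm_mul, norm_mul, Complex.norm_I, one_mul, Complex.norm_real,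
            Real.norm_of_nonneg hπ.le]
          refine mul_le_mul_of_nonneg_left ((norm_sub_le _ _).trans (add_le_add ?_ ?_)) hπ.le
          · refine (norm_inner_le_norm _ _).trans ?_
            rw [map_add]
            exact mul_le_mul_of_nonneg_right ((norm_add_le _ _).trans (add_le_add b1 b2)) hx0
          · exact (norm_inner_le_norm _ _).trans (mul_le_mul_of_nonneg_left b3 hy0)
        · exact (norm_inner_le_norm _ _).trans (mul_le_mul_of_nonneg_left b4 ha)
    _ = Real.pi * κ * (a' * x) + C₁ * (a * x) + Real.pi * κ * (y * b') + κ * (a * b) := by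
        field_simp
    _ ≤ _ := by
        have p1 := mul_nonneg ha hx0
        have p2 := mul_nonneg ha' hx0
        have p3 := mul_nonneg hy0 hb
        have p4 := mul_nonneg hy0 hb'
        have p5 := mul_nonneg ha hb
        have q : 0 ≤ Real.pi * κ := by positivity
        nlinarith [mul_nonneg q p1, mul_nonneg q p3, mul_nonneg q p5, mul_nonneg hC₁ p2,
          mul_nonneg hC₁ p3, mul_nonneg hC₁ p4, mul_nonneg hC₁ p5, mul_nonneg hκ0.le p1,
          mul_nonneg hκ0.le p2, mul_nonneg hκ0.le p3, mul_nonneg hκ0.le p4]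

/-! ### Resolvents of self-adjoint operators -/

section Resolvent

variable {H : Type*} [NormedAddCommGroup H] [InnerProductSpace ℂ H] [CompleteSpace H]
  {T : H →ₗ.[ℂ] H}

theorem inner_apply_of_isSelfAdjoint (hT : IsSelfAdjoint T) (u v : T.domain) :
    inner ℂ (T u) (v : H) = inner ℂ (u : H) (T v) := by
  have h := LinearPMap.adjoint_isFormalAdjoint hT.dense_domain
  rw [LinearPMap.isSelfAdjoint_def.1 hT] at h
  exact h u v

theorem inner_resolventOp_left (hT : IsSelfAdjoint T) {z : ℂ} (hz : z.im ≠ 0) (f g : H) :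
    inner ℂ (resolventOp T z f) g = inner ℂ f (resolventOp T (conj z) g) := by
  have hz' : (conj z).im ≠ 0 := by simpa using hz
  obtain ⟨hu, hf⟩ := (isResolventAt_of_isSelfAdjoint hT hz).1 f
  obtain ⟨hv, hg⟩ := (isResolventAt_of_isSelfAdjoint hT hz').1 g
  have h := inner_apply_of_isSelfAdjoint hT ⟨_, hu⟩ ⟨_, hv⟩
  conv_lhs => rw [← hg]
  conv_rhs => rw [← hf]
  rw [inner_sub_right, inner_sub_left, h, inner_smul_left, inner_smul_right]

theorem resolventOp_sub (hT : IsSelfAdjoint T) {z w : ℂ} (hz : z.im ≠ 0) (hw : w.im ≠ 0) (f : H) :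
    resolventOp T z f - resolventOp T w f
      = (z - w) • resolventOp T z (resolventOp T w f) := by
  obtain ⟨hu, hf⟩ := (isResolventAt_of_isSelfAdjoint hT hw).1 f
  have h := (isResolventAt_of_isSelfAdjoint hT hz).2 ⟨_, hu⟩
  have h2 : T ⟨resolventOp T w f, hu⟩ - z • resolventOp T w f
      = f - (z - w) • resolventOp T w f := by
    conv_rhs => enter [1]; rw [← hf]
    module
  change resolventOp T z (T ⟨resolventOp T w f, hu⟩ - z • resolventOp T w f)
    = resolventOp T w f at h
  rw [h2, map_sub, map_smul, sub_eq_iff_eq_add] at h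
  rw [sub_eq_iff_eq_add, h, add_comm]

theorem im_mul_norm_resolventOp_le (hT : IsSelfAdjoint T) {z : ℂ} (hz : z.im ≠ 0) (f : H) :
    |z.im| * ‖resolventOp T z f‖ ≤ ‖f‖ := by
  obtain ⟨hu, hf⟩ := (isResolventAt_of_isSelfAdjoint hT hz).1 f
  have h := im_mul_norm_le_of_real (inner_im_eq_zero_of_symm
    (inner_apply_of_isSelfAdjoint hT ⟨_, hu⟩ ⟨_, hu⟩)) z
  rwa [hf] at h

theorem norm_resolventOp_le (hT : IsSelfAdjoint T) {z : ℂ} (hz : z.im ≠ 0) (f : H) :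
    ‖resolventOp T z f‖ ≤ |z.im|⁻¹ * ‖f‖ := by
  rw [inv_mul_eq_div, le_div_iff₀ (abs_pos.2 hz), mul_comm]
  exact im_mul_norm_resolventOp_le hT hz f

/-- Insert f = (T - z)u with u the resolvent of f; ⟨u, Tu⟩ is real. This bounds ‖Rf‖ by the square
root of a matrix element and closes the differential inequality. -/
theorem im_mul_norm_sq_resolventOp (hT : IsSelfAdjoint T) {z : ℂ} (hz : z.im ≠ 0) (f : H) :
    z.im * ‖resolventOp T z f‖ ^ 2 = (inner ℂ f (resolventOp T z f)).im := by
  obtain ⟨hu, hf⟩ := (isResolventAt_of_isSelfAdjoint hT hz).1 f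
  have h := inner_im_eq_zero_of_symm
    (inner_apply_of_isSelfAdjoint hT ⟨_, hu⟩ ⟨_, hu⟩)
  have h2 := inner_apply_of_isSelfAdjoint hT ⟨_, hu⟩ ⟨_, hu⟩
  conv_rhs => enter [1, 2]; rw [← hf]
  rw [inner_sub_left, h2, inner_smul_left, inner_self_eq_norm_sq_to_K, Complex.sub_im, h]
  simp [← Complex.ofReal_pow]

theorem im_mul_norm_sq_resolventOp_conj (hT : IsSelfAdjoint T) {z : ℂ} (hz : z.im ≠ 0) (f : H) :
    z.im * ‖resolventOp T (conj z) f‖ ^ 2 = (inner ℂ f (resolventOp T z f)).im := by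
  have hz' : (conj z).im ≠ 0 := by simpa using hz
  have h := im_mul_norm_sq_resolventOp hT hz' f
  rw [← inner_resolventOp_left hT hz, ← inner_conj_symm] at h
  simp only [Complex.conj_im] at h
  linarith

theorem norm_resolventOp_sq_le (hT : IsSelfAdjoint T) {z : ℂ} (hz : 0 < z.im) (f : H) :
    ‖resolventOp T z f‖ ≤ √(‖inner ℂ f (resolventOp T z f)‖ / z.im) := by
  refine Real.le_sqrt_of_sq_le ?_
  rw [le_div_iff₀ hz, mul_comm, im_mul_norm_sq_resolventOp hT hz.ne']
  exact (le_abs_self _).trans (Complex.abs_im_le_norm _)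

theorem norm_resolventOp_conj_sq_le (hT : IsSelfAdjoint T) {z : ℂ} (hz : 0 < z.im) (f : H) :
    ‖resolventOp T (conj z) f‖ ≤ √(‖inner ℂ f (resolventOp T z f)‖ / z.im) := by
  refine Real.le_sqrt_of_sq_le ?_
  rw [le_div_iff₀ hz, mul_comm, im_mul_norm_sq_resolventOp_conj hT hz.ne']
  exact (le_abs_self _).trans (Complex.abs_im_le_norm _)

theorem hasDerivAt_inner_resolventOp (hT : IsSelfAdjoint T) (lam : ℝ) {ε : ℝ} (hε : 0 < ε)
    (f g : H) :
    HasDerivAt (fun ε : ℝ => inner ℂ f (resolventOp T (lam + ε * Complex.I) g))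
      (Complex.I * inner ℂ f (resolventOp T (lam + ε * Complex.I)
        (resolventOp T (lam + ε * Complex.I) g))) ε := by
  have him : ∀ ε : ℝ, ((lam : ℂ) + ε * Complex.I).im = ε := fun ε => by simp
  set G : ℝ → H →L[ℂ] H := fun ε => resolventOp T (lam + ε * Complex.I) with hG
  have hdiff : ∀ x : ℝ, 0 < x → ∀ h : H,
      G x h - G ε h = ((x - ε : ℝ) * Complex.I) • G x (G ε h) := by
    intro x hx h
    rw [hG]
    simp only
    rw [resolventOp_sub hT (by rw [him]; exact hx.ne') (by rw [him]; exact hε.ne')]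
    congr 1
    push_cast
    ring
  have hnorm : ∀ x : ℝ, 0 < x → ∀ h : H, ‖G x h‖ ≤ x⁻¹ * ‖h‖ := by
    intro x hx h
    have := norm_resolventOp_le hT (z := lam + x * Complex.I) (by rw [him]; exact hx.ne') h
    rwa [him, abs_of_pos hx] at this
  have hev : ∀ᶠ x in 𝓝 ε, ε / 2 < x := lt_mem_nhds (by linarith)
  have hlim : Tendsto (fun x => G x (G ε g)) (𝓝 ε) (𝓝 (G ε (G ε g))) := by
    rw [tendsto_iff_norm_sub_tendsto_zero]
    have h0 : Tendsto (fun x : ℝ => |x - ε| * ((ε / 2)⁻¹ * ‖G ε (G ε g)‖)) (𝓝 ε) (𝓝 0) := by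
      have hc : Continuous fun x : ℝ => |x - ε| * ((ε / 2)⁻¹ * ‖G ε (G ε g)‖) := by fun_prop
      simpa using hc.tendsto ε
    refine squeeze_zero' (.of_forall fun _ => norm_nonneg _) ?_ h0
    filter_upwards [hev] with x hx
    have hx0 : 0 < x := by linarith
    rw [hdiff x hx0, norm_smul, norm_mul, Complex.norm_I, mul_one, Complex.norm_real,
      Real.norm_eq_abs]
    refine mul_le_mul_of_nonneg_left ((hnorm x hx0 _).trans ?_) (abs_nonneg _)
    gcongr
  rw [hasDerivAt_iff_tendsto_slope]
  have h1 : Tendsto (fun x => Complex.I * inner ℂ f (G x (G ε g))) (𝓝[≠] ε)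
      (𝓝 (Complex.I * inner ℂ f (G ε (G ε g)))) :=
    ((tendsto_const_nhds.inner hlim).const_mul _).mono_left nhdsWithin_le_nhds
  refine h1.congr' ?_
  filter_upwards [nhdsWithin_le_nhds hev, self_mem_nhdsWithin] with x hx hne
  have hx0 : 0 < x := by linarith
  have hne' : ((x - ε : ℝ) : ℂ) ≠ 0 := by
    rw [Complex.ofReal_ne_zero, sub_ne_zero]; exact hne
  rw [slope_def_module, ← inner_sub_right]
  change _ = (x - ε)⁻¹ • inner ℂ f (G x g - G ε g)
  rw [hdiff x hx0, inner_smul_right, Complex.real_smul, Complex.ofReal_inv]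
  field_simp

end Resolvent

/-! ### Differential inequalities -/

/-- Integrability of x^(-1/2) at zero: the bound does not degenerate as a tends to 0. -/
theorem norm_sub_le_of_deriv_le_sqrt {F F' : ℝ → ℂ} {α β a b : ℝ} (ha : 0 < a) (hab : a ≤ b)
    (hF : ∀ x ∈ Set.Icc a b, HasDerivAt F (F' x) x)
    (hb : ∀ x ∈ Set.Icc a b, ‖F' x‖ ≤ α / √x + β) :
    ‖F b - F a‖ ≤ 2 * α * (√b - √a) + β * (b - a) := by
  have hB : ∀ x ∈ Set.Icc a b, HasDerivAt (fun x => 2 * α * (√x - √a) + β * (x - a))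
      (α / √x + β) x := by
    intro x hx
    have hx0 : 0 < x := ha.trans_le hx.1
    have h1 := (((Real.hasDerivAt_sqrt hx0.ne').sub_const (√a)).const_mul (2 * α)).add
      (((hasDerivAt_id x).sub_const a).const_mul β)
    have h2 := Real.sqrt_pos.2 hx0
    exact h1.congr_deriv (by field_simp)
  exact image_norm_le_of_norm_deriv_right_le_deriv_boundary' (f := fun x => F x - F a)
    (f' := F') (B' := fun x => α / √x + β)
    (fun x hx => ((hF x hx).sub_const (F a)).continuousAt.continuousWithinAt)
    (fun x hx => ((hF x ⟨hx.1, hx.2.le⟩).sub_const (F a)).hasDerivWithinAt)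
    (by simp) (fun x hx => (hB x hx).continuousAt.continuousWithinAt)
    (fun x hx => (hB x ⟨hx.1, hx.2.le⟩).hasDerivWithinAt)
    (fun x hx => hb x ⟨hx.1, hx.2.le⟩) (Set.right_mem_Icc.2 hab)

/-- Tracking N and a separately gives Na in place of a², the interpolation on which the threshold s
> 1/2 depends. -/
theorem norm_le_of_quadratic_deriv_bound {F F' : ℝ → ℂ} {N a C : ℝ} (hN : 0 < N) (hNa : N ≤ a)
    (hC : 0 ≤ C) (hF : ∀ x, 0 < x → HasDerivAt F (F' x) x)
    (h1 : ∀ x, 0 < x → ‖F x‖ ≤ N ^ 2 / x)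
    (h2 : ∀ x, 0 < x → ‖F' x‖ ≤ C * (2 * a * √(‖F x‖ / x) + N ^ 2)) {x : ℝ} (hx : 0 < x) :
    ‖F x‖ ≤ (2 + 2 * C + 16 * C ^ 2) * (N * a) := by
  have ha : 0 < a := hN.trans_le hNa
  -- At this point the trivial bound N²/ε equals Na, and a√ε₀ = √(Na).
  set ε₀ := N / a with hε₀
  have hε : 0 < ε₀ := div_pos hN ha
  have hε1 : ε₀ ≤ 1 := (div_le_one ha).2 hNa
  have hlarge : ∀ y, ε₀ ≤ y → ‖F y‖ ≤ N * a := by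
    intro y hy
    refine (h1 y (hε.trans_le hy)).trans ?_
    rw [div_le_iff₀ (hε.trans_le hy)]
    calc N ^ 2 = N * a * ε₀ := by rw [hε₀]; field_simp
      _ ≤ N * a * y := by gcongr
  have hNa0 : 0 < N * a := mul_pos hN ha
  rcases le_or_gt ε₀ x with hle | hlt
  · exact (hlarge x hle).trans (le_mul_of_one_le_left hNa0.le (by nlinarith [sq_nonneg C]))
  -- At a maximum point y of |F| on [x, ε₀], √|F| can be frozen at its maximal value m in the
  -- derivative bound. Integrating from y to ε₀ with p = √(Na) gives m² ≤ p² + 4Cmp + Cp².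
  obtain ⟨y, hy, hmax⟩ := isCompact_Icc.exists_isMaxOn (Set.nonempty_Icc.2 hlt.le)
    (f := fun y => ‖F y‖) (fun y hy =>
      (hF y (hx.trans_le hy.1)).continuousAt.norm.continuousWithinAt)
  refine (hmax (Set.left_mem_Icc.2 hlt.le)).trans ?_
  change ‖F y‖ ≤ _
  set m := √‖F y‖ with hm
  have hm2 : m ^ 2 = ‖F y‖ := Real.sq_sqrt (norm_nonneg _)
  have hm0 : 0 ≤ m := Real.sqrt_nonneg _
  have hy0 : 0 < y := hx.trans_le hy.1
  have hd := norm_sub_le_of_deriv_le_sqrt (F := F) (F' := F') (α := 2 * C * a * m)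
    (β := C * N ^ 2) hy0 hy.2 (fun t ht => hF t (hy0.trans_le ht.1)) (by
      intro t ht
      have ht0 := hy0.trans_le ht.1
      refine (h2 t ht0).trans ?_
      have h3 : √(‖F t‖ / t) ≤ m / √t := by
        rw [hm, ← Real.sqrt_div (norm_nonneg _)]
        have := hmax (Set.mem_Icc.2 ⟨hy.1.trans ht.1, ht.2⟩)
        change ‖F t‖ ≤ ‖F y‖ at this
        gcongr
      calc C * (2 * a * √(‖F t‖ / t) + N ^ 2) ≤ C * (2 * a * (m / √t) + N ^ 2) := by gcongr
        _ = 2 * C * a * m / √t + C * N ^ 2 := by ring)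
  set p := √(N * a) with hp
  have hp0 : 0 ≤ p := Real.sqrt_nonneg _
  have hp2 : p ^ 2 = N * a := Real.sq_sqrt hNa0.le
  have hap : a * √ε₀ = p := by
    rw [hp, ← Real.sqrt_sq ha.le, ← Real.sqrt_mul (sq_nonneg a), Real.sqrt_sq ha.le, hε₀]
    congr 1
    field_simp
  have h4 : ‖F y‖ ≤ ‖F ε₀‖ + ‖F ε₀ - F y‖ := by
    have := norm_sub_norm_le (F y) (F ε₀)
    rw [norm_sub_rev] at this
    linarith
  have h5 : 2 * (2 * C * a * m) * (√ε₀ - √y) ≤ 4 * C * m * p := by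
    calc 2 * (2 * C * a * m) * (√ε₀ - √y) ≤ 2 * (2 * C * a * m) * √ε₀ := by
          have := Real.sqrt_nonneg y
          gcongr
          linarith
      _ = 4 * C * m * (a * √ε₀) := by ring
      _ = _ := by rw [hap]
  have h6 : C * N ^ 2 * (ε₀ - y) ≤ C * p ^ 2 := by
    rw [hp2]
    calc C * N ^ 2 * (ε₀ - y) ≤ C * N ^ 2 * 1 := by
          gcongr
          linarith
      _ = C * (N * N) := by ring
      _ ≤ C * (N * a) := by gcongr
  have h7 := hlarge ε₀ le_rfl
  rw [← hp2] at h7 ⊢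
  -- Absorb 4Cmp ≤ m²/2 + 8C²p².
  nlinarith [sq_nonneg (m - 4 * C * p)]

/-! ### Resolvent bounds up to the real axis -/

section Mourre

variable {H : Type*} [NormedAddCommGroup H] [InnerProductSpace ℂ H] [CompleteSpace H]
  {T : H →ₗ.[ℂ] H}

/-- The matrix element of the squared resolvent between `f` and `g` is controlled on the half-line
`λ + i(0, ∞)` by the resolvent itself. -/
def SqBound (T : H →ₗ.[ℂ] H) (C lam : ℝ) (f g : H) (N a N' a' : ℝ) : Prop :=
  ∀ ε : ℝ, 0 < ε → ‖inner ℂ f (resolventOp T (lam + ε * Complex.I)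
      (resolventOp T (lam + ε * Complex.I) g))‖
    ≤ C * (a * ‖resolventOp T (lam + ε * Complex.I) g‖
      + ‖resolventOp T (conj (lam + ε * Complex.I)) f‖ * a' + N * N')

theorem SqBound.norm_inner_self_le (hT : IsSelfAdjoint T) {C lam N a : ℝ} {f : H}
    (h : SqBound T C lam f f N a N a) (hC : 0 ≤ C) (hN : 0 < N) (hNa : N ≤ a) (hf : ‖f‖ ≤ N)
    {ε : ℝ} (hε : 0 < ε) :
    ‖inner ℂ f (resolventOp T (lam + ε * Complex.I) f)‖
      ≤ (2 + 2 * C + 16 * C ^ 2) * (N * a) := by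
  have him : ∀ ε : ℝ, ((lam : ℂ) + ε * Complex.I).im = ε := fun ε => by simp
  refine norm_le_of_quadratic_deriv_bound
    (F := fun ε => inner ℂ f (resolventOp T (lam + ε * Complex.I) f)) hN hNa hC
    (fun x hx => hasDerivAt_inner_resolventOp hT lam hx f f) (fun x hx => ?_) (fun x hx => ?_) hε
  · refine (norm_inner_le_norm _ _).trans ?_
    have h1 := norm_resolventOp_le hT (z := lam + x * Complex.I) (by rw [him]; exact hx.ne') f
    rw [him, abs_of_pos hx] at h1
    calc _ ≤ N * (x⁻¹ * N) := by
          refine mul_le_mul hf (h1.trans ?_) (norm_nonneg _) hN.le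
          gcongr
      _ = N ^ 2 / x := by ring
  · rw [norm_mul, Complex.norm_I, one_mul]
    refine (h x hx).trans ?_
    have hx' : 0 < ((lam : ℂ) + x * Complex.I).im := by rw [him]; exact hx
    have h1 := norm_resolventOp_sq_le hT hx' f
    have h2 := norm_resolventOp_conj_sq_le hT hx' f
    rw [him] at h1 h2
    have ha : 0 ≤ a := hN.le.trans hNa
    refine mul_le_mul_of_nonneg_left ?_ hC
    calc _ ≤ a * √(‖inner ℂ f (resolventOp T (lam + x * Complex.I) f)‖ / x)
          + √(‖inner ℂ f (resolventOp T (lam + x * Complex.I) f)‖ / x) * a + N * N := by gcongr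
      _ = _ := by ring

/-- The diagonal bound is inserted in ε‖Rf‖² ≤ |⟨f, Rf⟩|; the constant comes from 2 + 2C + 16C² ≤ (2
+ 4C)². -/
theorem norm_resolventOp_le_of_sqBound (hT : IsSelfAdjoint T) {C lam N a : ℝ} {f : H}
    (h : SqBound T C lam f f N a N a) (hC : 0 ≤ C) (hN : 0 < N) (hNa : N ≤ a) (hf : ‖f‖ ≤ N)
    {ε : ℝ} (hε : 0 < ε) :
    ‖resolventOp T (lam + ε * Complex.I) f‖ ≤ (2 + 4 * C) * √(N * a) / √ε ∧
    ‖resolventOp T (conj (lam + ε * Complex.I)) f‖ ≤ (2 + 4 * C) * √(N * a) / √ε := by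
  have him : ((lam : ℂ) + ε * Complex.I).im = ε := by simp
  have hε' : 0 < ((lam : ℂ) + ε * Complex.I).im := by rw [him]; exact hε
  have h0 := h.norm_inner_self_le hT hC hN hNa hf hε
  have h1 := norm_resolventOp_sq_le hT hε' f
  have h2 := norm_resolventOp_conj_sq_le hT hε' f
  rw [him] at h1 h2
  have h3 : √(‖inner ℂ f (resolventOp T (lam + ε * Complex.I) f)‖ / ε)
      ≤ (2 + 4 * C) * √(N * a) / √ε := by
    rw [Real.sqrt_div (norm_nonneg _)]
    gcongr
    have hp : 0 ≤ N * a := mul_nonneg hN.le (hN.le.trans hNa)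
    rw [Real.sqrt_le_left (by positivity), mul_pow, Real.sq_sqrt hp]
    refine h0.trans (mul_le_mul_of_nonneg_right ?_ hp)
    nlinarith
  exact ⟨h1.trans h3, h2.trans h3⟩

theorem norm_deriv_le_of_sqBound (hT : IsSelfAdjoint T) {C lam N a N' a' : ℝ} {f g : H}
    (h : SqBound T C lam f g N a N' a') (hff : SqBound T C lam f f N a N a)
    (hgg : SqBound T C lam g g N' a' N' a')
    (hC : 0 ≤ C) (hN : 0 < N) (hNa : N ≤ a) (hf : ‖f‖ ≤ N)
    (hN' : 0 < N') (hNa' : N' ≤ a') (hg : ‖g‖ ≤ N') {ε : ℝ} (hε : 0 < ε) :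
    ‖Complex.I * inner ℂ f (resolventOp T (lam + ε * Complex.I)
        (resolventOp T (lam + ε * Complex.I) g))‖
      ≤ C * (2 + 4 * C) * (a * √(N' * a') + a' * √(N * a)) / √ε + C * (N * N') := by
  rw [norm_mul, Complex.norm_I, one_mul]
  refine (h ε hε).trans ?_
  have h1 := (norm_resolventOp_le_of_sqBound hT hgg hC hN' hNa' hg hε).1
  have h2 := (norm_resolventOp_le_of_sqBound hT hff hC hN hNa hf hε).2
  have ha := hN.le.trans hNa
  have ha' := hN'.le.trans hNa'
  calc _ ≤ C * (a * ((2 + 4 * C) * √(N' * a') / √ε)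
          + (2 + 4 * C) * √(N * a) / √ε * a' + N * N') := by
        gcongr
    _ = _ := by ring

/-- Once the diagonal bounds are known, ‖Rf‖ and ‖Rg‖ are of order ε^(-1/2), so the derivative of
the mixed element is integrable and no quadratic argument is needed. -/
theorem norm_inner_resolventOp_le_of_sqBound (hT : IsSelfAdjoint T) {C lam N a N' a' : ℝ} {f g : H}
    (h : SqBound T C lam f g N a N' a') (hff : SqBound T C lam f f N a N a)
    (hgg : SqBound T C lam g g N' a' N' a')
    (hC : 0 ≤ C) (hN : 0 < N) (hNa : N ≤ a) (hf : ‖f‖ ≤ N)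
    (hN' : 0 < N') (hNa' : N' ≤ a') (hg : ‖g‖ ≤ N') {ε : ℝ} (hε : 0 < ε) :
    ‖inner ℂ f (resolventOp T (lam + ε * Complex.I) g)‖
      ≤ (1 + 5 * C) * (2 + 4 * C) * (√(N * a) * √(N' * a')) := by
  have ha : 0 < a := hN.trans_le hNa
  have ha' : 0 < a' := hN'.trans_le hNa'
  set p := √(N * a) with hp
  set p' := √(N' * a') with hp'
  have hp0 : 0 ≤ p := Real.sqrt_nonneg _
  have hp0' : 0 ≤ p' := Real.sqrt_nonneg _
  have hsq : ∀ {N a : ℝ}, 0 < N → 0 < a → a * √(N / a) = √(N * a) := by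
    intro N a hN ha
    conv_rhs => rw [show N * a = a ^ 2 * (N / a) by field_simp, Real.sqrt_mul (sq_nonneg a),
      Real.sqrt_sq ha.le]
  have hsq' : ∀ {N a x : ℝ}, 0 < N → 0 < a → N / a ≤ x → N ≤ √(N * a) * √x := by
    intro N a x hN ha hx
    rw [← Real.sqrt_mul (by positivity)]
    refine Real.le_sqrt_of_sq_le ?_
    rw [div_le_iff₀ ha] at hx
    calc N ^ 2 = N * N := by ring
      _ ≤ N * (x * a) := by gcongr
      _ = _ := by ring
  set ε₀ := min (N / a) (N' / a') with hε₀
  have hε0 : 0 < ε₀ := lt_min (div_pos hN ha) (div_pos hN' ha')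
  have hlarge : ∀ x, ε₀ ≤ x →
      ‖inner ℂ f (resolventOp T (lam + x * Complex.I) g)‖ ≤ (2 + 4 * C) * (p * p') := by
    intro x hx
    have hx0 := hε0.trans_le hx
    have hs := Real.sqrt_pos.2 hx0
    -- The vector whose threshold has been passed is estimated by its norm, N ≤ √(Na)√x, and the
    -- resolvent is applied to the other vector.
    rcases min_le_iff.1 hx with hx' | hx'
    · have h1 := (norm_resolventOp_le_of_sqBound hT hgg hC hN' hNa' hg hx0).1
      refine (norm_inner_le_norm _ _).trans ?_
      calc _ ≤ (p * √x) * ((2 + 4 * C) * p' / √x) :=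
            mul_le_mul (hf.trans (hsq' hN ha hx')) h1 (norm_nonneg _) (by positivity)
        _ = _ := by field_simp
    · have h1 := (norm_resolventOp_le_of_sqBound hT hff hC hN hNa hf hx0).2
      have him : ((lam : ℂ) + x * Complex.I).im = x := by simp
      have hcc : ((conj ((lam : ℂ) + x * Complex.I)).im) ≠ 0 := by
        rw [Complex.conj_im, him]; exact neg_ne_zero.2 hx0.ne'
      have h2 := inner_resolventOp_left hT hcc f g
      rw [Complex.conj_conj] at h2
      rw [← h2]
      refine (norm_inner_le_norm _ _).trans ?_
      calc _ ≤ ((2 + 4 * C) * p / √x) * (p' * √x) :=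
            mul_le_mul h1 (hg.trans (hsq' hN' ha' hx')) (norm_nonneg _) (by positivity)
        _ = _ := by field_simp
  have hpp : 0 ≤ (2 + 4 * C) * (p * p') := by positivity
  rcases le_or_gt ε₀ ε with hle | hlt
  · refine (hlarge ε hle).trans ?_
    nlinarith
  have hd := norm_sub_le_of_deriv_le_sqrt
    (F := fun ε : ℝ => inner ℂ f (resolventOp T (lam + ε * Complex.I) g)) hε hlt.le
    (fun t ht => hasDerivAt_inner_resolventOp hT lam (hε.trans_le ht.1) f g)
    (fun t ht => norm_deriv_le_of_sqBound hT h hff hgg hC hN hNa hf hN' hNa' hg (hε.trans_le ht.1))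
  have h1 : a * √ε₀ ≤ p := by
    rw [hp, ← hsq hN ha]
    have := min_le_left (N / a) (N' / a')
    gcongr
  have h2 : a' * √ε₀ ≤ p' := by
    rw [hp', ← hsq hN' ha']
    have := min_le_right (N / a) (N' / a')
    gcongr
  have h3 : N ≤ p := Real.le_sqrt_of_sq_le (by nlinarith)
  have h4 : N' ≤ p' := Real.le_sqrt_of_sq_le (by nlinarith)
  have h5 : ε₀ ≤ 1 := (min_le_left _ _).trans ((div_le_one ha).2 hNa)
  have h6 := hlarge ε₀ le_rfl
  have h7 := norm_sub_norm_le (inner ℂ f (resolventOp T (lam + ε * Complex.I) g))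
    (inner ℂ f (resolventOp T (lam + ε₀ * Complex.I) g))
  rw [norm_sub_rev] at h7
  have h8 : 2 * (C * (2 + 4 * C) * (a * p' + a' * p)) * (√ε₀ - √ε)
      ≤ 4 * C * ((2 + 4 * C) * (p * p')) := by
    calc _ ≤ 2 * (C * (2 + 4 * C) * (a * p' + a' * p)) * √ε₀ := by
          have := Real.sqrt_nonneg ε
          gcongr
          linarith
      _ = 2 * (C * (2 + 4 * C)) * ((a * √ε₀) * p' + (a' * √ε₀) * p) := by ring
      _ ≤ 2 * (C * (2 + 4 * C)) * (p * p' + p' * p) := by gcongr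
      _ = _ := by ring
  have h9 : C * (N * N') * (ε₀ - ε) ≤ C * ((2 + 4 * C) * (p * p')) := by
    calc _ ≤ C * (N * N') * 1 := by
          gcongr
          linarith
      _ ≤ C * (p * p') := by rw [mul_one]; gcongr
      _ ≤ _ := by
          exact mul_le_mul_of_nonneg_left
            (le_mul_of_one_le_left (by positivity) (by linarith)) hC
  nlinarith

/-- Hölder continuity of order 1/2, used for the existence of the limit; only finitely many dyadic
pieces are involved there, so the crude factor aa' suffices. -/
theorem norm_inner_resolventOp_sub_le_of_sqBound (hT : IsSelfAdjoint T) {C lam N a N' a' : ℝ}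
    {f g : H} (h : SqBound T C lam f g N a N' a') (hff : SqBound T C lam f f N a N a)
    (hgg : SqBound T C lam g g N' a' N' a')
    (hC : 0 ≤ C) (hN : 0 < N) (hNa : N ≤ a) (hf : ‖f‖ ≤ N)
    (hN' : 0 < N') (hNa' : N' ≤ a') (hg : ‖g‖ ≤ N') {ε ε' : ℝ} (hε : 0 < ε) (hle : ε ≤ ε')
    (h1 : ε' ≤ 1) :
    ‖inner ℂ f (resolventOp T (lam + ε' * Complex.I) g)
        - inner ℂ f (resolventOp T (lam + ε * Complex.I) g)‖
      ≤ C * (10 + 16 * C) * (a * a') * (√ε' - √ε) := by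
  have ha : 0 < a := hN.trans_le hNa
  have ha' : 0 < a' := hN'.trans_le hNa'
  have hp : √(N * a) ≤ a := by rw [Real.sqrt_le_left ha.le]; nlinarith
  have hp' : √(N' * a') ≤ a' := by rw [Real.sqrt_le_left ha'.le]; nlinarith
  have hd := norm_sub_le_of_deriv_le_sqrt
    (F := fun ε : ℝ => inner ℂ f (resolventOp T (lam + ε * Complex.I) g))
    (α := C * (5 + 8 * C) * (a * a')) (β := 0) hε hle
    (fun t ht => hasDerivAt_inner_resolventOp hT lam (hε.trans_le ht.1) f g)
    (fun t ht => by
      have ht0 := hε.trans_le ht.1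
      have hs := Real.sqrt_pos.2 ht0
      have hs1 : √t ≤ 1 := Real.sqrt_le_one.2 (ht.2.trans h1)
      refine (norm_deriv_le_of_sqBound hT h hff hgg hC hN hNa hf hN' hNa' hg ht0).trans ?_
      rw [add_zero]
      calc _ ≤ C * (2 + 4 * C) * (a * a' + a' * a) / √t + C * (a * a') / √t := by
            have : C * (N * N') ≤ C * (a * a') / √t := by
              rw [le_div_iff₀ hs]
              calc C * (N * N') * √t ≤ C * (a * a') * 1 := by gcongr
                _ = _ := mul_one _
            gcongr
        _ = _ := by ring)
  refine hd.trans (le_of_eq ?_)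
  ring

end Mourre

/-! ### The commutator estimate on the domain of `A` -/

theorem isSelfAdjoint_opP (k d : ℕ) : IsSelfAdjoint (opP k d) :=
  (isEssentiallySelfAdjoint_opP₀ k d).2.2

theorem isSelfAdjoint_opA (k d : ℕ) : IsSelfAdjoint (opA k d) :=
  (isEssentiallySelfAdjoint_opA₀ k d).2.2

theorem graph_opP (k d : ℕ) :
    (opP k d).graph = (onTest (schwartzP k d)).graph.topologicalClosure :=
  (isEssentiallySelfAdjoint_opP₀ k d).2.1.graph_closure_eq_closure_graph.symm

theorem graph_opA (k d : ℕ) :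
    (opA k d).graph = (onTest (schwartzA k d)).graph.topologicalClosure :=
  (isEssentiallySelfAdjoint_opA₀ k d).2.1.graph_closure_eq_closure_graph.symm

theorem resolventOp_opP_toL2 (k d : ℕ) {z : ℂ} (hz : z.im ≠ 0) (u : 𝓢(E d, ℂ)) :
    resolventOp (opP k d) z (toL2 d u) = toL2 d (fmul (symR k z) u) := by
  have h := mem_closure_graph_onTest (schwartzP k d) (fmul (symR k z) u)
  rw [← graph_opP] at h
  obtain ⟨x, hx1, hx2⟩ := (LinearPMap.mem_graph_iff _).1 h
  have h1 := (isResolventAt_of_isSelfAdjoint (isSelfAdjoint_opP k d) hz).2 x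
  rw [hx1, hx2, ← map_smul, ← map_sub, schwartzP_fmul_symR k d hz] at h1
  exact h1

/-- At fixed ε the resolvents are bounded, so both sides of `exists_bound_symR_sq` are continuous in
the graph norm of `A` and the estimate passes from Schwartz functions to the closure. -/
theorem exists_sqBound_opP (k d : ℕ) {δ L : ℝ} (hδ : 0 < δ) (hL : 0 ≤ L) :
    ∃ C : ℝ, 0 ≤ C ∧ ∀ lam : ℝ, δ ≤ |lam| → |lam| ≤ L → ∀ f f' g g' : L2 d,
      (f, f') ∈ (opA k d).graph → (g, g') ∈ (opA k d).graph → ∀ N a N' a' : ℝ,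
      ‖f‖ ≤ N → ‖f‖ + ‖f'‖ ≤ a → ‖g‖ ≤ N' → ‖g‖ + ‖g'‖ ≤ a' →
      SqBound (opP k d) C lam f g N a N' a' := by
  obtain ⟨C, hC, h⟩ := exists_bound_symR_sq k d hδ hL
  refine ⟨C, hC, fun lam hl hlL f f' g g' hf hg N a N' a' hN ha hN' ha' ε hε => ?_⟩
  set z : ℂ := lam + ε * Complex.I with hz
  have hre : z.re = lam := by simp [hz]
  have him : z.im ≠ 0 := by simp [hz, hε.ne']
  have him' : (conj z).im ≠ 0 := by simpa using him
  rw [graph_opA] at hf hg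
  obtain ⟨u, hu, hu'⟩ := exists_seq_of_mem_closure_graph hf
  obtain ⟨v, hv, hv'⟩ := exists_seq_of_mem_closure_graph hg
  set G := resolventOp (opP k d) z
  set G' := resolventOp (opP k d) (conj z)
  have h1 : ∀ n, ‖inner ℂ (toL2 d (u n)) (G (G (toL2 d (v n))))‖
      ≤ C * ((‖toL2 d (u n)‖ + ‖toL2 d (schwartzA k d (u n))‖) * ‖G (toL2 d (v n))‖
        + ‖G' (toL2 d (u n))‖ * (‖toL2 d (v n)‖ + ‖toL2 d (schwartzA k d (v n))‖)
        + ‖toL2 d (u n)‖ * ‖toL2 d (v n)‖) := by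
    intro n
    have h2 := h z (by rwa [hre]) (by rwa [hre]) him (u n) (v n)
    rwa [← resolventOp_opP_toL2 k d him, ← resolventOp_opP_toL2 k d him,
      ← resolventOp_opP_toL2 k d him'] at h2
  have hGv := (G.continuous.tendsto g).comp hv
  have hlim := le_of_tendsto_of_tendsto' (hu.inner ((G.continuous.tendsto _).comp hGv)).norm
    ((((hu.norm.add hu'.norm).mul hGv.norm).add
      (((G'.continuous.tendsto f).comp hu).norm.mul (hv.norm.add hv'.norm))).add
        (hu.norm.mul hv.norm) |>.const_mul C) h1
  refine hlim.trans ?_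
  have hN0 : 0 ≤ N := (norm_nonneg _).trans hN
  gcongr

/-! ### Limiting absorption for weights with a dyadic decomposition -/

section Dyadic

variable {H : Type*} [NormedAddCommGroup H] [InnerProductSpace ℂ H]

theorem opNorm_le_of_norm_inner_le {S : H →L[ℂ] H} {c : ℝ} (hc : 0 ≤ c)
    (h : ∀ u v : H, ‖u‖ ≤ 1 → ‖v‖ ≤ 1 → ‖inner ℂ u (S v)‖ ≤ c) : ‖S‖ ≤ c := by
  refine ContinuousLinearMap.opNorm_le_of_unit_norm hc fun v hv => ?_
  rcases eq_or_ne (S v) 0 with h0 | h0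
  · rw [h0, norm_zero]; exact hc
  have h1 := h (((‖S v‖⁻¹ : ℝ) : ℂ) • S v) v (by
    rw [norm_smul, Complex.norm_real, norm_inv, norm_norm,
      inv_mul_cancel₀ (norm_ne_zero_iff.2 h0)]) hv.le
  rw [inner_smul_left, inner_self_eq_norm_sq_to_K, norm_mul, Complex.norm_conj,
    Complex.norm_real, norm_inv, norm_norm, norm_pow] at h1
  have h2 : ‖((‖S v‖ : ℝ) : ℂ)‖ = ‖S v‖ := by rw [Complex.norm_real, norm_norm]
  change ‖S v‖⁻¹ * ‖((‖S v‖ : ℝ) : ℂ)‖ ^ 2 ≤ c at h1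
  rw [h2, sq, inv_mul_cancel_left₀ (norm_ne_zero_iff.2 h0)] at h1
  exact h1

/-- `W` is the sum of a series of self-adjoint operators `w n` with range in the domain of `A`,
such that `‖w n‖` and `‖A (w n)‖` have a geometrically decaying product. -/
def HasDyadicDecomposition (A : H →ₗ.[ℂ] H) (W : H →L[ℂ] H) : Prop :=
  ∃ (w : ℕ → H →L[ℂ] H) (N a : ℕ → ℝ) (K ρ : ℝ), 0 ≤ ρ ∧ ρ < 1 ∧ 0 ≤ K ∧
    (∀ n, 0 < N n ∧ N n ≤ a n ∧ √(N n * a n) ≤ K * ρ ^ n) ∧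
    (∀ n u v, inner ℂ (w n u) v = inner ℂ u (w n v)) ∧
    (∀ n u, ‖u‖ ≤ 1 → ‖w n u‖ ≤ N n ∧
      ∃ f, (w n u, f) ∈ A.graph ∧ ‖w n u‖ + ‖f‖ ≤ a n) ∧
    Tendsto (fun n => ∑ i ∈ Finset.range n, w i) atTop (𝓝 W)

theorem HasDyadicDecomposition.inner_left {A : H →ₗ.[ℂ] H} {W : H →L[ℂ] H}
    (h : HasDyadicDecomposition A W) (u v : H) : inner ℂ (W u) v = inner ℂ u (W v) := by
  obtain ⟨w, N, a, K, ρ, -, -, -, -, hs, -, hW⟩ := h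
  have h1 : ∀ u : H, Tendsto (fun n => (∑ i ∈ Finset.range n, w i) u) atTop (𝓝 (W u)) := fun u =>
    ((ContinuousLinearMap.apply ℂ H u).continuous.tendsto W).comp hW
  refine tendsto_nhds_unique ((h1 u).inner tendsto_const_nhds)
    ((tendsto_const_nhds.inner (h1 v)).congr fun n => ?_)
  rw [sum_apply, sum_apply, sum_inner, inner_sum]
  exact Finset.sum_congr rfl fun i _ => (hs i u v).symm

/-- Enlarging the truncation by one adds one row and one column of the array w_i B w_j, each summing
to at most Cρⁿ/(1-ρ). -/
theorem norm_sub_partial_sum_le {w : ℕ → H →L[ℂ] H} {W B : H →L[ℂ] H} {C ρ : ℝ} (hρ : 0 ≤ ρ)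
    (hρ1 : ρ < 1) (hC : 0 ≤ C) (hW : Tendsto (fun n => ∑ i ∈ Finset.range n, w i) atTop (𝓝 W))
    (hB : ∀ n m, ‖w n ∘L B ∘L w m‖ ≤ C * ρ ^ n * ρ ^ m) (n : ℕ) :
    ‖W ∘L B ∘L W - (∑ i ∈ Finset.range n, w i) ∘L B ∘L (∑ i ∈ Finset.range n, w i)‖
      ≤ 2 * C / (1 - ρ) * ρ ^ n / (1 - ρ) := by
  set V : ℕ → H →L[ℂ] H := fun n => ∑ i ∈ Finset.range n, w i with hV
  have hgeo : ∀ n, ∑ i ∈ Finset.range n, ρ ^ i ≤ (1 - ρ)⁻¹ := fun n =>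
    (summable_geometric_of_lt_one hρ hρ1).sum_le_tsum _ (fun i _ => pow_nonneg hρ i) |>.trans_eq
      (tsum_geometric_of_lt_one hρ hρ1)
  have h1 : ∀ n m, ‖w n ∘L B ∘L V m‖ ≤ C * ρ ^ n * (1 - ρ)⁻¹ := by
    intro n m
    have e : w n ∘L B ∘L V m = ∑ i ∈ Finset.range m, w n ∘L B ∘L w i := by
      ext u
      simp [hV]
    rw [e]
    refine (norm_sum_le _ _).trans ((Finset.sum_le_sum fun i _ => hB n i).trans ?_)
    rw [← Finset.mul_sum]
    exact mul_le_mul_of_nonneg_left (hgeo m) (by positivity)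
  have h2 : ∀ n m, ‖V m ∘L B ∘L w n‖ ≤ C * ρ ^ n * (1 - ρ)⁻¹ := by
    intro n m
    have e : V m ∘L B ∘L w n = ∑ i ∈ Finset.range m, w i ∘L B ∘L w n := by
      ext u
      simp [hV]
    rw [e]
    refine (norm_sum_le _ _).trans ((Finset.sum_le_sum fun i _ => hB i n).trans ?_)
    rw [← Finset.sum_mul, ← Finset.mul_sum, mul_right_comm]
    exact mul_le_mul_of_nonneg_left (hgeo m) (by positivity)
  have h3 : ∀ n, dist (V n ∘L B ∘L V n) (V (n + 1) ∘L B ∘L V (n + 1))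
      ≤ 2 * C / (1 - ρ) * ρ ^ n := by
    intro n
    have e : V (n + 1) ∘L B ∘L V (n + 1) - V n ∘L B ∘L V n
        = w n ∘L B ∘L V (n + 1) + V n ∘L B ∘L w n := by
      have e1 : V (n + 1) = V n + w n := Finset.sum_range_succ _ _
      rw [e1]
      ext u
      simp
      abel
    rw [dist_comm, dist_eq_norm, e]
    refine (norm_add_le _ _).trans ((add_le_add (h1 n _) (h2 n n)).trans_eq ?_)
    ring
  have hlim : Tendsto (fun n => V n ∘L B ∘L V n) atTop (𝓝 (W ∘L B ∘L W)) :=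
    hW.mul (tendsto_const_nhds.mul hW)
  have := dist_le_of_le_geometric_of_tendsto ρ _ hρ1 h3 hlim n
  rwa [dist_comm, dist_eq_norm] at this

/-! ### Limiting absorption for decomposable weights -/

variable [CompleteSpace H] {T A : H →ₗ.[ℂ] H} {W : H →L[ℂ] H} {S : Set ℝ} {C : ℝ}

/-- The truncation error is geometric, uniformly in λ and ε, and each truncated sum is Hölder
continuous in ε down to zero. Together these give the uniform Cauchy property. -/
theorem limiting_absorption_upper (hT : IsSelfAdjoint T) (hC : 0 ≤ C)
    (hS : ∀ lam ∈ S, ∀ f f' g g' : H, (f, f') ∈ A.graph → (g, g') ∈ A.graph →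
      ∀ N a N' a' : ℝ, ‖f‖ ≤ N → ‖f‖ + ‖f'‖ ≤ a → ‖g‖ ≤ N' → ‖g‖ + ‖g'‖ ≤ a' →
      SqBound T C lam f g N a N' a')
    (hW : HasDyadicDecomposition A W) :
    (∃ M : ℝ, ∀ lam ∈ S, ∀ ε : ℝ, 0 < ε →
      ‖W ∘L resolventOp T (lam + ε * Complex.I) ∘L W‖ ≤ M) ∧
    ∃ G : ℝ → H →L[ℂ] H, TendstoUniformlyOn
      (fun (ε : ℝ) (lam : ℝ) => W ∘L resolventOp T (lam + ε * Complex.I) ∘L W) G (𝓝[>] 0) S := by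
  obtain ⟨w, N, a, K, ρ, hρ, hρ1, hK, hNa, hs, hw, hlim⟩ := hW
  set G : ℝ → ℝ → H →L[ℂ] H := fun ε lam => resolventOp T (lam + ε * Complex.I) with hG
  set c : ℝ := (1 + 5 * C) * (2 + 4 * C) * K ^ 2 with hc
  have hc0 : 0 ≤ c := by positivity
  have ha0 : ∀ n, 0 ≤ a n := fun n => (hNa n).1.le.trans (hNa n).2.1
  have hB : ∀ lam ∈ S, ∀ ε : ℝ, 0 < ε → ∀ n m, ‖w n ∘L G ε lam ∘L w m‖ ≤ c * ρ ^ n * ρ ^ m := by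
    intro lam hlam ε hε n m
    refine opNorm_le_of_norm_inner_le (by positivity) fun u v hu hv => ?_
    obtain ⟨hNu, f, hf, hfa⟩ := hw n u hu
    obtain ⟨hNv, g, hg, hga⟩ := hw m v hv
    have h1 := norm_inner_resolventOp_le_of_sqBound hT
      (hS lam hlam _ f _ g hf hg _ _ _ _ hNu hfa hNv hga)
      (hS lam hlam _ f _ f hf hf _ _ _ _ hNu hfa hNu hfa)
      (hS lam hlam _ g _ g hg hg _ _ _ _ hNv hga hNv hga) hC (hNa n).1 (hNa n).2.1 hNu
      (hNa m).1 (hNa m).2.1 hNv hε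
    rw [ContinuousLinearMap.comp_apply, ← hs]
    refine h1.trans ?_
    calc _ ≤ (1 + 5 * C) * (2 + 4 * C) * ((K * ρ ^ n) * (K * ρ ^ m)) := by
          have := (hNa n).2.2
          have := (hNa m).2.2
          gcongr
      _ = _ := by rw [hc]; ring
  have hsub := fun lam hlam ε hε n => norm_sub_partial_sum_le hρ hρ1 hc0 hlim
    (hB lam hlam ε hε) n
  -- With n = 0 the partial sum is empty, so the truncation estimate itself is the uniform bound.
  refine ⟨⟨_, fun lam hlam ε hε => by simpa using hsub lam hlam ε hε 0⟩, ?_⟩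
  set V : ℕ → H →L[ℂ] H := fun n => ∑ i ∈ Finset.range n, w i with hV
  have hD : ∀ n, ∃ D : ℝ, 0 ≤ D ∧ ∀ lam ∈ S, ∀ ε ε' : ℝ, 0 < ε → ε ≤ ε' → ε' ≤ 1 →
      ‖V n ∘L G ε' lam ∘L V n - V n ∘L G ε lam ∘L V n‖ ≤ D * √ε' := by
    intro n
    refine ⟨∑ i ∈ Finset.range n, ∑ j ∈ Finset.range n, C * (10 + 16 * C) * (a i * a j),
      Finset.sum_nonneg fun i _ => Finset.sum_nonneg fun j _ => by
        have := ha0 i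
        have := ha0 j
        positivity, fun lam hlam ε ε' hε hle h1 => ?_⟩
    have e : V n ∘L G ε' lam ∘L V n - V n ∘L G ε lam ∘L V n
        = ∑ i ∈ Finset.range n, ∑ j ∈ Finset.range n,
          w i ∘L (G ε' lam - G ε lam) ∘L w j := by
      ext u
      simp only [hV, sum_apply, ContinuousLinearMap.comp_apply, sub_apply,
        map_sum, map_sub, Finset.sum_sub_distrib]
      congr 1 <;> exact Finset.sum_comm
    rw [e, Finset.sum_mul]
    refine (norm_sum_le _ _).trans (Finset.sum_le_sum fun i _ => ?_)
    rw [Finset.sum_mul]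
    refine (norm_sum_le _ _).trans (Finset.sum_le_sum fun j _ => ?_)
    have hai := ha0 i
    have haj := ha0 j
    refine opNorm_le_of_norm_inner_le (by positivity) fun u v hu hv => ?_
    obtain ⟨hNu, f, hf, hfa⟩ := hw i u hu
    obtain ⟨hNv, g, hg, hga⟩ := hw j v hv
    have h1 := norm_inner_resolventOp_sub_le_of_sqBound hT
      (hS lam hlam _ f _ g hf hg _ _ _ _ hNu hfa hNv hga)
      (hS lam hlam _ f _ f hf hf _ _ _ _ hNu hfa hNu hfa)
      (hS lam hlam _ g _ g hg hg _ _ _ _ hNv hga hNv hga) hC (hNa i).1 (hNa i).2.1 hNu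
      (hNa j).1 (hNa j).2.1 hNv hε hle h1
    rw [ContinuousLinearMap.comp_apply, ← hs, ContinuousLinearMap.comp_apply, sub_apply,
      inner_sub_right]
    refine h1.trans (mul_le_mul_of_nonneg_left ?_ (by positivity))
    linarith [Real.sqrt_nonneg ε]
  have hcauchy : UniformCauchySeqOn (fun (ε : ℝ) (lam : ℝ) => W ∘L G ε lam ∘L W) (𝓝[>] 0) S := by
    intro U hU
    obtain ⟨η, hη, hηU⟩ := Metric.mem_uniformity_dist.1 hU
    have htail : Tendsto (fun n => 2 * c / (1 - ρ) * ρ ^ n / (1 - ρ)) atTop (𝓝 0) := by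
      simpa using ((tendsto_pow_atTop_nhds_zero_of_lt_one hρ hρ1).const_mul
        (2 * c / (1 - ρ))).div_const (1 - ρ)
    obtain ⟨n, hn⟩ := (htail.eventually_lt_const (show (0 : ℝ) < η / 4 by positivity)).exists
    obtain ⟨D, hD0, hD⟩ := hD n
    have hsqrt : Tendsto (fun ε : ℝ => D * √ε) (𝓝[>] 0) (𝓝 0) := by
      have h : Continuous fun ε : ℝ => D * √ε := by fun_prop
      simpa using (h.tendsto 0).mono_left nhdsWithin_le_nhds
    have hev : ∀ᶠ ε : ℝ in 𝓝[>] 0, 0 < ε ∧ ε ≤ 1 ∧ D * √ε < η / 4 := by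
      filter_upwards [self_mem_nhdsWithin, nhdsWithin_le_nhds (Iic_mem_nhds one_pos),
        hsqrt.eventually_lt_const (show (0 : ℝ) < η / 4 by positivity)] with ε h1 h2 h3
      exact ⟨h1, h2, h3⟩
    have hmain : ∀ lam ∈ S, ∀ ε ε' : ℝ, 0 < ε → ε ≤ ε' → ε' ≤ 1 → D * √ε' < η / 4 →
        dist (W ∘L G ε lam ∘L W) (W ∘L G ε' lam ∘L W) < η := by
      intro lam hlam ε ε' hε hle h1 hDε
      have hε' := hε.trans_le hle
      have e1 := hsub lam hlam ε hε n
      have e2 := hsub lam hlam ε' hε' n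
      have e3 := hD lam hlam ε ε' hε hle h1
      rw [← dist_eq_norm] at e1 e2 e3
      have t1 := dist_triangle4 (W ∘L G ε lam ∘L W) (V n ∘L G ε lam ∘L V n)
        (V n ∘L G ε' lam ∘L V n) (W ∘L G ε' lam ∘L W)
      rw [dist_comm (V n ∘L G ε lam ∘L V n), dist_comm (V n ∘L G ε' lam ∘L V n)
        (W ∘L G ε' lam ∘L W)] at t1
      linarith
    filter_upwards [hev.prod_mk hev] with p hp lam hlam
    obtain ⟨⟨h1, h2, h3⟩, h4, h5, h6⟩ := hp
    refine hηU ?_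
    rcases le_total p.1 p.2 with h | h
    · exact hmain lam hlam _ _ h1 h h5 h6
    · rw [dist_comm]
      exact hmain lam hlam _ _ h4 h h2 h3
  have hex : ∀ lam, ∃ B : H →L[ℂ] H, lam ∈ S →
      Tendsto (fun ε => W ∘L G ε lam ∘L W) (𝓝[>] 0) (𝓝 B) := by
    intro lam
    by_cases hlam : lam ∈ S
    · obtain ⟨B, hB⟩ := cauchy_iff_exists_le_nhds.1 (hcauchy.cauchy_map hlam)
      exact ⟨B, fun _ => hB⟩
    · exact ⟨0, fun h => absurd h hlam⟩
  choose B hB' using hex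
  exact ⟨B, hcauchy.tendstoUniformlyOn_of_tendsto fun lam hlam => hB' lam hlam⟩

theorem adjoint_resolventOp (hT : IsSelfAdjoint T) {z : ℂ} (hz : z.im ≠ 0) :
    ContinuousLinearMap.adjoint (resolventOp T z) = resolventOp T (conj z) := by
  have hz' : (conj z).im ≠ 0 := by simpa using hz
  refine ((ContinuousLinearMap.eq_adjoint_iff _ _).2 fun x y => ?_).symm
  rw [inner_resolventOp_left hT hz', Complex.conj_conj]

theorem limiting_absorption (hT : IsSelfAdjoint T) (hC : 0 ≤ C)
    (hS : ∀ lam ∈ S, ∀ f f' g g' : H, (f, f') ∈ A.graph → (g, g') ∈ A.graph →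
      ∀ N a N' a' : ℝ, ‖f‖ ≤ N → ‖f‖ + ‖f'‖ ≤ a → ‖g‖ ≤ N' → ‖g‖ + ‖g'‖ ≤ a' →
      SqBound T C lam f g N a N' a')
    (hW : HasDyadicDecomposition A W) :
    (∃ M : ℝ, ∀ z : ℂ, z.re ∈ S → 0 < z.im → ‖W ∘L resolventOp T z ∘L W‖ ≤ M) ∧
    (∃ M : ℝ, ∀ z : ℂ, z.re ∈ S → z.im < 0 → ‖W ∘L resolventOp T z ∘L W‖ ≤ M) ∧
    (∃ G : ℝ → H →L[ℂ] H, TendstoUniformlyOn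
      (fun (ε : ℝ) (lam : ℝ) => W ∘L resolventOp T (lam - ε * Complex.I) ∘L W) G (𝓝[>] 0) S) ∧
    ∃ G : ℝ → H →L[ℂ] H, TendstoUniformlyOn
      (fun (ε : ℝ) (lam : ℝ) => W ∘L resolventOp T (lam + ε * Complex.I) ∘L W) G (𝓝[>] 0) S := by
  obtain ⟨⟨M, hM⟩, G, hG⟩ := limiting_absorption_upper hT hC hS hW
  have hWa : ContinuousLinearMap.adjoint W = W :=
    ((ContinuousLinearMap.eq_adjoint_iff _ _).2 hW.inner_left).symm
  -- `W` is self-adjoint, so the lower half-plane is the image of the upper one under the adjoint,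
  -- an isometry.
  have hadj : ∀ z : ℂ, z.im ≠ 0 → W ∘L resolventOp T (conj z) ∘L W
      = ContinuousLinearMap.adjoint (W ∘L resolventOp T z ∘L W) := by
    intro z hz
    rw [ContinuousLinearMap.adjoint_comp, ContinuousLinearMap.adjoint_comp, hWa,
      adjoint_resolventOp hT hz]
    rfl
  have hup : ∀ z : ℂ, z.re ∈ S → 0 < z.im → ‖W ∘L resolventOp T z ∘L W‖ ≤ M := by
    intro z hz him
    have := hM z.re hz z.im him
    rwa [Complex.re_add_im] at this
  refine ⟨⟨M, hup⟩, ⟨M, fun z hz him => ?_⟩,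
    ⟨fun lam => ContinuousLinearMap.adjoint (G lam), ?_⟩, G, hG⟩
  · have h1 : (conj z).im ≠ 0 := by simpa using him.ne
    have h2 := hadj (conj z) h1
    rw [Complex.conj_conj] at h2
    rw [h2, LinearIsometryEquiv.norm_map]
    exact hup (conj z) (by simpa using hz) (by simpa using him)
  · have h1 := (ContinuousLinearMap.adjoint (𝕜 := ℂ) (E := H) (F := H)).isometry.uniformContinuous
      |>.comp_tendstoUniformlyOn hG
    refine h1.congr ?_
    filter_upwards [self_mem_nhdsWithin] with ε hε lam _
    have h2 := hadj (lam + ε * Complex.I) (by simpa using (ne_of_gt hε))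
    simp only [Function.comp_apply]
    rw [← h2]
    simp [sub_eq_add_neg]

end Dyadic

/-! ### Dyadic decomposition of powers -/

/-- `max(t, 4⁻ⁿ)^{s/2-1}`, so that `t · dyadicPow s n t` converges to `t^{s/2}`. -/
def dyadicPow (s : ℝ) (n : ℕ) (t : ℝ) : ℝ := max t ((1 / 4) ^ n) ^ (s / 2 - 1)

/-- The differences of the functions `dyadicPow s n`. -/
def dyadicDiff (s : ℝ) : ℕ → ℝ → ℝ
  | 0 => dyadicPow s 0
  | n + 1 => fun t => dyadicPow s (n + 1) t - dyadicPow s n t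

theorem continuous_dyadicPow (s : ℝ) (n : ℕ) : Continuous (dyadicPow s n) :=
  (continuous_id.max continuous_const).rpow_const fun t =>
    Or.inl (lt_of_lt_of_le (by positivity) (le_max_right t _)).ne'

theorem continuous_dyadicDiff (s : ℝ) : ∀ n, Continuous (dyadicDiff s n)
  | 0 => continuous_dyadicPow s 0
  | n + 1 => (continuous_dyadicPow s (n + 1)).sub (continuous_dyadicPow s n)

theorem rpow_mul_le_of_mem_Icc {b r e : ℝ} (hb : 0 < b) (h1 : 1 ≤ r) (h4 : r ≤ 4) :
    (r * b) ^ e ≤ 4 ^ |e| * b ^ e := by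
  rw [Real.mul_rpow (by linarith) hb.le]
  refine mul_le_mul_of_nonneg_right ?_ (by positivity)
  calc r ^ e ≤ r ^ |e| := Real.rpow_le_rpow_of_exponent_le h1 (le_abs_self e)
    _ ≤ 4 ^ |e| := Real.rpow_le_rpow (by linarith) h4 (abs_nonneg e)

theorem mul_rpow_sub_one_self {x : ℝ} (hx : 0 < x) (e : ℝ) : x * x ^ (e - 1) = x ^ e := by
  rw [Real.rpow_sub_one hx.ne']
  field_simp

/-- Consecutive truncations agree above the larger threshold; below it both are powers of numbers
within a factor 4 of 4⁻ⁿ. The absolute value in |s/2 - 1| covers both signs of the exponent. -/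
theorem abs_dyadicDiff_le (s : ℝ) (n : ℕ) {t : ℝ} (ht1 : t ≤ 1) :
    |dyadicDiff s n t| ≤ 4 ^ |s / 2 - 1| * ((1 / 4 : ℝ) ^ n) ^ (s / 2 - 1) ∧
      (dyadicDiff s n t ≠ 0 → t ≤ 4 * (1 / 4) ^ n) := by
  cases n with
  | zero =>
    simp only [dyadicDiff, dyadicPow, pow_zero, max_eq_right ht1, Real.one_rpow, mul_one, abs_one]
    exact ⟨Real.one_le_rpow (by norm_num) (abs_nonneg _), fun _ => by linarith⟩
  | succ n =>
    set b : ℝ := (1 / 4) ^ (n + 1) with hb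
    have hb0 : 0 < b := by positivity
    have hbn : (1 / 4 : ℝ) ^ n = 4 * b := by rw [hb, pow_succ]; ring
    have hval : dyadicDiff s (n + 1) t = max t b ^ (s / 2 - 1) - max t (4 * b) ^ (s / 2 - 1) := by
      rw [← hbn]; rfl
    rw [hval]
    rcases le_or_gt (4 * b) t with h | h
    · rw [max_eq_left h, max_eq_left (by linarith), sub_self, abs_zero]
      exact ⟨by positivity, fun h => absurd rfl h⟩
    · refine ⟨?_, fun _ => h.le⟩
      have hm1 : b ≤ max t b := le_max_right _ _
      have hm4 : max t b ≤ 4 * b := max_le h.le (by linarith)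
      have h1 : max t b ^ (s / 2 - 1) ≤ 4 ^ |s / 2 - 1| * b ^ (s / 2 - 1) := by
        have := rpow_mul_le_of_mem_Icc (e := s / 2 - 1) hb0 ((one_le_div hb0).2 hm1)
          ((div_le_iff₀ hb0).2 hm4)
        rwa [div_mul_cancel₀ _ hb0.ne'] at this
      have h2 := rpow_mul_le_of_mem_Icc (e := s / 2 - 1) hb0 (r := 4) (by norm_num) le_rfl
      rw [max_eq_right h.le]
      have h3 : 0 ≤ max t b ^ (s / 2 - 1) := Real.rpow_nonneg (hb0.le.trans hm1) _
      have h4 : 0 ≤ (4 * b) ^ (s / 2 - 1) := by positivity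
      rw [abs_le]
      constructor <;> linarith

theorem abs_mul_dyadicDiff_le (s : ℝ) (n : ℕ) {t : ℝ} (ht : t ∈ Set.Icc (0 : ℝ) 1) :
    |t * dyadicDiff s n t| ≤ 4 * 4 ^ |s / 2 - 1| * ((1 / 4 : ℝ) ^ n) ^ (s / 2) := by
  obtain ⟨h1, h2⟩ := abs_dyadicDiff_le s n ht.2
  set b : ℝ := (1 / 4) ^ n
  have hb0 : 0 < b := by positivity
  have hbs : b ^ (s / 2) = b * b ^ (s / 2 - 1) := (mul_rpow_sub_one_self hb0 _).symm
  rcases eq_or_ne (dyadicDiff s n t) 0 with h0 | h0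
  · rw [h0, mul_zero, abs_zero]; positivity
  rw [abs_mul, abs_of_nonneg ht.1, hbs]
  calc t * |dyadicDiff s n t| ≤ 4 * b * (4 ^ |s / 2 - 1| * b ^ (s / 2 - 1)) :=
        mul_le_mul (h2 h0) h1 (abs_nonneg _) (by positivity)
    _ = _ := by ring

/-- Half of the factor t is used: √t times the difference has size (4⁻ⁿ)^((s-1)/2). This measures
`A` applied to the n-th piece. -/
theorem abs_dyadicDiff_mul_le (s : ℝ) (n : ℕ) {t : ℝ} (ht : t ∈ Set.Icc (0 : ℝ) 1) :
    |dyadicDiff s n t * (t * dyadicDiff s n t)|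
      ≤ (4 * 4 ^ |s / 2 - 1| * ((1 / 4 : ℝ) ^ n) ^ ((s - 1) / 2)) ^ 2 := by
  obtain ⟨h1, -⟩ := abs_dyadicDiff_le s n ht.2
  have h2 := abs_mul_dyadicDiff_le s n ht
  set b : ℝ := (1 / 4) ^ n
  have hb0 : 0 < b := by positivity
  have hbs : b ^ (s / 2 - 1) * b ^ (s / 2) = (b ^ ((s - 1) / 2)) ^ 2 := by
    rw [← Real.rpow_add hb0, ← Real.rpow_natCast, ← Real.rpow_mul hb0.le]
    congr 1
    push_cast
    ring
  rw [abs_mul]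
  calc _ ≤ (4 ^ |s / 2 - 1| * b ^ (s / 2 - 1)) * (4 * 4 ^ |s / 2 - 1| * b ^ (s / 2)) :=
        mul_le_mul h1 h2 (abs_nonneg _) (by positivity)
    _ = 4 * (4 ^ |s / 2 - 1|) ^ 2 * (b ^ (s / 2 - 1) * b ^ (s / 2)) := by ring
    _ = 4 * ((4 ^ |s / 2 - 1|) ^ 2 * (b ^ ((s - 1) / 2)) ^ 2) := by rw [hbs]; ring
    _ ≤ 16 * ((4 ^ |s / 2 - 1|) ^ 2 * (b ^ ((s - 1) / 2)) ^ 2) := by gcongr; norm_num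
    _ = _ := by ring

theorem abs_mul_dyadicPow_sub_le {s : ℝ} (hs : 0 < s) (n : ℕ) {t : ℝ} (ht : 0 ≤ t) :
    |t * dyadicPow s n t - t ^ (s / 2)| ≤ ((1 / 4 : ℝ) ^ n) ^ (s / 2) := by
  rw [dyadicPow]
  set b : ℝ := (1 / 4) ^ n
  have hb0 : 0 < b := by positivity
  rcases le_or_gt b t with h | h
  · rw [max_eq_left h, mul_rpow_sub_one_self (hb0.trans_le h), sub_self, abs_zero]
    positivity
  · rw [max_eq_right h.le]
    have h1 : t * b ^ (s / 2 - 1) ≤ b ^ (s / 2) := by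
      rw [← mul_rpow_sub_one_self hb0 (s / 2)]
      gcongr
    have h2 : t ^ (s / 2) ≤ b ^ (s / 2) := Real.rpow_le_rpow ht h.le (by linarith)
    have h3 : 0 ≤ t * b ^ (s / 2 - 1) := by positivity
    have h4 : 0 ≤ t ^ (s / 2) := by positivity
    rw [abs_le]
    constructor <;> linarith

theorem tendsto_dyadic_rpow {e : ℝ} (he : 0 < e) :
    Tendsto (fun n : ℕ => ((1 / 4 : ℝ) ^ n) ^ e) atTop (𝓝 0) := by
  have h := (tendsto_pow_atTop_nhds_zero_of_lt_one (r := (1 / 4 : ℝ)) (by norm_num)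
    (by norm_num)).rpow_const (p := e) (Or.inr he.le)
  rwa [Real.zero_rpow he.ne'] at h

/-! ### Dyadic decomposition in a functional calculus -/

section Calculus

variable {H : Type*} [NormedAddCommGroup H] [InnerProductSpace ℂ H]

/-- Powers of a nonnegative contraction `M' M`, taken in a functional calculus `Φ`, have a dyadic
decomposition if the range of `M'` is in the domain of `A`. -/
theorem hasDyadicDecomposition_of_calculus {A : H →ₗ.[ℂ] H} {M M' : H →L[ℂ] H} {c s : ℝ}
    (hc : 0 ≤ c) (hs : 1 / 2 < s) {Φ : (ℝ → ℝ) → H →L[ℂ] H}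
    (hsub : ∀ f g : ℝ → ℝ, Continuous f → ContinuousOn g (Set.Icc 0 1) →
      Φ (fun t => f t - g t) = Φ f - Φ g)
    (hmul : ∀ f g : ℝ → ℝ, Continuous f → Continuous g →
      Φ (fun t => f t * g t) = Φ f ∘L Φ g)
    (hsym : ∀ f : ℝ → ℝ, Continuous f → ∀ u v : H, inner ℂ (Φ f u) v = inner ℂ u (Φ f v))
    (hbound : ∀ f : ℝ → ℝ, ContinuousOn f (Set.Icc 0 1) → ∀ C : ℝ, 0 ≤ C →
      (∀ t ∈ Set.Icc (0 : ℝ) 1, |f t| ≤ C) → ‖Φ f‖ ≤ C)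
    (hid : Φ (fun t => t) = M' ∘L M)
    (hM : ∀ u v : H, inner ℂ (M u) v = inner ℂ u (M' v))
    (hA : ∀ h : H, ∃ f, (M' h, f) ∈ A.graph ∧ ‖f‖ ≤ c * ‖h‖) :
    HasDyadicDecomposition A (Φ fun t => t ^ (s / 2)) := by
  set K : ℝ := 4 * 4 ^ |s / 2 - 1| with hK
  have hK0 : 0 < K := by positivity
  have hyc := continuous_dyadicDiff s
  have htc : ∀ n, Continuous fun t => t * dyadicDiff s n t := fun n => continuous_id.mul (hyc n)
  have hqc : ∀ n, Continuous fun t => t * dyadicPow s n t := fun n =>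
    continuous_id.mul (continuous_dyadicPow s n)
  have hb0 : ∀ n : ℕ, (0 : ℝ) < (1 / 4) ^ n := fun n => by positivity
  have hb1 : ∀ n : ℕ, ((1 : ℝ) / 4) ^ n ≤ 1 := fun n => pow_le_one₀ (by norm_num) (by norm_num)
  -- With t in the role of ⟨A⟩⁻² or ⟨x⟩⁻², piece n lives where t ≤ 4·4⁻ⁿ. Its norm is of order
  -- 2^(-ns), and its norm after applying `A` of order 2^(-n(s-1)). The geometric mean has ratio
  -- 2^(-(s-1/2)), which is below 1 exactly when s > 1/2.
  refine ⟨fun n => Φ fun t => t * dyadicDiff s n t,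
    fun n => K * ((1 / 4 : ℝ) ^ n) ^ (s / 2),
    fun n => (1 + c) * (K * ((1 / 4 : ℝ) ^ n) ^ ((s - 1) / 2)),
    √(1 + c) * K, (1 / 4 : ℝ) ^ ((s - 1 / 2) / 2), by positivity,
    Real.rpow_lt_one (by norm_num) (by norm_num) (by linarith), by positivity,
    fun n => ⟨by positivity, ?_, ?_⟩, fun n => hsym _ (htc n), fun n u hu => ?_, ?_⟩
  · have h1 : ((1 / 4 : ℝ) ^ n) ^ (s / 2) ≤ ((1 / 4 : ℝ) ^ n) ^ ((s - 1) / 2) :=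
      Real.rpow_le_rpow_of_exponent_ge (hb0 n) (hb1 n) (by linarith)
    calc K * ((1 / 4 : ℝ) ^ n) ^ (s / 2) ≤ K * ((1 / 4 : ℝ) ^ n) ^ ((s - 1) / 2) :=
          mul_le_mul_of_nonneg_left h1 hK0.le
      _ ≤ _ := le_mul_of_one_le_left (by positivity) (by linarith)
  · have h1 : ((1 / 4 : ℝ) ^ n) ^ (s / 2) * ((1 / 4 : ℝ) ^ n) ^ ((s - 1) / 2)
        = (((1 / 4 : ℝ) ^ ((s - 1 / 2) / 2)) ^ n) ^ 2 := by
      rw [Real.rpow_pow_comm (by norm_num), ← Real.rpow_add (hb0 n), ← Real.rpow_mul_natCast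
        (hb0 n).le]
      congr 1
      push_cast
      ring
    have h2 : √(1 + c) ^ 2 = 1 + c := Real.sq_sqrt (by linarith)
    have h3 : K * ((1 / 4 : ℝ) ^ n) ^ (s / 2) * ((1 + c) * (K * ((1 / 4 : ℝ) ^ n) ^ ((s - 1) / 2)))
        = (√(1 + c) * K * ((1 / 4 : ℝ) ^ ((s - 1 / 2) / 2)) ^ n) ^ 2 := by
      rw [mul_pow, mul_pow, h2, ← h1]
      ring
    have h4 : (0 : ℝ) ≤ √(1 + c) * K * ((1 / 4 : ℝ) ^ ((s - 1 / 2) / 2)) ^ n := by positivity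
    rw [h3, Real.sqrt_sq h4]
  · have h1 : ‖Φ fun t => t * dyadicDiff s n t‖ ≤ K * ((1 / 4 : ℝ) ^ n) ^ (s / 2) :=
      hbound _ (htc n).continuousOn _ (by positivity) fun t ht => abs_mul_dyadicDiff_le s n ht
    have h2 : ‖Φ (fun t => t * dyadicDiff s n t) u‖ ≤ K * ((1 / 4 : ℝ) ^ n) ^ (s / 2) :=
      ((Φ fun t => t * dyadicDiff s n t).le_of_opNorm_le h1 u).trans
        (mul_le_of_le_one_right (by positivity) hu)
    have h3 : Φ (fun t => t * dyadicDiff s n t) u = M' (M (Φ (dyadicDiff s n) u)) := by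
      rw [hmul (fun t => t) _ continuous_id (hyc n), hid]
      rfl
    obtain ⟨f, hf, hfc⟩ := hA (M (Φ (dyadicDiff s n) u))
    rw [← h3] at hf
    refine ⟨h2, f, hf, ?_⟩
    -- The piece is M'M Φ(diff), where M' is spent on entering the domain of `A`. The rest is
    -- measured by ‖Mv‖² = ⟨v, M'Mv⟩, which restores one factor t inside the calculus.
    have h4 : ‖M (Φ (dyadicDiff s n) u)‖ ^ 2
        ≤ (K * ((1 / 4 : ℝ) ^ n) ^ ((s - 1) / 2)) ^ 2 := by
      have e1 : (inner ℂ (M (Φ (dyadicDiff s n) u)) (M (Φ (dyadicDiff s n) u)) : ℂ)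
          = inner ℂ u (Φ (fun t => dyadicDiff s n t * (t * dyadicDiff s n t)) u) := by
        rw [hM, ← h3, hsym _ (hyc n), hmul _ _ (hyc n) (htc n)]
        rfl
      rw [← inner_self_eq_norm_sq (𝕜 := ℂ), e1]
      refine (RCLike.re_le_norm _).trans ((norm_inner_le_norm _ _).trans ?_)
      have e2 := hbound (fun t => dyadicDiff s n t * (t * dyadicDiff s n t))
        ((hyc n).mul (htc n)).continuousOn _ (sq_nonneg _)
        fun t ht => abs_dyadicDiff_mul_le s n ht
      have e3 := (Φ fun t => dyadicDiff s n t * (t * dyadicDiff s n t)).le_of_opNorm_le e2 u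
      rw [← hK] at e3
      calc _ ≤ 1 * ((K * ((1 / 4 : ℝ) ^ n) ^ ((s - 1) / 2)) ^ 2 * 1) := by
            refine mul_le_mul hu (e3.trans ?_) (norm_nonneg _) zero_le_one
            gcongr
        _ = _ := by ring
    have h5 := (pow_le_pow_iff_left₀ (norm_nonneg _) (by positivity) two_ne_zero).1 h4
    have h6 : K * ((1 / 4 : ℝ) ^ n) ^ (s / 2) ≤ K * ((1 / 4 : ℝ) ^ n) ^ ((s - 1) / 2) := by
      have := Real.rpow_le_rpow_of_exponent_ge (hb0 n) (hb1 n)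
        (show (s - 1) / 2 ≤ s / 2 by linarith)
      gcongr
    calc _ ≤ K * ((1 / 4 : ℝ) ^ n) ^ ((s - 1) / 2)
          + c * (K * ((1 / 4 : ℝ) ^ n) ^ ((s - 1) / 2)) :=
          add_le_add (h2.trans h6) (hfc.trans (by gcongr))
      _ = _ := by ring
  -- The first n + 1 pieces telescope to t times `dyadicPow s n`, hence the shift of index.
  · rw [← tendsto_add_atTop_iff_nat 1]
    have hsum : ∀ n, ∑ i ∈ Finset.range (n + 1), (Φ fun t => t * dyadicDiff s i t)
        = Φ fun t => t * dyadicPow s n t := by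
      intro n
      induction n with
      | zero => rw [Finset.sum_range_one]; rfl
      | succ n ih =>
        rw [Finset.sum_range_succ, ih, ← eq_sub_iff_add_eq', ← hsub _ _ (hqc _)
          (hqc n).continuousOn]
        congr 1
        funext t
        simp only [dyadicDiff]
        ring
    simp only [hsum]
    rw [tendsto_iff_norm_sub_tendsto_zero]
    have hsc : Continuous fun t : ℝ => t ^ (s / 2) :=
      continuous_id.rpow_const fun _ => Or.inr (by linarith)
    refine squeeze_zero (fun _ => norm_nonneg _) (fun n => ?_)
      (tendsto_dyadic_rpow (show 0 < s / 2 by linarith))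
    rw [← hsub _ _ (hqc n) hsc.continuousOn]
    exact hbound _ ((hqc n).sub hsc).continuousOn _ (by positivity) fun t ht =>
      abs_mul_dyadicPow_sub_le (by linarith) n ht.1

/-! ### The weight `⟨A⟩^{-s}` -/

/-- Here M = (A - i)⁻¹ and M' = (A + i)⁻¹, so that M'M = ⟨A⟩⁻². The identity A(A + i)⁻¹ = 1 - i(A +
i)⁻¹ gives the constant 2. -/
theorem hasDyadicDecomposition_japaneseOp [CompleteSpace H] {A : H →ₗ.[ℂ] H}
    (hA : IsSelfAdjoint A) {s : ℝ}
    (hs : 1 / 2 < s) : HasDyadicDecomposition A (japaneseOp A s) := by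
  have hI : Complex.I.im ≠ 0 := by simp
  have hI' : (-Complex.I).im ≠ 0 := by simp
  have hconj : conj Complex.I = -Complex.I := Complex.conj_I
  set R := resolventOp A Complex.I with hR
  set R' := resolventOp A (-Complex.I) with hR'
  have hadj : ∀ u v, inner ℂ (R u) v = inner ℂ u (R' v) := fun u v => by
    rw [hR, inner_resolventOp_left hA hI, hconj]
  have hR1 : ∀ u, ‖R u‖ ≤ ‖u‖ := fun u => by simpa using norm_resolventOp_le hA hI u
  have hR1' : ∀ u, ‖R' u‖ ≤ ‖u‖ := fun u => by simpa using norm_resolventOp_le hA hI' u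
  have hpos : (R' ∘L R).IsPositive := by
    have h1 : ContinuousLinearMap.adjoint R = R' := by
      rw [hR, adjoint_resolventOp hA hI, hconj]
    rw [← h1]
    exact ContinuousLinearMap.isPositive_adjoint_comp_self R
  have hsa : IsSelfAdjoint (R' ∘L R) := hpos.isSelfAdjoint
  have hspec : spectrum ℝ (R' ∘L R) ⊆ Set.Icc 0 1 := by
    intro t ht
    refine ⟨spectrum_nonneg_of_nonneg ((ContinuousLinearMap.nonneg_iff_isPositive _).2 hpos) ht, ?_⟩
    have h1 := spectrum.norm_le_norm_mul_of_mem ht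
    have h2 : ‖R' ∘L R‖ ≤ 1 := ContinuousLinearMap.opNorm_le_bound _ zero_le_one fun u => by
      rw [one_mul]; exact (hR1' _).trans (hR1 u)
    have h3 : ‖(1 : H →L[ℂ] H)‖ ≤ 1 := ContinuousLinearMap.norm_id_le
    calc t ≤ ‖t‖ := le_abs_self t
      _ ≤ 1 * 1 := h1.trans (mul_le_mul h2 h3 (norm_nonneg _) zero_le_one)
      _ = 1 := one_mul 1
  refine hasDyadicDecomposition_of_calculus (M := R) (M' := R') (c := 2) (s := s)
    (Φ := fun f => cfc f (R' ∘L R)) (by norm_num) hs (fun f g hf hg => ?_) (fun f g hf hg => ?_)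
    (fun f hf u v => ?_) (fun f hf C hC hfC => ?_) ?_ hadj (fun h => ?_)
  · exact cfc_sub f g _ hf.continuousOn (hg.mono hspec)
  · exact cfc_mul f g _ hf.continuousOn hg.continuousOn
  · have h1 : IsSelfAdjoint (cfc f (R' ∘L R)) := cfc_predicate f _
    exact h1.isSymmetric u v
  · exact norm_cfc_le hC fun t ht => hfC t (hspec ht)
  · exact cfc_id' ℝ _
  · obtain ⟨hd, he⟩ := (isResolventAt_of_isSelfAdjoint hA hI').1 h
    refine ⟨A ⟨R' h, hd⟩, A.mem_graph ⟨R' h, hd⟩, ?_⟩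
    have h1 : A ⟨R' h, hd⟩ = h + -Complex.I • R' h := sub_eq_iff_eq_add.1 he
    rw [h1]
    refine (norm_add_le _ _).trans ?_
    rw [norm_smul, norm_neg, Complex.norm_I, one_mul]
    linarith [hR1' h]

end Calculus

/-! ### The weight `⟨x⟩^{-s}` -/

/-- The function `⟨x⟩^{-2}`. -/
def weightSq (d : ℕ) (x : E d) : ℝ := (1 + ‖x‖ ^ 2)⁻¹

/-- The function `⟨x⟩^{-1}`. -/
def weight (d : ℕ) (x : E d) : ℝ := (1 + ‖x‖ ^ 2) ^ (-(1 / 2) : ℝ)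

theorem weightSq_mem (d : ℕ) (x : E d) : weightSq d x ∈ Set.Icc (0 : ℝ) 1 :=
  ⟨by unfold weightSq; positivity, inv_le_one_of_one_le₀ (by nlinarith [sq_nonneg ‖x‖])⟩

theorem continuous_weightSq (d : ℕ) : Continuous (weightSq d) :=
  Continuous.inv₀ (by fun_prop) fun x => by positivity

theorem hasTemperateGrowth_weight (d : ℕ) : (weight d).HasTemperateGrowth :=
  Function.hasTemperateGrowth_one_add_norm_sq_rpow (E d) _

theorem weight_mul_self (d : ℕ) (x : E d) : weight d x * weight d x = weightSq d x := by
  have h : (0 : ℝ) < 1 + ‖x‖ ^ 2 := by positivity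
  rw [weight, weightSq, ← Real.rpow_add h, ← Real.rpow_neg_one]
  norm_num

theorem weight_nonneg (d : ℕ) (x : E d) : 0 ≤ weight d x := by
  unfold weight; positivity

theorem norm_mul_weight_le (d : ℕ) (x : E d) : ‖x‖ * weight d x ≤ 1 := by
  have h1 := weight_mul_self d x
  have h2 := weight_nonneg d x
  have h3 : weightSq d x * (1 + ‖x‖ ^ 2) = 1 := inv_mul_cancel₀ (by positivity)
  have h4 : (‖x‖ * weight d x) ^ 2 ≤ 1 := by nlinarith [(weightSq_mem d x).1]
  exact (abs_le_one_iff_mul_self_le_one.2 (by nlinarith)) |> (le_abs_self _).trans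

theorem abs_weight_le (d : ℕ) (x : E d) : |weight d x| ≤ 1 := by
  rw [abs_of_nonneg (weight_nonneg d x)]
  have h1 := weight_mul_self d x
  have h2 := weight_nonneg d x
  nlinarith [(weightSq_mem d x).2]

theorem memLp_weight (d : ℕ) :
    MemLp (fun x : E d => ((weight d x : ℝ) : ℂ)) ∞ (volume : Measure (E d)) :=
  memLp_top_ofReal (hasTemperateGrowth_weight d).1.continuous (abs_weight_le d)

theorem norm_toL2_schwartzA_weight_le (k d : ℕ) (u : 𝓢(E d, ℂ)) :
    ‖toL2 d (schwartzA k d (mulS (fun x => ((weight d x : ℝ) : ℂ)) u))‖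
      ≤ 3 * d * ‖toL2 d u‖ := by
  have hw := hasTemperateGrowth_ofReal (hasTemperateGrowth_weight d)
  refine (norm_toL2_schwartzA_le k d _).trans ?_
  have h1 : ∀ j : Fin d, 2 * ‖toL2 d (mulS (coord j) (mulS (fun x => ((weight d x : ℝ) : ℂ)) u))‖
      + ‖toL2 d (mulS (fun x => ((weight d x : ℝ) : ℂ)) u)‖ ≤ 3 * ‖toL2 d u‖ := by
    intro j
    have h2 := norm_toL2_mulS_le hw (C := 1)
      (fun x => by rw [Complex.norm_real]; exact abs_weight_le d x) u
    have h3 := norm_toL2_mulS_le ((hasTemperateGrowth_coord j).fun_mul hw) (C := 1)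
      (fun x => by
        rw [norm_mul, Complex.norm_real, Real.norm_of_nonneg (weight_nonneg d x)]
        exact (mul_le_mul_of_nonneg_right (norm_coord_le j x) (weight_nonneg d x)).trans
          (norm_mul_weight_le d x)) u
    rw [mulS_mulS (hasTemperateGrowth_coord j) hw]
    linarith
  refine (Finset.sum_le_sum fun j _ => h1 j).trans_eq ?_
  simp
  ring

/-- `A` is bounded by |x| up to bounded terms, so A⟨x⟩⁻¹ is bounded on Schwartz functions;
closedness of `opA k d` extends this to all of L². -/
theorem exists_graph_opA_weight (k d : ℕ) (h : L2 d) :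
    ∃ f, (mulOp (fun x => ((weight d x : ℝ) : ℂ)) h, f) ∈ (opA k d).graph ∧
      ‖f‖ ≤ 3 * d * ‖h‖ := by
  have hw := hasTemperateGrowth_ofReal (hasTemperateGrowth_weight d)
  obtain ⟨x, hx, hlim⟩ := mem_closure_iff_seq_limit.1 (denseRange_toL2 d h)
  choose u hu using hx
  set f : ℕ → L2 d := fun n =>
    toL2 d (schwartzA k d (mulS (fun x => ((weight d x : ℝ) : ℂ)) (u n))) with hf
  have hdist : ∀ n m, dist (f n) (f m) ≤ 3 * d * dist (x n) (x m) := by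
    intro n m
    rw [dist_eq_norm, dist_eq_norm, hf]
    simp only
    rw [← map_sub, ← map_sub, ← map_sub, ← hu, ← hu, ← map_sub]
    exact norm_toL2_schwartzA_weight_le k d _
  have hcs : CauchySeq f := by
    have h1 := hlim.cauchySeq
    rw [cauchySeq_iff_tendsto_dist_atTop_0] at h1 ⊢
    refine squeeze_zero (fun _ => dist_nonneg) (fun p => hdist p.1 p.2) ?_
    simpa using h1.const_mul (3 * (d : ℝ))
  obtain ⟨y, hy⟩ := cauchySeq_tendsto_of_complete hcs
  refine ⟨y, ?_, ?_⟩
  · have hcl : IsClosed ((opA k d).graph : Set (L2 d × L2 d)) := (isSelfAdjoint_opA k d).isClosed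
    refine hcl.mem_of_tendsto
      ((((mulOp fun x => ((weight d x : ℝ) : ℂ)).continuous.tendsto h).comp hlim).prodMk_nhds hy)
      (.of_forall fun n => ?_)
    simp only [Function.comp_apply]
    rw [← hu n, mulOp_toL2 (memLp_weight d) hw, graph_opA]
    exact mem_closure_graph_onTest _ _
  · refine le_of_tendsto_of_tendsto' hy.norm (hlim.norm.const_mul (3 * (d : ℝ))) fun n => ?_
    rw [← hu n]
    exact norm_toL2_schwartzA_weight_le k d _

theorem memLp_comp_weightSq {d : ℕ} {f : ℝ → ℝ} (hf : ContinuousOn f (Set.Icc 0 1)) :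
    MemLp (fun x : E d => ((f (weightSq d x) : ℝ) : ℂ)) ∞ (volume : Measure (E d)) := by
  obtain ⟨C, hC⟩ := isCompact_Icc.exists_bound_of_continuousOn hf
  exact memLp_top_ofReal (hf.comp_continuous (continuous_weightSq d) (weightSq_mem d))
    fun x => hC _ (weightSq_mem d x)

/-- The calculus is composition with ⟨x⟩⁻² followed by multiplication, and M = M' = ⟨x⟩⁻¹. -/
theorem hasDyadicDecomposition_japaneseX (k d : ℕ) {s : ℝ} (hs : 1 / 2 < s) :
    HasDyadicDecomposition (opA k d) (japaneseX d s) := by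
  have hJ : japaneseX d s
      = mulOp fun x : E d => (((weightSq d x) ^ (s / 2) : ℝ) : ℂ) := by
    rw [japaneseX]
    congr 1
    funext x
    have h : (0 : ℝ) ≤ 1 + ‖x‖ ^ 2 := by positivity
    rw [weightSq, Real.inv_rpow h, ← Real.rpow_neg h]
    ring_nf
  rw [hJ]
  have hm := fun {f : ℝ → ℝ} (hf : ContinuousOn f (Set.Icc 0 1)) => memLp_comp_weightSq (d := d) hf
  refine hasDyadicDecomposition_of_calculus (M := mulOp fun x => ((weight d x : ℝ) : ℂ))
    (M' := mulOp fun x => ((weight d x : ℝ) : ℂ)) (c := 3 * d) (s := s)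
    (Φ := fun f => mulOp fun x => ((f (weightSq d x) : ℝ) : ℂ)) (by positivity) hs
    (fun f g hf hg => ?_) (fun f g hf hg => ?_)
    (fun f hf u v => inner_mulOp (hm hf.continuousOn) u v) (fun f hf C hC hfC => ?_) ?_
    (inner_mulOp (memLp_weight d)) (exists_graph_opA_weight k d)
  · ext1 u
    refine Lp.ext ?_
    rw [sub_apply]
    filter_upwards [mulOp_apply (hm (hf.continuousOn.sub hg)) u, mulOp_apply (hm hf.continuousOn) u,
      mulOp_apply (hm hg) u, Lp.coeFn_sub (mulOp (fun x => ((f (weightSq d x) : ℝ) : ℂ)) u)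
        (mulOp (fun x => ((g (weightSq d x) : ℝ) : ℂ)) u)] with x h1 h2 h3 h4
    rw [h4, Pi.sub_apply, h2, h3]
    refine h1.trans ?_
    simp [sub_mul]
  · ext1 u
    refine Lp.ext ?_
    rw [ContinuousLinearMap.comp_apply]
    filter_upwards [mulOp_apply (hm (hf.mul hg).continuousOn) u,
      mulOp_apply (hm hf.continuousOn) (mulOp (fun x => ((g (weightSq d x) : ℝ) : ℂ)) u),
      mulOp_apply (hm hg.continuousOn) u] with x h1 h2 h3
    rw [h2, h3]
    refine h1.trans ?_
    simp [mul_assoc]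
  · exact ContinuousLinearMap.opNorm_le_bound _ hC fun u =>
      norm_mulOp_apply_le (hm hf) (fun x => by
        rw [Complex.norm_real]; exact hfC _ (weightSq_mem d x)) u
  · ext1 u
    refine Lp.ext ?_
    rw [ContinuousLinearMap.comp_apply]
    filter_upwards [mulOp_apply (hm continuous_id.continuousOn) u,
      mulOp_apply (memLp_weight d) (mulOp (fun x => ((weight d x : ℝ) : ℂ)) u),
      mulOp_apply (memLp_weight d) u] with x h1 h2 h3
    rw [h2, h3, ← mul_assoc, ← Complex.ofReal_mul, weight_mul_self]
    exact h1

end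

end UltraHyp

/-! ### The theorem -/

theorem proposition2p2 (d k : ℕ) (hd : 2 ≤ d) (hk : k ≤ d)
    (I : Set ℝ) (hI : I.OrdConnected) (hIc : IsCompact (closure I)) (hI0 : (0 : ℝ) ∉ closure I)
    (s : ℝ) (hs : 1 / 2 < s) :
    -- `P` and `A` are essentially self-adjoint on `C_c^∞`
    UltraHyp.IsEssentiallySelfAdjoint (UltraHyp.opP₀ k d) ∧
    UltraHyp.IsEssentiallySelfAdjoint (UltraHyp.opA₀ k d) ∧
    -- for the weights `W = ⟨A⟩^{-s}` and `W = ⟨x⟩^{-s}`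
    ∀ W : UltraHyp.L2 d →L[ℂ] UltraHyp.L2 d,
      (W = UltraHyp.japaneseOp (UltraHyp.opA k d) s ∨ W = UltraHyp.japaneseX d s) →
      -- uniform bounds in both half-strips
      (∃ C : ℝ, ∀ z : ℂ, z.re ∈ I → 0 < z.im →
        ‖W ∘L UltraHyp.resolventOp (UltraHyp.opP k d) z ∘L W‖ ≤ C) ∧
      (∃ C : ℝ, ∀ z : ℂ, z.re ∈ I → z.im < 0 →
        ‖W ∘L UltraHyp.resolventOp (UltraHyp.opP k d) z ∘L W‖ ≤ C) ∧
      -- norm limits `W (P - λ + i0)⁻¹ W` and `W (P - λ - i0)⁻¹ W`, uniform in `λ ∈ I`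
      (∃ G : ℝ → UltraHyp.L2 d →L[ℂ] UltraHyp.L2 d,
        TendstoUniformlyOn
          (fun (ε : ℝ) (lam : ℝ) =>
            W ∘L UltraHyp.resolventOp (UltraHyp.opP k d) (lam - ε * Complex.I) ∘L W)
          G (𝓝[>] 0) I) ∧
      (∃ G : ℝ → UltraHyp.L2 d →L[ℂ] UltraHyp.L2 d,
        TendstoUniformlyOn
          (fun (ε : ℝ) (lam : ℝ) =>
            W ∘L UltraHyp.resolventOp (UltraHyp.opP k d) (lam + ε * Complex.I) ∘L W)
          G (𝓝[>] 0) I) := by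
  refine ⟨UltraHyp.isEssentiallySelfAdjoint_opP₀ k d, UltraHyp.isEssentiallySelfAdjoint_opA₀ k d,
    fun W hW => ?_⟩
  have hdec : UltraHyp.HasDyadicDecomposition (UltraHyp.opA k d) W := by
    rcases hW with rfl | rfl
    · exact UltraHyp.hasDyadicDecomposition_japaneseOp (UltraHyp.isSelfAdjoint_opA k d) hs
    · exact UltraHyp.hasDyadicDecomposition_japaneseX k d hs
  -- The constant of the commutator estimate depends on λ only through a lower and an upper bound
  -- for |λ|; both exist since the closure of `I` is compact and omits 0.
  obtain ⟨δ, hδ, hδI⟩ : ∃ δ : ℝ, 0 < δ ∧ ∀ lam ∈ I, δ ≤ |lam| := by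
    obtain ⟨δ, hδ, h⟩ := Metric.isOpen_iff.1 isClosed_closure.isOpen_compl 0 hI0
    refine ⟨δ, hδ, fun lam hlam => ?_⟩
    by_contra hlt
    exact h (by simpa using hlt) (subset_closure hlam)
  obtain ⟨L, hL⟩ := hIc.isBounded.exists_norm_le
  obtain ⟨C, hC, hb⟩ := UltraHyp.exists_sqBound_opP k d hδ (abs_nonneg L)
  exact UltraHyp.limiting_absorption (UltraHyp.isSelfAdjoint_opP k d) hC
    (fun lam hlam => hb lam (hδI lam hlam)
      ((hL lam (subset_closure hlam)).trans (le_abs_self L))) hdec
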